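/- Let $X$ be a connected locally finite graph, i.e. a connected, locally finite CW complex of dimension at most $1$. Let $\partial X=\varprojlim_{K}\pi_0(X\smallsetminus K)$ ($K\subseteq X$ compact, each $\pi_0(X\smallsetminus K)$ discrete) be its space of ends and $\hat X=X\sqcup\partial X$ its end (Freudenthal) compactification, whose topology is generated by the open subsets of $X$ together with the sets $\hat U$, for $U$ a component of $X\smallsetminus K$ with $K$ compact, where $\hat U$ is the union of $U$ and the set of ends that map to $U$. Every proper map $f:X\to X$ extends to a continuous map $\hat f:\hat X\to\hat X$ with $\hat f(\partial X)\subseteq\partial X$. Let $X_g\subseteq X$ be the core of $X$, i.e. the smallest subgraph containing all immersed loops (locally injective continuous maps $S^1\to X$), and let $\partial X_g\subseteq\partial X$ be the image of the space of ends of $X_g$ under the map induced by the inclusion. Let $\mathrm{Maps}(X)$ be the group of proper homotopy equivalences of $X$ up to proper homotopy. Let $PH(X)$ be the set of pairs $(\hat f,\hat g)$, where $f,g:X\to X$ are proper maps such that $fg$ and $gf$ are properly homotopic to the identity, with the subspace topology from $C(\hat X,\hat X)\times C(\hat X,\hat X)$ (compact-open topology on each factor), and give $\mathrm{Maps}(X)$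 the quotient topology with respect to $PH(X)\to\mathrm{Maps}(X)$, $(\hat f,\hat g)\mapsto[f]$. Let $\mathrm{Homeo}(\partial X)$ be the group of homeomorphisms of $\partial X$ with the compact-open topology, and let $\mathrm{Homeo}(\partial X,\partial X_g)$ be the subgroup of those $h$ with $h(\partial X_g)=\partial X_g$, with the subspace topology. Then for every $[f]\in\mathrm{Maps}(X)$ the map $\hat f|_{\partial X}$ is a homeomorphism of $\partial X$ that depends only on $[f]$ and maps $\partial X_g$ onto itself, and the homomorphism $$\sigma:\mathrm{Maps}(X)\to\mathrm{Homeo}(\partial X,\partial X_g),\qquad [f]\mapsto \hat f|_{\partial X},$$ is continuous and open. In particular, if $X$ is a tree (contains no embedded circle), then $\sigma:\mathrm{Maps}(X)\to\mathrm{Homeo}(\partial X)$ is an isomorphism of topological groups, i.e. a group isomorphism that is also a homeomorphism. -/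

import Mathlib

open Set Topology TopologicalSpace

noncomputable section

namespace LocallyFiniteGraph

universe u v w

/-! ### Graphs -/

section Graphs

variable (X : Type u) [TopologicalSpace X] [CWComplex (univ : Set X)]

/-- A CW structure on `X` makes `X` a locally finite graph when there are no cells of dimension
at least two, and every point has a neighbourhood meeting only finitely many closed cells. -/
structure IsLocallyFiniteGraph : Prop where
  isEmpty_cell : ∀ n, 2 ≤ n → IsEmpty (RelCWComplex.cell (univ : Set X) n)
  locallyFinite : LocallyFinite
    (fun c : (Σ n, RelCWComplex.cell (univ : Set X) n) ↦ RelCWComplex.closedCell c.1 c.2)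

/-- An immersed loop: a locally injective continuous map from the circle. -/
def IsImmersedLoop {Y : Type u} [TopologicalSpace Y] (γ : C(Circle, Y)) : Prop :=
  IsLocallyInjective γ

/-- A graph is a tree when it contains no embedded circle (used for connected `X`). -/
def IsTree (Y : Type u) [TopologicalSpace Y] : Prop :=
  ∀ γ : C(Circle, Y), ¬ Function.Injective γ

/-- The subgraph `E` contains the image of every immersed loop of `X`. -/
def ContainsImmersedLoops (E : RelCWComplex.Subcomplex (univ : Set X)) : Prop :=
  ∀ γ : C(Circle, X), IsImmersedLoop γ → range γ ⊆ (E : Set X)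

/-- The core `X_g`: the smallest subgraph that contains all immersed loops, constructed as the
intersection of all such subgraphs. -/
def core [T2Space X] : RelCWComplex.Subcomplex (univ : Set X) where
  carrier := ⋂ (E : RelCWComplex.Subcomplex (univ : Set X)) (_ : ContainsImmersedLoops X E), (E : Set X)
  I n := {i | ∀ E : RelCWComplex.Subcomplex (univ : Set X), ContainsImmersedLoops X E → i ∈ E.I n}
  closed' := isClosed_iInter fun E ↦ isClosed_iInter fun _ ↦ E.closed
  union' := by
    rw [empty_union]
    apply subset_antisymm
    · refine iUnion_subset fun n ↦ iUnion_subset fun i ↦ subset_iInter₂ fun E hE ↦ ?_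
      exact RelCWComplex.Subcomplex.openCell_subset_of_mem E (i.2 E hE)
    · intro x hx
      have hx' : x ∈ (univ : Set X) := mem_univ x
      rw [← CWComplex.iUnion_openCell_eq_complex (C := (univ : Set X))] at hx'
      simp only [mem_iUnion] at hx' ⊢
      obtain ⟨n, i, hi⟩ := hx'
      refine ⟨n, ⟨i, fun E hE ↦ ?_⟩, hi⟩
      by_contra hn
      exact (RelCWComplex.Subcomplex.disjoint_openCell_subcomplex_of_not_mem E hn).notMem_of_mem_left
        hi (mem_iInter₂.1 hx E hE)

end Graphs

/-! ### Proper maps and proper homotopies -/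

/-- Proper continuous maps. -/
structure ProperMap (X : Type u) (Y : Type v) [TopologicalSpace X] [TopologicalSpace Y] where
  map : C(X, Y)
  proper : IsProperMap map

section Proper

open unitInterval

variable {X : Type u} {Y : Type v} {Z : Type w} [TopologicalSpace X] [TopologicalSpace Y]
  [TopologicalSpace Z]

namespace ProperMap

protected def id (X : Type u) [TopologicalSpace X] : ProperMap X X :=
  ⟨ContinuousMap.id X, isProperMap_id⟩

def comp (g : ProperMap Y Z) (f : ProperMap X Y) : ProperMap X Z :=
  ⟨g.map.comp f.map, g.proper.comp f.proper⟩

/-- The preimage of a compact set under a proper map, as a compact set. -/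
def preimage (f : ProperMap X Y) (K : Compacts Y) : Compacts X :=
  ⟨f.map ⁻¹' K, f.proper.isCompact_preimage K.isCompact⟩

end ProperMap

/-- Two proper maps are properly homotopic when there is a homotopy between them which is proper
as a map on `I × X`. -/
def ProperHomotopic (f g : ProperMap X Y) : Prop :=
  ∃ H : ContinuousMap.Homotopy f.map g.map, IsProperMap (H : I × X → Y)

theorem ProperHomotopic.refl (f : ProperMap X Y) : ProperHomotopic f f :=
  ⟨ContinuousMap.Homotopy.refl f.map, f.proper.comp isProperMap_snd_of_compactSpace⟩

theorem ProperHomotopic.symm {f g : ProperMap X Y} (h : ProperHomotopic f g) :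
    ProperHomotopic g f := by
  obtain ⟨H, hH⟩ := h
  exact ⟨H.symm, hH.comp ((unitInterval.symmHomeomorph.isProperMap).prodMap isProperMap_id)⟩

theorem ProperHomotopic.trans {f g h : ProperMap X Y} (h₁ : ProperHomotopic f g)
    (h₂ : ProperHomotopic g h) : ProperHomotopic f h := by
  obtain ⟨H, hH⟩ := h₁
  obtain ⟨G, hG⟩ := h₂
  refine ⟨H.trans G, ?_⟩
  -- the two halves of the interval
  let a : I → I := fun t ↦ ⟨(t : ℝ) / 2, by constructor <;> linarith [t.2.1, t.2.2]⟩
  let b : I → I := fun t ↦ ⟨((t : ℝ) + 1) / 2, by constructor <;> linarith [t.2.1, t.2.2]⟩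
  have ha : Continuous a := by fun_prop
  have hb : Continuous b := by fun_prop
  let A : I × X → I × X := Prod.map a id
  let B : I × X → I × X := Prod.map b id
  have hA : Continuous A := ha.prodMap continuous_id
  have hB : Continuous B := hb.prodMap continuous_id
  have hTA : ∀ p, (H.trans G) (A p) = H p := by
    rintro ⟨t, x⟩
    have ht : ((a t : I) : ℝ) ≤ 1 / 2 := by
      change (t : ℝ) / 2 ≤ 1 / 2
      linarith [t.2.2]
    rw [show A (t, x) = (a t, x) from rfl, ContinuousMap.Homotopy.trans_apply, dif_pos ht]
    congr 1
    refine Prod.ext (Subtype.ext ?_) rfl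
    change 2 * ((t : ℝ) / 2) = t
    ring
  have hTB : ∀ p, (H.trans G) (B p) = G p := by
    rintro ⟨t, x⟩
    rw [show B (t, x) = (b t, x) from rfl, ContinuousMap.Homotopy.trans_apply]
    have hbt : ((b t : I) : ℝ) = ((t : ℝ) + 1) / 2 := rfl
    split_ifs with ht
    · have ht0 : (t : ℝ) = 0 := by
        have := t.2.1
        simp only [hbt] at ht
        linarith
      have ht0' : t = 0 := Subtype.ext ht0
      subst ht0'
      rw [G.apply_zero, ← H.apply_one x]
      congr 1
      refine Prod.ext (Subtype.ext ?_) rfl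
      simp [b]
    · congr 1
      refine Prod.ext (Subtype.ext ?_) rfl
      change 2 * (((t : ℝ) + 1) / 2) - 1 = t
      ring
  have hcov : ∀ p : I × X, p ∈ range A ∨ p ∈ range B := by
    rintro ⟨t, x⟩
    rcases le_total (t : ℝ) (1 / 2) with ht | ht
    · left
      refine ⟨(⟨2 * (t : ℝ), by linarith [t.2.1], by linarith⟩, x),
        Prod.ext (Subtype.ext ?_) rfl⟩
      change 2 * (t : ℝ) / 2 = t
      ring
    · right
      refine ⟨(⟨2 * (t : ℝ) - 1, by linarith, by linarith [t.2.2]⟩, x),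
        Prod.ext (Subtype.ext ?_) rfl⟩
      change (2 * (t : ℝ) - 1 + 1) / 2 = t
      ring
  rw [isProperMap_iff_isClosedMap_and_compact_fibers] at hH hG ⊢
  have key : ∀ S : Set (I × X), S = A '' (A ⁻¹' S) ∪ B '' (B ⁻¹' S) := by
    intro S
    rw [image_preimage_eq_inter_range, image_preimage_eq_inter_range, ← inter_union_distrib_left]
    exact (inter_eq_left.2 fun p _ ↦ hcov p).symm
  refine ⟨(H.trans G).continuous, fun S hS ↦ ?_, fun y ↦ ?_⟩
  · have : (H.trans G) '' S = H '' (A ⁻¹' S) ∪ G '' (B ⁻¹' S) := by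
      conv_lhs => rw [key S]
      rw [image_union, image_image, image_image]
      simp only [hTA, hTB]
    rw [this]
    exact (hH.2.1 _ (hS.preimage hA)).union (hG.2.1 _ (hS.preimage hB))
  · have : (H.trans G) ⁻¹' {y} = A '' (H ⁻¹' {y}) ∪ B '' (G ⁻¹' {y}) := by
      conv_lhs => rw [key ((H.trans G) ⁻¹' {y})]
      rw [← preimage_comp, ← preimage_comp,
        show (H.trans G) ∘ A = H from funext hTA, show (H.trans G) ∘ B = G from funext hTB]
    rw [this]
    exact ((hH.2.2 y).image hA).union ((hG.2.2 y).image hB)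

theorem ProperHomotopic.comp {g g' : ProperMap Y Z} {f f' : ProperMap X Y}
    (hg : ProperHomotopic g g') (hf : ProperHomotopic f f') :
    ProperHomotopic (g.comp f) (g'.comp f') := by
  obtain ⟨H, hH⟩ := hf
  obtain ⟨G, hG⟩ := hg
  have h1 : ProperHomotopic (g.comp f) (g.comp f') :=
    ⟨⟨⟨fun p ↦ g.map (H p), by fun_prop⟩, fun x ↦ by simp [ProperMap.comp],
      fun x ↦ by simp [ProperMap.comp]⟩, g.proper.comp hH⟩
  have h2 : ProperHomotopic (g.comp f') (g'.comp f') :=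
    ⟨⟨⟨fun p ↦ G (p.1, f'.map p.2), by fun_prop⟩, fun x ↦ by simp [ProperMap.comp],
      fun x ↦ by simp [ProperMap.comp]⟩, hG.comp (isProperMap_id.prodMap f'.proper)⟩
  exact h1.trans h2

end Proper

/-! ### The space of ends -/

section Ends

open unitInterval

/-- The map on connected components of complements induced by a map of pairs. -/
def complMap {X : Type u} {Y : Type v} [TopologicalSpace X] [TopologicalSpace Y] (f : C(X, Y))
    (K : Set X) (L : Set Y) (h : MapsTo f Kᶜ Lᶜ) :
    ConnectedComponents (Kᶜ : Set X) → ConnectedComponents (Lᶜ : Set Y) :=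
  (f.continuous.restrict h).connectedComponentsMap

/-- The map `π₀(X ∖ L) → π₀(X ∖ K)` for `K ⊆ L`. -/
def restrictCompl {X : Type u} [TopologicalSpace X] {K L : Compacts X} (h : K ≤ L) :
    ConnectedComponents ((L : Set X)ᶜ : Set X) → ConnectedComponents ((K : Set X)ᶜ : Set X) :=
  complMap (ContinuousMap.id X) L K (compl_subset_compl.2 h)

/-- The space of ends: the inverse limit of `π₀(X ∖ K)` over the compact subsets `K` of `X`. -/
@[ext]
structure EndSpace (X : Type u) [TopologicalSpace X] : Type u where
  component : (K : Compacts X) → ConnectedComponents ((K : Set X)ᶜ : Set X)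
  compatible : ∀ (K L : Compacts X) (h : K ≤ L), restrictCompl h (component L) = component K

/-- The inverse limit topology, every `π₀(X ∖ K)` being discrete. -/
instance EndSpace.instTopologicalSpace (X : Type u) [TopologicalSpace X] :
    TopologicalSpace (EndSpace X) :=
  ⨅ K : Compacts X, TopologicalSpace.induced (fun ω ↦ ω.component K) ⊥

variable {X : Type u} {Y : Type v} {Z : Type w} [TopologicalSpace X] [TopologicalSpace Y]
  [TopologicalSpace Z]

theorem complMap_comp (g : C(Y, Z)) (f : C(X, Y)) (K : Set X) (L : Set Y) (M : Set Z)
    (hg : MapsTo g Lᶜ Mᶜ) (hf : MapsTo f Kᶜ Lᶜ) (c : ConnectedComponents (Kᶜ : Set X)) :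
    complMap g L M hg (complMap f K L hf c) = complMap (g.comp f) K M (hg.comp hf) c := by
  obtain ⟨x, rfl⟩ := ConnectedComponents.surjective_coe c
  rfl

theorem complMap_id (K : Set X) (h : MapsTo (ContinuousMap.id X) Kᶜ Kᶜ)
    (c : ConnectedComponents (Kᶜ : Set X)) : complMap (ContinuousMap.id X) K K h c = c := by
  obtain ⟨x, rfl⟩ := ConnectedComponents.surjective_coe c
  rfl

/-- The value at `K` of the image of an end `ω` under `f` is the component of `Y ∖ K` containing
the image of the component `ω (f⁻¹ K)` of `X ∖ f⁻¹ K`. -/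
def ProperMap.endMap (f : ProperMap X Y) (ω : EndSpace X) : EndSpace Y :=
  ⟨fun K ↦ complMap f.map (f.preimage K) K (fun _ hx ↦ hx) (ω.component (f.preimage K)), by
    intro K L h
    rw [← ω.compatible (f.preimage K) (f.preimage L) (fun _ hx ↦ h hx)]
    unfold restrictCompl
    generalize ω.component (f.preimage L) = c
    obtain ⟨x, rfl⟩ := ConnectedComponents.surjective_coe c
    rfl⟩

theorem EndSpace.continuous_eval (K : Compacts X) :
    @Continuous (EndSpace X) _ _ ⊥ (fun ω ↦ ω.component K) :=
  continuous_iff_le_induced.2 (iInf_le _ K)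

theorem ProperMap.continuous_endMap (f : ProperMap X Y) : Continuous f.endMap := by
  refine continuous_iInf_rng.2 fun K ↦ continuous_induced_rng.2 ?_
  let _ : TopologicalSpace (ConnectedComponents (((f.preimage K : Compacts X) : Set X)ᶜ : Set X)) := ⊥
  let _ : TopologicalSpace (ConnectedComponents ((K : Set Y)ᶜ : Set Y)) := ⊥
  have : DiscreteTopology
      (ConnectedComponents (((f.preimage K : Compacts X) : Set X)ᶜ : Set X)) := ⟨rfl⟩
  exact (continuous_of_discreteTopology (f := complMap f.map (f.preimage K) K (fun _ hx ↦ hx))).comp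
    (EndSpace.continuous_eval (f.preimage K))

theorem ProperMap.endMap_id (ω : EndSpace X) : (ProperMap.id X).endMap ω = ω :=
  EndSpace.ext (funext fun K ↦ complMap_id (K : Set X) _ (ω.component K))

theorem ProperMap.endMap_comp (g : ProperMap Y Z) (f : ProperMap X Y) (ω : EndSpace X) :
    (g.comp f).endMap ω = g.endMap (f.endMap ω) :=
  EndSpace.ext (funext fun K ↦ (complMap_comp g.map f.map _ _ (K : Set Z) _ _ _).symm)

/-- Properly homotopic maps induce the same map on ends. -/
theorem ProperHomotopic.endMap_eq {f g : ProperMap X Y} (h : ProperHomotopic f g) :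
    f.endMap = g.endMap := by
  obtain ⟨H, hH⟩ := h
  funext ω
  refine EndSpace.ext (funext fun K ↦ ?_)
  let P : Compacts (I × X) := ⟨H ⁻¹' K, hH.isCompact_preimage K.isCompact⟩
  let L : Compacts X := ⟨Prod.snd '' (P : Set (I × X)), P.isCompact.image continuous_snd⟩
  have hL : ∀ x ∈ ((L : Set X)ᶜ : Set X), ∀ t, H (t, x) ∉ (K : Set Y) :=
    fun x hx t ht ↦ hx ⟨(t, x), ht, rfl⟩
  have hf : f.preimage K ≤ L := fun x hx ↦ by
    have h0 : H (0, x) ∈ (K : Set Y) := by rw [H.apply_zero]; exact hx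
    exact ⟨(0, x), h0, rfl⟩
  have hg : g.preimage K ≤ L := fun x hx ↦ by
    have h1 : H (1, x) ∈ (K : Set Y) := by rw [H.apply_one]; exact hx
    exact ⟨(1, x), h1, rfl⟩
  change complMap f.map (f.preimage K) K (fun _ hx ↦ hx) (ω.component (f.preimage K)) =
    complMap g.map (g.preimage K) K (fun _ hx ↦ hx) (ω.component (g.preimage K))
  rw [← ω.compatible _ _ hf, ← ω.compatible _ _ hg]
  obtain ⟨x, hx⟩ := ConnectedComponents.surjective_coe (ω.component L)
  rw [← hx]
  change ConnectedComponents.mk _ = ConnectedComponents.mk _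
  rw [ConnectedComponents.coe_eq_coe']
  let q : I → ((K : Set Y)ᶜ : Set Y) := fun t ↦ ⟨H (t, x.1), hL x.1 x.2 t⟩
  have hq : Continuous q := by fun_prop
  have hc : IsPreconnected (range q) := isPreconnected_range hq
  have h01 : q 0 ∈ connectedComponent (q 1) :=
    hc.subset_connectedComponent (x := q 1) ⟨1, rfl⟩ ⟨0, rfl⟩
  have e0 : q 0 = ⟨f.map x, fun hx' ↦ x.2 (hf hx')⟩ := Subtype.ext (H.apply_zero x.1)
  have e1 : q 1 = ⟨g.map x, fun hx' ↦ x.2 (hg hx')⟩ := Subtype.ext (H.apply_one x.1)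
  rw [e0, e1] at h01
  exact h01

end Ends

/-! ### The Freudenthal compactification -/

section Freudenthal

/-- The end compactification `X ⊔ ∂X`. -/
inductive Freudenthal (X : Type u) [TopologicalSpace X] : Type u
  | point (x : X) : Freudenthal X
  | limit (ω : EndSpace X) : Freudenthal X

variable {X : Type u} [TopologicalSpace X]

/-- For a component `U` of `X ∖ K`, the set `Û`: the union of `U` and the set of ends that map
to `U`. -/
def Freudenthal.basicSet (K : Compacts X) (U : ConnectedComponents ((K : Set X)ᶜ : Set X)) :
    Set (Freudenthal X) :=
  Freudenthal.point '' {x : X | ∃ h : x ∈ (K : Set X)ᶜ, ConnectedComponents.mk ⟨x, h⟩ = U} ∪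
    Freudenthal.limit '' {ω : EndSpace X | ω.component K = U}

instance Freudenthal.instTopologicalSpace : TopologicalSpace (Freudenthal X) :=
  generateFrom
    ({s | ∃ U : Set X, IsOpen U ∧ s = Freudenthal.point '' U} ∪ {s | ∃ K U, s = Freudenthal.basicSet K U})

/-- The extension of a proper map to the end compactifications, as a function. -/
def ProperMap.hatFun {Y : Type v} [TopologicalSpace Y] (f : ProperMap X Y) :
    Freudenthal X → Freudenthal Y
  | .point x => .point (f.map x)
  | .limit ω => .limit (f.endMap ω)

/-- The extension of a proper map to the end compactifications, as a continuous map. -/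
def ProperMap.hat {Y : Type v} [TopologicalSpace Y] (f : ProperMap X Y) :
    C(Freudenthal X, Freudenthal Y) where
  toFun := f.hatFun
  continuous_toFun := by
    refine continuous_generateFrom_iff.2 ?_
    rintro s (⟨U, hU, rfl⟩ | ⟨K, U, rfl⟩)
    · refine isOpen_generateFrom_of_mem (Or.inl ⟨f.map ⁻¹' U, hU.preimage f.map.continuous, ?_⟩)
      ext (x | ω) <;> simp [ProperMap.hatFun]
    · have : f.hatFun ⁻¹' (Freudenthal.basicSet K U) =
          ⋃ D ∈ {D | complMap f.map (f.preimage K) K (fun _ hx ↦ hx) D = U},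
            Freudenthal.basicSet (f.preimage K) D := by
        apply subset_antisymm
        · rintro (x | ω) h
          · obtain ⟨y, ⟨hy, hyU⟩, hyx⟩ | ⟨_, _, h⟩ := h
            · cases hyx
              exact mem_iUnion₂.2 ⟨ConnectedComponents.mk ⟨x, hy⟩, hyU, Or.inl ⟨x, ⟨hy, rfl⟩, rfl⟩⟩
            · cases h
          · obtain ⟨_, _, h⟩ | ⟨η, hη, h⟩ := h
            · cases h
            · cases h
              exact mem_iUnion₂.2 ⟨ω.component (f.preimage K), hη, Or.inr ⟨ω, rfl, rfl⟩⟩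
        · refine iUnion₂_subset fun D hD ↦ ?_
          rintro _ (⟨y, ⟨hy, rfl⟩, rfl⟩ | ⟨η, rfl, rfl⟩)
          · exact Or.inl ⟨f.map y, ⟨hy, hD⟩, rfl⟩
          · exact Or.inr ⟨f.endMap η, hD, rfl⟩
      rw [this]
      exact isOpen_biUnion fun D _ ↦ isOpen_generateFrom_of_mem (Or.inr ⟨_, _, rfl⟩)

end Freudenthal

/-! ### The mapping class group -/

section Maps

variable (X : Type u) [TopologicalSpace X]

instance ProperMap.instMonoid : Monoid (ProperMap X X) where
  mul := ProperMap.comp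
  one := ProperMap.id X
  mul_assoc _ _ _ := rfl
  one_mul _ := rfl
  mul_one _ := rfl

/-- Proper homotopy as a congruence on the monoid of proper self-maps. -/
def properHomotopyCon : Con (ProperMap X X) where
  r := ProperHomotopic
  iseqv := ⟨ProperHomotopic.refl, ProperHomotopic.symm, ProperHomotopic.trans⟩
  mul' := ProperHomotopic.comp

/-- The mapping class group: the group of invertible elements of the monoid of proper homotopy
classes of proper maps `X → X`, i.e. of proper homotopy classes of proper homotopy equivalences. -/
abbrev Maps : Type u := (properHomotopyCon X).Quotientˣ

/-- Pairs `(f, g)` of proper homotopy equivalences of `X` that are each other's inverses up to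
proper homotopy. -/
def HomotopyInversePair : Type u :=
  {p : ProperMap X X × ProperMap X X //
    ProperHomotopic (p.1.comp p.2) (ProperMap.id X) ∧
      ProperHomotopic (p.2.comp p.1) (ProperMap.id X)}

/-- The topology for which `(f, g) ↦ (f̂, ĝ)` is a homeomorphism onto a subspace of the square of
the space of continuous self-maps of the end compactification, with the compact-open topology. -/
instance HomotopyInversePair.instTopologicalSpace : TopologicalSpace (HomotopyInversePair X) :=
  TopologicalSpace.induced (fun p ↦ (p.1.1.hat, p.1.2.hat))
    (inferInstance : TopologicalSpace
      (C(Freudenthal X, Freudenthal X) × C(Freudenthal X, Freudenthal X)))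

variable {X}

/-- The mapping class of `f`, for a pair `(f, g)` of mutually inverse proper homotopy
equivalences. -/
def HomotopyInversePair.toMaps (p : HomotopyInversePair X) : Maps X :=
  ⟨(p.1.1 : (properHomotopyCon X).Quotient), (p.1.2 : (properHomotopyCon X).Quotient),
    (properHomotopyCon X).eq.2 p.2.1, (properHomotopyCon X).eq.2 p.2.2⟩

/-- The quotient topology on the mapping class group. -/
instance Maps.instTopologicalSpace : TopologicalSpace (Maps X) :=
  TopologicalSpace.coinduced HomotopyInversePair.toMaps inferInstance

end Maps

/-! ### The action on the space of ends -/

section Sigma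

/-- The compact-open topology on a homeomorphism group. -/
instance homeoTopology (Y : Type u) [TopologicalSpace Y] : TopologicalSpace (Y ≃ₜ Y) :=
  TopologicalSpace.induced (fun h ↦ (h : C(Y, Y))) inferInstance

/-- `Homeo(Y, A)`: the group of homeomorphisms of `Y` that map the subset `A` onto itself. -/
def homeoPair (Y : Type u) [TopologicalSpace Y] (A : Set Y) : Subgroup (Y ≃ₜ Y) where
  carrier := {h | h '' A = A}
  one_mem' := image_id A
  mul_mem' {g h} hg hh := by
    change (g ∘ h) '' A = A
    rw [image_comp, show h '' A = A from hh, show g '' A = A from hg]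
  inv_mem' {h} hh := by
    change h.symm '' A = A
    conv_lhs => rw [← show h '' A = A from hh]
    exact h.toEquiv.symm_image_image A

variable {X : Type u} [TopologicalSpace X]

/-- The self-map of `∂X` induced by a proper homotopy class of proper self-maps. -/
def classEndMap (φ : (properHomotopyCon X).Quotient) : EndSpace X → EndSpace X :=
  Con.liftOn φ ProperMap.endMap fun _ _ h ↦ ProperHomotopic.endMap_eq h

theorem continuous_classEndMap (φ : (properHomotopyCon X).Quotient) :
    Continuous (classEndMap φ) := by
  induction φ using Con.induction_on with
  | H f => exact f.continuous_endMap

theorem classEndMap_mul (φ ψ : (properHomotopyCon X).Quotient) (ω : EndSpace X) :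
    classEndMap (φ * ψ) ω = classEndMap φ (classEndMap ψ ω) := by
  induction φ, ψ using Con.induction_on₂ with
  | H f g => exact f.endMap_comp g ω

theorem classEndMap_one (ω : EndSpace X) :
    classEndMap (1 : (properHomotopyCon X).Quotient) ω = ω :=
  ProperMap.endMap_id ω

/-- The homomorphism `σ` sending a mapping class to the homeomorphism of `∂X` it induces. -/
def endAction : Maps X →* (EndSpace X ≃ₜ EndSpace X) where
  toFun φ :=
    { toFun := classEndMap φ.val
      invFun := classEndMap (φ⁻¹).val
      left_inv := fun ω ↦ by rw [← classEndMap_mul, Units.inv_mul, classEndMap_one]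
      right_inv := fun ω ↦ by rw [← classEndMap_mul, Units.mul_inv, classEndMap_one]
      continuous_toFun := continuous_classEndMap _
      continuous_invFun := continuous_classEndMap _ }
  map_one' := Homeomorph.ext classEndMap_one
  map_mul' _ _ := Homeomorph.ext fun ω ↦ classEndMap_mul _ _ ω

/-- `∂X_g ⊆ ∂X`: the ends of `X` coming from the space of ends of the core, through the inclusion
of the core, which is proper. -/
def coreEnds (X : Type u) [TopologicalSpace X] [T2Space X] [CWComplex (univ : Set X)] :
    Set (EndSpace X) :=
  range (ProperMap.endMap (⟨⟨Subtype.val, continuous_subtype_val⟩,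
    (core X).closed.isProperMap_subtypeVal⟩ : ProperMap ((core X : Set X) : Type _) X))

end Sigma

end LocallyFiniteGraph

end

/-! The proof fixes a normal spanning tree of `X`: a rooted spanning tree in which the endpoints of
every edge are comparable (`exists_normal_spanning_tree`). Direct all edges upwards and let the cone
of a vertex `u` be the part of `X` above `u`. An edge that enters the cone from outside starts at an
ancestor of `u`, so cones of depth `n` are connected, finite in number, with compact complement, and
cut off from the rest by vertices of smaller depth. Hence ends correspond to rays of the tree, cones
are a neighbourhood basis of an end (`hasBasis_endFilter_cone`, `hasBasis_nhds_end`), and a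
continuous map that respects ends is proper.

The tree embeds in a product of intervals by one coordinate per vertex. In these coordinates there
is an explicit path between two points, continuous in its endpoints, for which cones are convex
(`continuous_geodesic`, `geodesic_mem_cone`). So two proper maps with the same action on ends are
properly homotopic as soon as they differ only where both take values in the tree
(`properHomotopic_of_tree`).

The set `∂X_g` consists of the ends accumulated by edges outside the tree (`coreEnds_eq`). An
immersed loop cannot turn around inside a piece of the tree, and a tree edge with non-tree edges on
both sides lies on an immersed loop. This set is invariant under proper homotopy equivalences
because the winding number around a non-tree edge is a homotopy invariant that vanishes on loops
inside the tree (`endMap_mem_loopEnds`).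

Continuity of `σ` holds since `∂X` is a subspace of the compactification. For openness, let `k` be a
homeomorphism of `∂X` that preserves `∂X_g` and all ray vertices of depth `m`. The vertices can be
moved along with `k`, and a Schröder–Bernstein argument permutes the non-tree edges along with `k`
(`exists_vertexMap`, `exists_edgePerm`). This yields mutually inverse proper homotopy equivalences
that induce `k` and its inverse and move points only inside cones of large depth
(`exists_equivalence`). Such maps are close to the identity in the compact-open topology
(`exists_isClose_hat_mem`), and composing with a given representative proves openness at every class
(`isOpenMap_endAction`).

If `X` is a tree, there are no non-tree edges. The homotopy criterion then gives injectivity, and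
the realisation at depth `0`, where it imposes no condition, gives surjectivity. -/

noncomputable section

namespace LocallyFiniteGraph

/-! ### Normal spanning trees -/

/-- A rooted tree on a vertex set, given by its parent function. -/
structure RootedTree (V : Type*) where
  root : V
  parent : V → V
  depth : V → ℕ
  parent_root : parent root = root
  depth_root : depth root = 0
  depth_parent : ∀ v, v ≠ root → depth v = depth (parent v) + 1

namespace RootedTree

variable {V : Type*} (t : RootedTree V)

/-- The tree order: `u` lies on the path from the root to `v`. -/
def Le (u v : V) : Prop := ∃ k, t.parent^[k] v = u

end RootedTree

section NormalTree

variable {V : Type*} (G : SimpleGraph V)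

/-- There is a walk of length `k` from `u` to `v` inside `A`. -/
def WalkIn (A : Set V) : ℕ → V → V → Prop
  | 0, u, v => u ∈ A ∧ u = v
  | k + 1, u, v => u ∈ A ∧ ∃ z, G.Adj u z ∧ WalkIn A k z v

/-- The vertices that can be reached from `x` inside `A`. -/
def reachIn (A : Set V) (x : V) : Set V := {y | ∃ k, WalkIn G A k x y}

variable {G}

theorem WalkIn.left_mem {A : Set V} {k : ℕ} {u v : V} (h : WalkIn G A k u v) : u ∈ A := by
  cases k <;> exact h.1

theorem WalkIn.right_mem {A : Set V} {k : ℕ} {u v : V} (h : WalkIn G A k u v) : v ∈ A := by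
  induction k generalizing u with
  | zero => exact h.2 ▸ h.1
  | succ k ih => obtain ⟨_, z, _, hz⟩ := h; exact ih hz

theorem WalkIn.trans {A : Set V} {k l : ℕ} {u v w : V} (h : WalkIn G A k u v)
    (h' : WalkIn G A l v w) : WalkIn G A (k + l) u w := by
  induction k generalizing u with
  | zero => obtain ⟨_, rfl⟩ := h; simpa using h'
  | succ k ih =>
    obtain ⟨hu, z, ha, hz⟩ := h
    rw [Nat.succ_add]
    exact ⟨hu, z, ha, ih hz⟩

theorem WalkIn.symm {A : Set V} {k : ℕ} {u v : V} (h : WalkIn G A k u v) : WalkIn G A k v u := by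
  induction k generalizing u with
  | zero => obtain ⟨hu, rfl⟩ := h; exact ⟨hu, rfl⟩
  | succ k ih =>
    obtain ⟨hu, z, ha, hz⟩ := h
    have h1 : WalkIn G A 1 z u := ⟨hz.left_mem, u, ha.symm, hu, rfl⟩
    exact (ih hz).trans h1

/-- Either a walk avoids `u`, or `u` has a walk to its endpoint that is not longer. -/
theorem WalkIn.diff_singleton_or {A : Set V} {k : ℕ} {z v : V} (u : V) (h : WalkIn G A k z v) :
    WalkIn G (A \ {u}) k z v ∨ ∃ j ≤ k, WalkIn G A j u v := by
  induction k generalizing z with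
  | zero =>
    obtain ⟨hz, rfl⟩ := h
    by_cases hu : z = u
    · exact Or.inr ⟨0, le_rfl, hu ▸ hz, hu.symm⟩
    · exact Or.inl ⟨⟨hz, hu⟩, rfl⟩
  | succ k ih =>
    by_cases hu : z = u
    · exact Or.inr ⟨k + 1, le_rfl, hu ▸ h⟩
    · obtain ⟨hz, y, ha, hy⟩ := h
      obtain h1 | ⟨j, hj, h1⟩ := ih hy
      · exact Or.inl ⟨⟨hz, hu⟩, y, ha, h1⟩
      · exact Or.inr ⟨j, by omega, h1⟩

theorem reachIn_subset (A : Set V) (x : V) : reachIn G A x ⊆ A := fun _ ⟨_, h⟩ ↦ h.right_mem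

theorem mem_reachIn_self {A : Set V} {x : V} (h : x ∈ A) : x ∈ reachIn G A x := ⟨0, h, rfl⟩

theorem reachIn_eq {A : Set V} {x y : V} (h : y ∈ reachIn G A x) :
    reachIn G A y = reachIn G A x := by
  obtain ⟨k, hk⟩ := h
  ext z
  exact ⟨fun ⟨l, hl⟩ ↦ ⟨_, hk.trans hl⟩, fun ⟨l, hl⟩ ↦ ⟨_, hk.symm.trans hl⟩⟩

theorem mem_reachIn_of_adj {A : Set V} {x y : V} (hx : x ∈ A) (hy : y ∈ A) (h : G.Adj x y) :
    y ∈ reachIn G A x := ⟨1, hx, y, h, hy, rfl⟩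

theorem reachIn_reachIn {A : Set V} {x y : V} (hy : y ∈ reachIn G A x) :
    reachIn G (reachIn G A x) y = reachIn G A x := by
  refine subset_antisymm (reachIn_subset _ _) ?_
  rw [← reachIn_eq hy]
  rintro z ⟨k, hk⟩
  refine ⟨k, ?_⟩
  have : ∀ k w, w ∈ reachIn G A y → WalkIn G A k w z → WalkIn G (reachIn G A y) k w z := by
    intro k
    induction k with
    | zero => exact fun w hw h ↦ ⟨hw, h.2⟩
    | succ k ih =>
      rintro w hw ⟨hwA, v, ha, hv⟩
      refine ⟨hw, v, ha, ih v ?_ hv⟩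
      rw [← reachIn_eq hw]
      exact mem_reachIn_of_adj hwA hv.left_mem ha
  exact this k y (mem_reachIn_self hk.left_mem) hk

/-- The vertex just before the first visit to `w` is reached from `x` without passing through `w`.
-/
theorem exists_adj_of_walkIn {A : Set V} {k : ℕ} {x w : V} (h : WalkIn G A k x w) (hx : x ≠ w) :
    ∃ u ∈ reachIn G (A \ {w}) x, G.Adj w u := by
  induction k generalizing x with
  | zero => exact absurd h.2 hx
  | succ k ih =>
    obtain ⟨hxA, z, ha, hz⟩ := h
    by_cases hzw : z = w
    · subst hzw
      exact ⟨x, mem_reachIn_self ⟨hxA, hx⟩, ha.symm⟩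
    · obtain ⟨u, hu, hau⟩ := ih hz hzw
      have hxA' : x ∈ A \ {w} := ⟨hxA, hx⟩
      have hzA' : z ∈ A \ {w} := ⟨hz.left_mem, hzw⟩
      rw [reachIn_eq (mem_reachIn_of_adj hxA' hzA' ha)] at hu
      exact ⟨u, hu, hau⟩

variable (G)

/-- A state of the depth-first search: a vertex `w` and a connected set `C` of vertices not yet
visited, adjacent to `w`. -/
def IsSearchState (s : V × Set V) : Prop :=
  s.1 ∉ s.2 ∧ (∃ u ∈ s.2, G.Adj s.1 u) ∧ ∀ x ∈ s.2, reachIn G s.2 x = s.2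

variable (idx : V → ℕ)

/-- `w` is a neighbour of `s.1` in `s.2` that is as close as possible, within `s.2`, to the first
vertex of `s.2`. -/
def IsNextVertex (s : V × Set V) (w : V) : Prop :=
  w ∈ s.2 ∧ G.Adj s.1 w ∧ ∃ τ ∈ s.2, (∀ y ∈ s.2, idx τ ≤ idx y) ∧
    ∃ k, WalkIn G s.2 k w τ ∧ ∀ u ∈ s.2, G.Adj s.1 u → ∀ j, WalkIn G s.2 j u τ → k ≤ j

theorem exists_isNextVertex {s : V × Set V} (hs : IsSearchState G s) :
    ∃ w, IsNextVertex G idx s w := by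
  classical
  obtain ⟨-, ⟨u, hu, hau⟩, hc⟩ := hs
  obtain ⟨τ, hτ, hmin⟩ := exists_minimalFor_of_wellFoundedLT (· ∈ s.2) idx ⟨u, hu⟩
  have hmin' : ∀ y ∈ s.2, idx τ ≤ idx y := fun y hy ↦ by
    by_contra hlt
    exact hlt (hmin hy (not_le.1 hlt).le)
  have hex : ∃ k, ∃ w ∈ s.2, G.Adj s.1 w ∧ WalkIn G s.2 k w τ := by
    have : τ ∈ reachIn G s.2 u := by rw [hc u hu]; exact hτ
    obtain ⟨k, hk⟩ := this
    exact ⟨k, u, hu, hau, hk⟩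
  obtain ⟨w, hw, haw, hk⟩ := Nat.find_spec hex
  exact ⟨w, hw, haw, τ, hτ, hmin', _, hk, fun v hv hav j hj ↦ Nat.find_min' hex ⟨v, hv, hav, hj⟩⟩

open Classical in
/-- The next vertex of the depth-first search. -/
def nextVertex (s : V × Set V) : V :=
  if h : ∃ w, IsNextVertex G idx s w then h.choose else s.1

theorem nextVertex_spec {s : V × Set V} (hs : IsSearchState G s) :
    IsNextVertex G idx s (nextVertex G idx s) := by
  rw [nextVertex, dif_pos (exists_isNextVertex G idx hs)]
  exact (exists_isNextVertex G idx hs).choose_spec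

/-- The states of the depth-first search on its way to `x`. -/
def searchState (r x : V) : ℕ → V × Set V
  | 0 => (r, reachIn G {r}ᶜ x)
  | n + 1 =>
    let s := searchState r x n
    (nextVertex G idx s, reachIn G (s.2 \ {nextVertex G idx s}) x)

variable {G idx}

theorem searchState_succ_subset (r x : V) (n : ℕ) :
    (searchState G idx r x (n + 1)).2 ⊆
      (searchState G idx r x n).2 \ {(searchState G idx r x (n + 1)).1} :=
  reachIn_subset _ _

theorem searchState_antitone (r x : V) : Antitone fun n ↦ (searchState G idx r x n).2 :=
  antitone_nat_of_succ_le fun n ↦ (searchState_succ_subset r x n).trans sdiff_subset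

theorem isSearchState_searchState (hG : G.Connected) (r x : V) (n : ℕ)
    (hx : x ∈ (searchState G idx r x n).2) : IsSearchState G (searchState G idx r x n) := by
  induction n with
  | zero =>
    have hxr : x ≠ r := reachIn_subset _ _ hx
    refine ⟨fun h ↦ reachIn_subset _ _ h rfl, ?_, fun y hy ↦ reachIn_reachIn hy⟩
    obtain ⟨p⟩ := hG.preconnected x r
    have hp : ∀ {a b : V}, G.Walk a b → ∃ k, WalkIn G univ k a b := by
      intro a b p
      induction p with
      | nil => exact ⟨0, trivial, rfl⟩
      | cons h p ih => obtain ⟨k, hk⟩ := ih; exact ⟨k + 1, trivial, _, h, hk⟩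
    obtain ⟨k, hk⟩ := hp p
    have := exists_adj_of_walkIn hk hxr
    rwa [← compl_eq_univ_sdiff] at this
  | succ n ih =>
    have hx' := searchState_succ_subset r x n hx
    have hs := ih hx'.1
    have hn := nextVertex_spec G idx hs
    refine ⟨fun h ↦ (searchState_succ_subset r x n h).2 rfl, ?_, fun y hy ↦ reachIn_reachIn hy⟩
    have : nextVertex G idx (searchState G idx r x n) ∈
        reachIn G (searchState G idx r x n).2 x := by rw [hs.2.2 x hx'.1]; exact hn.1
    obtain ⟨k, hk⟩ := this
    exact exists_adj_of_walkIn hk hx'.2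

/-- The search depends on its goal only through the component that contains it, so goals that share
a component have shared all states so far. -/
theorem searchState_eq {r x y : V} {n : ℕ} (h : y ∈ (searchState G idx r x n).2) {m : ℕ}
    (hm : m ≤ n) : searchState G idx r y m = searchState G idx r x m := by
  induction m with
  | zero =>
    exact Prod.ext rfl (reachIn_eq (searchState_antitone r x (Nat.zero_le n) h))
  | succ m ih =>
    have e := ih (Nat.le_of_succ_le hm)
    have := searchState_antitone r x hm h
    simp only [searchState] at this ⊢
    rw [e, reachIn_eq this]

/-- The search arrives at every vertex. The index of the first vertex `τ` of the current component
never decreases and is at most `idx x`, so `τ` is eventually constant; from then on each step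
strictly shortens the distance to it. -/
theorem exists_notMem_searchState (hG : G.Connected) (hidx : Function.Injective idx) (r x : V) :
    ∃ n, x ∉ (searchState G idx r x n).2 := by
  by_contra! H
  set S := searchState G idx r x with hS
  have hs : ∀ n, IsSearchState G (S n) := fun n ↦ isSearchState_searchState hG r x n (H n)
  have hn : ∀ n, IsNextVertex G idx (S n) (S (n + 1)).1 := fun n ↦ nextVertex_spec G idx (hs n)
  choose hmem hadj τ hτ hmin d hd hdmin using hn
  have hmono : Monotone fun n ↦ idx (τ n) := monotone_nat_of_le_succ fun n ↦
    hmin n _ (searchState_antitone r x n.le_succ (hτ (n + 1)))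
  have hbdd : ∀ n, idx (τ n) ≤ idx x := fun n ↦ hmin n x (H n)
  obtain ⟨N, hN⟩ : ∃ N, ∀ n ≥ N, idx (τ n) = idx (τ N) := by
    by_contra! hcon
    have : ∀ k, ∃ n, k ≤ idx (τ n) := by
      intro k
      induction k with
      | zero => exact ⟨0, Nat.zero_le _⟩
      | succ k ih =>
        obtain ⟨n, hn⟩ := ih
        obtain ⟨m, hm, hne⟩ := hcon n
        have := hmono hm
        simp only at this
        exact ⟨m, by omega⟩
    obtain ⟨n, hn⟩ := this (idx x + 1)
    have := hbdd n
    omega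
  have hτN : ∀ n ≥ N, τ n = τ N := fun n hn ↦ hidx (hN n hn)
  have hlt : ∀ n ≥ N, d (n + 1) < d n := by
    intro n hnN
    have e1 : τ (n + 1) = τ n := (hτN _ (by omega)).trans (hτN n hnN).symm
    have hτ' : τ n ∈ (S (n + 1)).2 := e1 ▸ hτ (n + 1)
    have hτ'' := searchState_succ_subset r x n hτ'
    cases hdn : d n with
    | zero =>
      have h0 := hd n
      rw [hdn] at h0
      exact absurd h0.2.symm hτ''.2
    | succ k =>
      have h0 := hd n
      rw [hdn] at h0
      obtain ⟨hw, z, haz, hz⟩ := h0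
      -- The rest of a shortest walk either avoids the new vertex, and then survives in the next
      -- component and bounds the next distance, or it yields a walk from the new vertex that is too
      -- short.
      obtain h1 | ⟨j, hj, h1⟩ := hz.diff_singleton_or (S (n + 1)).1
      · have hC : reachIn G ((S n).2 \ {(S (n + 1)).1}) (τ n) = (S (n + 1)).2 :=
          reachIn_eq hτ'
        have hzC : z ∈ (S (n + 1)).2 := by rw [← hC]; exact ⟨k, h1.symm⟩
        have h2 : WalkIn G (S (n + 1)).2 k z (τ n) := by
          have : ∀ k z, z ∈ (S (n + 1)).2 → WalkIn G ((S n).2 \ {(S (n + 1)).1}) k z (τ n) →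
              WalkIn G (S (n + 1)).2 k z (τ n) := by
            intro k
            induction k with
            | zero => exact fun z hz h ↦ ⟨hz, h.2⟩
            | succ k ih =>
              rintro z hz ⟨hzA, v, ha, hv⟩
              refine ⟨hz, v, ha, ih v ?_ hv⟩
              rw [← hC]
              exact ⟨k, hv.symm⟩
          exact this k z hzC h1
        have := hdmin (n + 1) z hzC haz k (e1 ▸ h2)
        omega
      · have := hdmin n _ (hmem n) (hadj n) j h1
        omega
  have : ∀ k, d (N + k) + k ≤ d N := by
    intro k
    induction k with
    | zero => exact le_rfl
    | succ k ih =>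
      have := hlt (N + k) (by omega)
      rw [add_assoc N k 1] at this
      omega
  have := this (d N + 1)
  omega

/-- Every countable connected graph has a normal spanning tree: a rooted spanning tree such that
adjacent vertices are comparable in the tree order. -/
theorem exists_normal_spanning_tree [Countable V] (hG : G.Connected) :
    ∃ t : RootedTree V, (∀ v, v ≠ t.root → G.Adj (t.parent v) v) ∧
      ∀ u v, G.Adj u v → t.Le u v ∨ t.Le v u := by
  classical
  obtain ⟨idx, hidx⟩ := Countable.exists_injective_nat V
  obtain ⟨r⟩ := hG.nonempty
  set S := searchState G idx r with hS
  have hex : ∀ x, ∃ n, x ∉ (S x n).2 := exists_notMem_searchState hG hidx r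
  -- The component loses its goal exactly when the goal is visited, as `reachIn G A x` is empty for
  -- `x ∉ A`. For the root this happens at time `0`.
  let depth : V → ℕ := fun x ↦ Nat.find (hex x)
  have hdepth : ∀ x n, n < depth x ↔ x ∈ (S x n).2 := by
    intro x n
    refine ⟨fun h ↦ not_not.1 (Nat.find_min (hex x) h), fun h ↦ ?_⟩
    by_contra hlt
    exact Nat.find_spec (hex x) (searchState_antitone r x (not_lt.1 hlt) h)
  have hroot : depth r = 0 := by
    by_contra h
    exact reachIn_subset _ _ ((hdepth r 0).1 (Nat.pos_of_ne_zero h)) rfl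
  have hlast : ∀ x n, depth x = n + 1 → (S x (n + 1)).1 = x := by
    intro x n h
    have h1 := (hdepth x n).1 (by omega)
    have h2 : x ∉ (S x (n + 1)).2 := fun h2 ↦ by have := (hdepth x (n + 1)).2 h2; omega
    by_contra hne
    exact h2 (mem_reachIn_self ⟨h1, Ne.symm hne⟩)
  have hpos : ∀ x, x ≠ r → 0 < depth x := fun x hx ↦ (hdepth x 0).2 (mem_reachIn_self hx)
  have hself : ∀ x, (S x (depth x)).1 = x := by
    intro x
    cases h : depth x with
    | zero =>
      by_cases hx : x = r
      · rw [hx]; rfl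
      · exact absurd h (hpos x hx).ne'
    | succ n => exact hlast x n h
  have hstate : ∀ x n, n < depth x → IsSearchState G (S x n) := fun x n h ↦
    isSearchState_searchState hG r x n ((hdepth x n).1 h)
  have hpar : ∀ x n, depth x = n + 1 →
      depth (S x n).1 = n ∧ ∀ j ≤ n, (S (S x n).1 j).1 = (S x j).1 := by
    intro x n h
    cases n with
    | zero => exact ⟨hroot, fun j hj ↦ by obtain rfl := Nat.le_zero.1 hj; rfl⟩
    | succ m =>
      have hmem : (S x (m + 1)).1 ∈ (S x m).2 :=
        (nextVertex_spec G idx (hstate x m (by omega))).1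
      have heq : S (S x (m + 1)).1 m = S x m := searchState_eq hmem le_rfl
      have hw : (S (S x (m + 1)).1 (m + 1)).1 = (S x (m + 1)).1 := by
        change nextVertex G idx (S (S x (m + 1)).1 m) = nextVertex G idx (S x m)
        rw [heq]
      refine ⟨le_antisymm ?_ ((hdepth _ m).2 (heq ▸ hmem)), fun j hj ↦ ?_⟩
      · by_contra hlt
        have := (hdepth _ (m + 1)).1 (not_le.1 hlt)
        exact (searchState_succ_subset r _ m this).2 hw.symm
      · obtain hj | rfl := Nat.lt_or_eq_of_le hj
        · exact congrArg Prod.fst (searchState_eq hmem (Nat.lt_succ_iff.1 hj))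
        · exact hw
  let t : RootedTree V :=
    { root := r
      parent := fun x ↦ (S x (depth x - 1)).1
      depth := depth
      parent_root := by simp only [hroot]; rfl
      depth_root := hroot
      depth_parent := fun x hx ↦ by
        obtain ⟨n, hn⟩ := Nat.exists_eq_succ_of_ne_zero (hpos x hx).ne'
        rw [hn, Nat.succ_sub_one, (hpar x n hn).1] }
  have hanc : ∀ n x, depth x = n → ∀ j ≤ n, t.Le (S x j).1 x := by
    intro n
    induction n with
    | zero =>
      intro x hx j hj
      obtain rfl := Nat.le_zero.1 hj
      exact ⟨0, by have := hself x; rw [hx] at this; exact this.symm⟩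
    | succ n ih =>
      intro x hx j hj
      obtain hj | rfl := Nat.lt_or_eq_of_le hj
      · obtain ⟨hd, he⟩ := hpar x n hx
        obtain ⟨k, hk⟩ := ih _ hd j (Nat.lt_succ_iff.1 hj)
        refine ⟨k + 1, ?_⟩
        rw [Function.iterate_succ_apply]
        change t.parent^[k] (S x (depth x - 1)).1 = _
        rw [hx, Nat.succ_sub_one, hk, he j (Nat.lt_succ_iff.1 hj)]
      · exact ⟨0, (hlast x n hx).symm⟩
  refine ⟨t, fun v hv ↦ ?_, fun y z hyz ↦ ?_⟩
  · obtain ⟨n, hn⟩ := Nat.exists_eq_succ_of_ne_zero (hpos v hv).ne'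
    have h1 := (nextVertex_spec G idx (hstate v n (by omega))).2.1
    change G.Adj (S v (depth v - 1)).1 v
    rw [hn, Nat.succ_sub_one]
    have h2 : nextVertex G idx (S v n) = v := hlast v n hn
    rwa [h2] at h1
  -- Consider the first stage at which the searches towards `y` and `z` differ or one has ended.
  -- Until then they share their visited vertices. If neither goal was the last one visited, the
  -- adjacent vertices `y` and `z` remain in one component and the searches still agree; so one goal
  -- was visited on the way to the other.
  · let P : ℕ → Prop := fun n ↦ n < depth y ∧ n < depth z ∧ S y n = S z n
    have hP : ∃ n, ¬ P n := ⟨depth y, fun h ↦ lt_irrefl _ h.1⟩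
    have hmin := fun m ↦ Nat.find_min (m := m) hP
    have hfin := Nat.find_spec hP
    cases hn : Nat.find hP with
    | zero =>
      rw [hn] at hfin
      by_cases hy : y = r
      · exact Or.inl (by rw [hy]; exact hanc _ z rfl 0 (Nat.zero_le _))
      by_cases hz : z = r
      · exact Or.inr (by rw [hz]; exact hanc _ y rfl 0 (Nat.zero_le _))
      refine absurd ⟨hpos y hy, hpos z hz, Prod.ext rfl ?_⟩ hfin
      exact (reachIn_eq (mem_reachIn_of_adj hy hz hyz)).symm
    | succ n =>
      rw [hn] at hfin
      obtain ⟨h1, h2, h3⟩ := not_not.1 (hmin n (by omega))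
      have hw : (S y (n + 1)).1 = (S z (n + 1)).1 := by
        change nextVertex G idx (S y n) = nextVertex G idx (S z n)
        rw [h3]
      by_cases hy : y = (S y (n + 1)).1
      · left
        rw [hy, hw]
        exact hanc _ z rfl (n + 1) h2
      by_cases hz : z = (S z (n + 1)).1
      · right
        rw [hz, ← hw]
        exact hanc _ y rfl (n + 1) h1
      have hyC : y ∈ (S y n).2 \ {(S y (n + 1)).1} := ⟨(hdepth y n).1 h1, hy⟩
      have hzC : z ∈ (S y n).2 \ {(S y (n + 1)).1} :=
        ⟨h3 ▸ (hdepth z n).1 h2, by rw [hw]; exact hz⟩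
      have hy' : y ∈ (S y (n + 1)).2 := mem_reachIn_self hyC
      have hz' : z ∈ (S y (n + 1)).2 := mem_reachIn_of_adj hyC hzC hyz
      have he : S z (n + 1) = S y (n + 1) := searchState_eq hz' le_rfl
      exact absurd ⟨(hdepth y _).2 hy', (hdepth z _).2 (he ▸ hz'), he.symm⟩ hfin

end NormalTree

end LocallyFiniteGraph

end

noncomputable section

namespace LocallyFiniteGraph

universe u v w

/-! ### Combinatorial models of graphs -/

section Model

open unitInterval

/-- A description of a space as a locally finite graph with vertices `V` and edges `E`, every edge
being parametrised by the unit interval. -/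
structure GraphModel (X : Type u) [TopologicalSpace X] (V : Type v) (E : Type w) where
  vtx : V → X
  src : E → V
  tgt : E → V
  edge : E → C(I, X)
  edge_zero : ∀ e, edge e 0 = vtx (src e)
  edge_one : ∀ e, edge e 1 = vtx (tgt e)
  vtx_injective : Function.Injective vtx
  exists_cell : ∀ x, (∃ v, vtx v = x) ∨ ∃ e, ∃ s ∈ Ioo (0 : I) 1, edge e s = x
  edge_ne_vtx : ∀ e, ∀ s ∈ Ioo (0 : I) 1, ∀ v, edge e s ≠ vtx v
  edge_inj : ∀ e e', ∀ s ∈ Ioo (0 : I) 1, ∀ s' ∈ Ioo (0 : I) 1,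
    edge e s = edge e' s' → e = e' ∧ s = s'
  locallyFinite_vtx : LocallyFinite fun v ↦ ({vtx v} : Set X)
  locallyFinite_edge : LocallyFinite fun e ↦ range (edge e)

theorem unitInterval_cases (s : I) : s = 0 ∨ s = 1 ∨ s ∈ Ioo (0 : I) 1 := by
  by_cases h0 : s = 0
  · exact Or.inl h0
  by_cases h1 : s = 1
  · exact Or.inr (Or.inl h1)
  · exact Or.inr (Or.inr ⟨unitInterval.pos_iff_ne_zero.2 h0, unitInterval.lt_one_iff_ne_one.2 h1⟩)

namespace GraphModel

variable {X : Type u} [TopologicalSpace X] {V : Type v} {E : Type w} (M : GraphModel X V E)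

/-- The closed cells, indexed by the vertices and edges together. -/
def closedCell : V ⊕ E → Set X := Sum.elim (fun v ↦ {M.vtx v}) fun e ↦ range (M.edge e)

theorem locallyFinite_closedCell : LocallyFinite M.closedCell :=
  M.locallyFinite_vtx.sumElim M.locallyFinite_edge

theorem iUnion_closedCell : ⋃ c, M.closedCell c = univ := by
  refine eq_univ_of_forall fun x ↦ mem_iUnion.2 ?_
  obtain ⟨v, rfl⟩ | ⟨e, s, -, rfl⟩ := M.exists_cell x
  · exact ⟨Sum.inl v, rfl⟩
  · exact ⟨Sum.inr e, s, rfl⟩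

theorem isCompact_closedCell (c : V ⊕ E) : IsCompact (M.closedCell c) := by
  cases c with
  | inl v => exact isCompact_singleton
  | inr e => exact isCompact_range (M.edge e).continuous

theorem finite_edges_at (x : X) : {e | x ∈ range (M.edge e)}.Finite :=
  M.locallyFinite_edge.point_finite x

theorem finite_edges_src (v : V) : {e | M.src e = v}.Finite :=
  (M.finite_edges_at (M.vtx v)).subset fun e he ↦ ⟨0, by rw [M.edge_zero, he]⟩

theorem finite_edges_tgt (v : V) : {e | M.tgt e = v}.Finite :=
  (M.finite_edges_at (M.vtx v)).subset fun e he ↦ ⟨1, by rw [M.edge_one, he]⟩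

/-- The number of vertices in a compact set is finite. -/
theorem finite_vertices_mem {K : Set X} (hK : IsCompact K) : {v | M.vtx v ∈ K}.Finite :=
  (M.locallyFinite_vtx.finite_nonempty_inter_compact hK).subset fun v hv ↦ ⟨M.vtx v, rfl, hv⟩

theorem finite_edges_inter {K : Set X} (hK : IsCompact K) :
    {e | (range (M.edge e) ∩ K).Nonempty}.Finite :=
  M.locallyFinite_edge.finite_nonempty_inter_compact hK

/-- Every point lies on a vertex or on an edge, closed version of the cell decomposition. -/
theorem vtx_or_edge (x : X) : (∃ v, M.vtx v = x) ∨ ∃ e s, M.edge e s = x := by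
  obtain h | ⟨e, s, -, h⟩ := M.exists_cell x
  exacts [Or.inl h, Or.inr ⟨e, s, h⟩]

include M in
theorem weaklyLocallyCompactSpace : WeaklyLocallyCompactSpace X where
  exists_compact_mem_nhds x := by
    obtain ⟨U, hU, hfin⟩ := M.locallyFinite_closedCell x
    refine ⟨⋃ c ∈ {c | (M.closedCell c ∩ U).Nonempty}, M.closedCell c,
      hfin.isCompact_biUnion fun c _ ↦ M.isCompact_closedCell c, Filter.mem_of_superset hU ?_⟩
    intro y hy
    have : y ∈ ⋃ c, M.closedCell c := by rw [M.iUnion_closedCell]; trivial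
    obtain ⟨c, hc⟩ := mem_iUnion.1 this
    exact mem_biUnion (show c ∈ {c | (M.closedCell c ∩ U).Nonempty} from ⟨y, hc, hy⟩) hc

/-- Two functions on a graph agreeing on vertices and edges are equal. -/
theorem ext_of_cells {Y : Type*} {f g : X → Y} (hv : ∀ v, f (M.vtx v) = g (M.vtx v))
    (he : ∀ e s, f (M.edge e s) = g (M.edge e s)) : f = g := by
  funext x
  obtain ⟨v, rfl⟩ | ⟨e, s, rfl⟩ := M.vtx_or_edge x
  exacts [hv v, he e s]

include M in
theorem nonempty_vertices [Nonempty X] : Nonempty V := by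
  obtain ⟨x⟩ := ‹Nonempty X›
  obtain ⟨v, -⟩ | ⟨e, -⟩ := M.exists_cell x
  exacts [⟨v⟩, ⟨M.src e⟩]

section T2

variable [T2Space X]

theorem isClosed_closedCell (c : V ⊕ E) : IsClosed (M.closedCell c) :=
  (M.isCompact_closedCell c).isClosed

theorem isClosed_range_edge (e : E) : IsClosed (range (M.edge e)) :=
  M.isClosed_closedCell (Sum.inr e)

theorem isClosed_image_vtx (A : Set V) : IsClosed (M.vtx '' A) := by
  rw [← biUnion_of_singleton (M.vtx '' A), biUnion_image, biUnion_eq_iUnion]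
  exact (M.locallyFinite_vtx.comp_injective Subtype.val_injective).isClosed_iUnion
    fun _ ↦ isClosed_singleton

theorem isClosed_biUnion_edge (A : Set E) : IsClosed (⋃ e ∈ A, range (M.edge e)) := by
  rw [biUnion_eq_iUnion]
  exact (M.locallyFinite_edge.comp_injective Subtype.val_injective).isClosed_iUnion
    fun _ ↦ M.isClosed_range_edge _

/-- The closed cells form a locally finite closed cover, and a parametrised edge is a quotient map
onto its image because `I` is compact and `X` is Hausdorff. -/
theorem continuous_of_edges {Y : Type*} [TopologicalSpace Y] {f : X → Y}
    (h : ∀ e, Continuous (f ∘ M.edge e)) : Continuous f := by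
  refine M.locallyFinite_closedCell.continuous M.iUnion_closedCell M.isClosed_closedCell ?_
  rintro (v | e)
  · exact continuousOn_singleton _ _
  · have hq : IsQuotientMap (rangeFactorization (M.edge e)) :=
      IsClosedMap.isQuotientMap
        ((M.edge e).continuous.subtype_mk _).isClosedMap
        ((M.edge e).continuous.subtype_mk _) rangeFactorization_surjective
    change ContinuousOn f (range (M.edge e))
    rw [continuousOn_iff_continuous_domRestrict, hq.continuous_iff]
    exact h e

theorem exists_lift {Y : Type*} [TopologicalSpace Y] (f₀ : V → Y) (f₁ : E → C(I, Y))
    (h0 : ∀ e, f₁ e 0 = f₀ (M.src e)) (h1 : ∀ e, f₁ e 1 = f₀ (M.tgt e)) :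
    ∃ f : C(X, Y), (∀ v, f (M.vtx v) = f₀ v) ∧ ∀ e s, f (M.edge e s) = f₁ e s := by
  have key : ∀ x, ∃ y, (∀ v, M.vtx v = x → y = f₀ v) ∧ ∀ e s, M.edge e s = x → y = f₁ e s := by
    intro x
    obtain ⟨v, rfl⟩ | ⟨e, s, hs, rfl⟩ := M.exists_cell x
    · refine ⟨f₀ v, fun w hw ↦ by rw [M.vtx_injective hw], fun e s hes ↦ ?_⟩
      obtain rfl | rfl | hs := unitInterval_cases s
      · rw [M.edge_zero] at hes
        rw [h0, M.vtx_injective hes]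
      · rw [M.edge_one] at hes
        rw [h1, M.vtx_injective hes]
      · exact absurd hes (M.edge_ne_vtx e s hs v)
    · refine ⟨f₁ e s, fun w hw ↦ absurd hw.symm (M.edge_ne_vtx e s hs w), fun e' s' hes ↦ ?_⟩
      obtain rfl | rfl | hs' := unitInterval_cases s'
      · rw [M.edge_zero] at hes
        exact absurd hes.symm (M.edge_ne_vtx e s hs _)
      · rw [M.edge_one] at hes
        exact absurd hes.symm (M.edge_ne_vtx e s hs _)
      · obtain ⟨rfl, rfl⟩ := M.edge_inj _ _ _ hs' _ hs hes
        rfl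
  choose f hf using key
  refine ⟨⟨f, M.continuous_of_edges fun e ↦ ?_⟩, fun v ↦ (hf _).1 v rfl, fun e s ↦ (hf _).2 e s rfl⟩
  have : f ∘ M.edge e = f₁ e := funext fun s ↦ (hf _).2 e s rfl
  rw [this]
  exact (f₁ e).continuous

/-- The continuous map on a graph with prescribed values on vertices and edges. -/
def lift {Y : Type*} [TopologicalSpace Y] (f₀ : V → Y) (f₁ : E → C(I, Y))
    (h0 : ∀ e, f₁ e 0 = f₀ (M.src e)) (h1 : ∀ e, f₁ e 1 = f₀ (M.tgt e)) : C(X, Y) :=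
  (M.exists_lift f₀ f₁ h0 h1).choose

@[simp]
theorem lift_vtx {Y : Type*} [TopologicalSpace Y] (f₀ : V → Y) (f₁ : E → C(I, Y))
    (h0 : ∀ e, f₁ e 0 = f₀ (M.src e)) (h1 : ∀ e, f₁ e 1 = f₀ (M.tgt e)) (v : V) :
    M.lift f₀ f₁ h0 h1 (M.vtx v) = f₀ v :=
  (M.exists_lift f₀ f₁ h0 h1).choose_spec.1 v

@[simp]
theorem lift_edge {Y : Type*} [TopologicalSpace Y] (f₀ : V → Y) (f₁ : E → C(I, Y))
    (h0 : ∀ e, f₁ e 0 = f₀ (M.src e)) (h1 : ∀ e, f₁ e 1 = f₀ (M.tgt e)) (e : E) (s : I) :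
    M.lift f₀ f₁ h0 h1 (M.edge e s) = f₁ e s :=
  (M.exists_lift f₀ f₁ h0 h1).choose_spec.2 e s

/-- The simple graph underlying a graph model. -/
def adjGraph : SimpleGraph V where
  Adj u v := u ≠ v ∧ ∃ e, (M.src e = u ∧ M.tgt e = v) ∨ (M.src e = v ∧ M.tgt e = u)
  symm := ⟨fun _ _ ⟨h, e, he⟩ ↦ ⟨h.symm, e, he.symm⟩⟩
  loopless := ⟨fun _ h ↦ h.1 rfl⟩

theorem connected_adjGraph [ConnectedSpace X] : M.adjGraph.Connected := by
  have : Nonempty V := M.nonempty_vertices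
  refine ⟨fun a b ↦ ?_⟩
  let P : Set V := {v | M.adjGraph.Reachable a v}
  -- If both `Q` and its complement are closed under edges, then `A Q` and `A Qᶜ` are complementary
  -- closed subsets of the connected space `X`.
  let A : Set V → Set X := fun Q ↦ M.vtx '' Q ∪ ⋃ e ∈ {e | M.src e ∈ Q}, range (M.edge e)
  have hA : ∀ Q, IsClosed (A Q) := fun Q ↦ (M.isClosed_image_vtx Q).union (M.isClosed_biUnion_edge _)
  have hP : ∀ e, M.src e ∈ P ↔ M.tgt e ∈ P := by
    intro e
    by_cases h : M.src e = M.tgt e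
    · rw [h]
    · have hadj : M.adjGraph.Adj (M.src e) (M.tgt e) := ⟨h, e, Or.inl ⟨rfl, rfl⟩⟩
      exact ⟨fun h' ↦ h'.trans hadj.reachable, fun h' ↦ h'.trans hadj.symm.reachable⟩
  have hvtx : ∀ Q : Set V, (∀ e, M.src e ∈ Q ↔ M.tgt e ∈ Q) → ∀ v, M.vtx v ∈ A Q → v ∈ Q := by
    rintro Q hQ v (⟨w, hw, hwv⟩ | h)
    · exact M.vtx_injective hwv ▸ hw
    · simp only [mem_iUnion, mem_range] at h
      obtain ⟨e, he, s, hs⟩ := h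
      obtain rfl | rfl | hs' := unitInterval_cases s
      · rw [M.edge_zero] at hs
        exact M.vtx_injective hs ▸ he
      · rw [M.edge_one] at hs
        exact M.vtx_injective hs ▸ (hQ e).1 he
      · exact absurd hs (M.edge_ne_vtx e s hs' v)
  have hcompl : A Pᶜ = (A P)ᶜ := by
    ext x
    obtain ⟨v, rfl⟩ | ⟨e, s, hs, rfl⟩ := M.exists_cell x
    · refine ⟨fun h h' ↦ hvtx Pᶜ (fun e ↦ not_congr (hP e)) v h (hvtx P hP v h'), fun h ↦ Or.inl
        ⟨v, fun hv ↦ h (Or.inl ⟨v, hv, rfl⟩), rfl⟩⟩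
    · have hmem : ∀ Q, M.edge e s ∈ A Q ↔ M.src e ∈ Q := by
        refine fun Q ↦ ⟨?_, fun h ↦ Or.inr (mem_biUnion (x := e) h ⟨s, rfl⟩)⟩
        rintro (⟨w, -, hw⟩ | h)
        · exact absurd hw.symm (M.edge_ne_vtx e s hs w)
        · simp only [mem_iUnion, mem_range] at h
          obtain ⟨e', he', s', hs'⟩ := h
          obtain rfl | rfl | hs'' := unitInterval_cases s'
          · rw [M.edge_zero] at hs'
            exact absurd hs'.symm (M.edge_ne_vtx e s hs _)
          · rw [M.edge_one] at hs'
            exact absurd hs'.symm (M.edge_ne_vtx e s hs _)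
          · rwa [← (M.edge_inj _ _ _ hs'' _ hs hs').1]
      rw [mem_compl_iff, hmem, hmem, mem_compl_iff]
  have hclopen : IsClopen (A P) := ⟨hA P, by rw [← isClosed_compl_iff, ← hcompl]; exact hA _⟩
  have huniv := hclopen.eq_univ ⟨M.vtx a, Or.inl ⟨a, SimpleGraph.Reachable.refl a, rfl⟩⟩
  exact hvtx P hP b (huniv ▸ mem_univ _)

-- By local finiteness a vertex has finitely many neighbours, and by connectedness the successive
-- neighbourhoods `B n` of one vertex exhaust all vertices.
include M in
theorem countable_vertices [ConnectedSpace X] : Countable V := by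
  obtain ⟨a⟩ := M.nonempty_vertices
  have hN : ∀ v, {w | M.adjGraph.Adj v w}.Finite := by
    intro v
    refine (((M.finite_edges_src v).image M.tgt).union
      ((M.finite_edges_tgt v).image M.src)).subset ?_
    rintro w ⟨-, e, ⟨h1, h2⟩ | ⟨h1, h2⟩⟩
    · exact Or.inl ⟨e, h1, h2⟩
    · exact Or.inr ⟨e, h2, h1⟩
  let B : ℕ → Set V := fun n ↦ Nat.rec {a} (fun _ S ↦ S ∪ ⋃ v ∈ S, {w | M.adjGraph.Adj v w}) n
  have hB : ∀ n, (B n).Countable := by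
    intro n
    induction n with
    | zero => exact countable_singleton a
    | succ n ih => exact ih.union (ih.biUnion fun v _ ↦ (hN v).countable)
  have hcov : ∀ v, ∃ n, v ∈ B n := by
    clear hB
    intro v
    obtain ⟨p⟩ := (M.connected_adjGraph.preconnected v a)
    induction p with
    | nil => exact ⟨0, rfl⟩
    | cons h p ih =>
      obtain ⟨n, hn⟩ := ih
      exact ⟨n + 1, Or.inr (mem_biUnion hn h.symm)⟩
  rw [← countable_univ_iff]
  exact (countable_iUnion hB).mono fun v _ ↦ mem_iUnion.2 (hcov v)

end T2

open Classical in
/-- Reverse the parametrisation of the edges in a given set. -/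
def reorient (A : Set E) : GraphModel X V E where
  vtx := M.vtx
  src e := if e ∈ A then M.tgt e else M.src e
  tgt e := if e ∈ A then M.src e else M.tgt e
  edge e := if e ∈ A then (M.edge e).comp ⟨σ, continuous_symm⟩ else M.edge e
  edge_zero e := by split_ifs <;> simp [M.edge_zero, M.edge_one]
  edge_one e := by split_ifs <;> simp [M.edge_zero, M.edge_one]
  vtx_injective := M.vtx_injective
  exists_cell x := by
    refine (M.exists_cell x).imp_right ?_
    rintro ⟨e, s, hs, h⟩
    by_cases he : e ∈ A
    · refine ⟨e, σ s, ⟨unitInterval.symm_one ▸ unitInterval.symm_lt_symm.2 hs.2,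
        unitInterval.symm_zero ▸ unitInterval.symm_lt_symm.2 hs.1⟩, by simpa [he] using h⟩
    · exact ⟨e, s, hs, by simpa [he] using h⟩
  edge_ne_vtx e s hs v := by
    have hs' : σ s ∈ Ioo (0 : I) 1 := ⟨unitInterval.symm_one ▸ unitInterval.symm_lt_symm.2 hs.2,
        unitInterval.symm_zero ▸ unitInterval.symm_lt_symm.2 hs.1⟩
    split_ifs
    · exact M.edge_ne_vtx e _ hs' v
    · exact M.edge_ne_vtx e s hs v
  edge_inj e e' s hs s' hs' h := by
    have hσ : ∀ s ∈ Ioo (0 : I) 1, σ s ∈ Ioo (0 : I) 1 := fun s hs ↦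
      ⟨unitInterval.symm_one ▸ unitInterval.symm_lt_symm.2 hs.2,
        unitInterval.symm_zero ▸ unitInterval.symm_lt_symm.2 hs.1⟩
    have hτ : ∀ e s, (if e ∈ A then (M.edge e).comp ⟨σ, continuous_symm⟩ else M.edge e) s =
        M.edge e (if e ∈ A then σ s else s) := fun e s ↦ by split_ifs <;> rfl
    rw [hτ, hτ] at h
    obtain ⟨rfl, h2⟩ := M.edge_inj _ _ _ (by split_ifs; exacts [hσ s hs, hs]) _
      (by split_ifs; exacts [hσ s' hs', hs']) h
    refine ⟨rfl, ?_⟩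
    split_ifs at h2
    · exact unitInterval.symm_bijective.injective h2
    · exact h2
  locallyFinite_vtx := M.locallyFinite_vtx
  locallyFinite_edge := by
    refine M.locallyFinite_edge.subset fun e ↦ ?_
    split_ifs
    · rintro _ ⟨s, rfl⟩; exact ⟨σ s, rfl⟩
    · exact subset_rfl

theorem image_edge_reorient (A : Set E) (e : E) :
    (M.reorient A).edge e '' Ioo 0 1 = M.edge e '' Ioo 0 1 := by
  have hσ : ∀ s ∈ Ioo (0 : I) 1, σ s ∈ Ioo (0 : I) 1 := fun s hs ↦
    ⟨unitInterval.symm_one ▸ unitInterval.symm_lt_symm.2 hs.2,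
      unitInterval.symm_zero ▸ unitInterval.symm_lt_symm.2 hs.1⟩
  by_cases he : e ∈ A
  · simp only [reorient, he, if_true]
    ext x
    constructor
    · rintro ⟨s, hs, rfl⟩; exact ⟨σ s, hσ s hs, rfl⟩
    · rintro ⟨s, hs, rfl⟩; exact ⟨σ s, hσ s hs, by simp⟩
  · simp only [reorient, he, if_false]

end GraphModel

/-- A graph model together with a normal spanning tree, every edge being directed away from the
root. -/
structure TreeModel (X : Type u) [TopologicalSpace X] (V : Type v) (E : Type w) extends
    GraphModel X V E, RootedTree V where
  /-- The edges of the spanning tree. -/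
  treeEdge : Set E
  tgt_ne_root : ∀ e ∈ treeEdge, tgt e ≠ root
  src_eq_parent : ∀ e ∈ treeEdge, src e = parent (tgt e)
  existsUnique_treeEdge : ∀ v, v ≠ root → ∃! e, e ∈ treeEdge ∧ tgt e = v
  le_src_tgt : ∀ e, toRootedTree.Le (src e) (tgt e)

theorem GraphModel.exists_treeModel {X : Type u} [TopologicalSpace X] [T2Space X]
    [ConnectedSpace X] {V : Type v} {E : Type w} (M : GraphModel X V E) :
    ∃ N : TreeModel X V E, N.vtx = M.vtx ∧ ∀ e, N.edge e '' Ioo 0 1 = M.edge e '' Ioo 0 1 := by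
  have := M.countable_vertices
  obtain ⟨t, ht, hcomp⟩ := exists_normal_spanning_tree M.connected_adjGraph
  have hcomp' : ∀ e, t.Le (M.src e) (M.tgt e) ∨ t.Le (M.tgt e) (M.src e) := by
    intro e
    by_cases h : M.src e = M.tgt e
    · exact Or.inl ⟨0, h.symm⟩
    · exact hcomp _ _ ⟨h, e, Or.inl ⟨rfl, rfl⟩⟩
  have hdepth : ∀ {u v}, t.Le u v → t.depth u ≤ t.depth v := by
    rintro u v ⟨k, rfl⟩
    induction k with
    | zero => exact le_rfl
    | succ k ih =>
      refine le_trans ?_ ih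
      rw [Function.iterate_succ_apply']
      by_cases h : t.parent^[k] v = t.root
      · rw [h, t.parent_root]
      · have := t.depth_parent _ h; omega
  -- The endpoints of each edge are comparable, so reversing exactly these edges makes all edges
  -- ascend.
  let A : Set E := {e | ¬ t.Le (M.src e) (M.tgt e)}
  let N := M.reorient A
  have hle : ∀ e, t.Le (N.src e) (N.tgt e) := by
    intro e
    by_cases h : e ∈ A
    · simpa [N, GraphModel.reorient, h] using (hcomp' e).resolve_left h
    · simpa [N, GraphModel.reorient, h] using not_not.1 h
  have hex : ∀ v : {v // v ≠ t.root}, ∃ e, N.src e = t.parent v ∧ N.tgt e = v := by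
    rintro ⟨v, hv⟩
    obtain ⟨hne, e, he⟩ := ht v hv
    refine ⟨e, ?_⟩
    have hlt : t.depth (t.parent v) < t.depth v := by have := t.depth_parent v hv; omega
    have h1 : (N.src e = t.parent v ∧ N.tgt e = v) ∨ (N.src e = v ∧ N.tgt e = t.parent v) := by
      by_cases h : e ∈ A
      · simp only [N, GraphModel.reorient, h, if_true]; tauto
      · simp only [N, GraphModel.reorient, h, if_false]; tauto
    refine h1.resolve_right fun ⟨h2, h3⟩ ↦ ?_
    have := hdepth (hle e)
    rw [h2, h3] at this
    omega
  choose te hte using hex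
  refine ⟨{ N, t with
    treeEdge := range te
    tgt_ne_root := ?_
    src_eq_parent := ?_
    existsUnique_treeEdge := ?_
    le_src_tgt := hle }, rfl, fun e ↦ M.image_edge_reorient A e⟩
  · rintro _ ⟨v, rfl⟩ h
    exact v.2 ((hte v).2.symm.trans h)
  · rintro _ ⟨v, rfl⟩
    rw [(hte v).1, (hte v).2]
  · rintro v hv
    refine ⟨te ⟨v, hv⟩, ⟨⟨_, rfl⟩, (hte _).2⟩, ?_⟩
    rintro _ ⟨⟨w, rfl⟩, hw⟩
    rw [(hte w).2] at hw
    congr 1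
    exact Subtype.ext hw

end Model

/-! ### The model of a one-dimensional CW complex -/

section CW

open unitInterval Metric

variable {X : Type u} [TopologicalSpace X] [CWComplex (univ : Set X)]

theorem IsLocallyFiniteGraph.exists_graphModel (hX : IsLocallyFiniteGraph X) :
    ∃ M : GraphModel X (RelCWComplex.cell (univ : Set X) 0) (RelCWComplex.cell (univ : Set X) 1),
      (∀ v, RelCWComplex.openCell 0 v = {M.vtx v}) ∧
        ∀ e, RelCWComplex.openCell 1 e = M.edge e '' Ioo 0 1 := by
  let V := RelCWComplex.cell (univ : Set X) 0
  let E := RelCWComplex.cell (univ : Set X) 1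
  let vtx : V → X := fun v ↦ RelCWComplex.map 0 v ![]
  -- The affine parametrisation of `[-1, 1]`, the closed unit ball of dimension one.
  let χ : I → (Fin 1 → ℝ) := fun s _ ↦ 2 * (s : ℝ) - 1
  have hχc : Continuous χ := by fun_prop
  have hχm : ∀ s, χ s ∈ closedBall (0 : Fin 1 → ℝ) 1 := by
    intro s
    rw [mem_closedBall_zero_iff, pi_norm_le_iff_of_nonneg zero_le_one]
    intro i
    rw [Real.norm_eq_abs, abs_le]
    constructor <;> simp only [χ] <;> linarith [s.2.1, s.2.2]
  have hχb : ∀ s, s ∈ Ioo (0 : I) 1 ↔ χ s ∈ ball (0 : Fin 1 → ℝ) 1 := by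
    intro s
    rw [mem_ball_zero_iff, pi_norm_lt_iff zero_lt_one]
    simp only [χ, Real.norm_eq_abs, abs_lt, Fin.forall_fin_one, mem_Ioo, ← Subtype.coe_lt_coe,
      Icc.coe_zero, Icc.coe_one]
    constructor <;> rintro ⟨h1, h2⟩ <;> constructor <;> linarith
  have hχs : ∀ y : Fin 1 → ℝ, y ∈ closedBall (0 : Fin 1 → ℝ) 1 → ∃ s, χ s = y := by
    intro y hy
    rw [mem_closedBall_zero_iff, pi_norm_le_iff_of_nonneg zero_le_one] at hy
    have := abs_le.1 (hy 0)
    refine ⟨⟨(y 0 + 1) / 2, by linarith, by linarith⟩, ?_⟩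
    ext i
    rw [Subsingleton.elim i 0]
    simp only [χ]
    ring
  have hχinj : Function.Injective χ := by
    intro s s' h
    have := congrFun h 0
    simp only [χ] at this
    exact Subtype.ext (by linarith)
  let edge : E → C(I, X) := fun e ↦
    ⟨fun s ↦ RelCWComplex.map 1 e (χ s), (RelCWComplex.continuousOn 1 e).comp_continuous hχc hχm⟩
  have hopen0 : ∀ v : V, RelCWComplex.openCell 0 v = {vtx v} := fun v ↦
    RelCWComplex.openCell_zero_eq_singleton
  have hclosed0 : ∀ v : V, RelCWComplex.closedCell 0 v = {vtx v} := fun v ↦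
    RelCWComplex.closedCell_zero_eq_singleton
  have hopen1 : ∀ e : E, RelCWComplex.openCell 1 e = edge e '' Ioo 0 1 := by
    intro e
    ext x
    constructor
    · rintro ⟨y, hy, rfl⟩
      obtain ⟨s, rfl⟩ := hχs y (ball_subset_closedBall hy)
      exact ⟨s, (hχb s).2 hy, rfl⟩
    · rintro ⟨s, hs, rfl⟩
      exact ⟨χ s, (hχb s).1 hs, rfl⟩
  have hclosed1 : ∀ e : E, RelCWComplex.closedCell 1 e = range (edge e) := by
    intro e
    ext x
    constructor
    · rintro ⟨y, hy, rfl⟩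
      obtain ⟨s, rfl⟩ := hχs y hy
      exact ⟨s, rfl⟩
    · rintro ⟨s, rfl⟩
      exact ⟨χ s, hχm s, rfl⟩
  have hend : ∀ e : E, ∀ s, s ∉ Ioo (0 : I) 1 → ∃ v, edge e s = vtx v := by
    intro e s hs
    obtain ⟨x, y, hxy⟩ := CWComplex.exists_cellFrontier_one_eq e
    have : edge e s ∈ RelCWComplex.cellFrontier 1 e := by
      refine ⟨χ s, ?_, rfl⟩
      rw [← closedBall_sdiff_ball]
      exact ⟨hχm s, fun h ↦ hs ((hχb s).2 h)⟩
    rw [hxy, hclosed0, hclosed0] at this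
    exact this.elim (fun h ↦ ⟨x, h⟩) fun h ↦ ⟨y, h⟩
  choose src hsrc using fun e ↦ hend e 0 fun h ↦ lt_irrefl _ h.1
  choose tgt htgt using fun e ↦ hend e 1 fun h ↦ lt_irrefl _ h.2
  refine ⟨{ vtx := vtx, src := src, tgt := tgt, edge := edge, edge_zero := hsrc, edge_one := htgt,
            vtx_injective := RelCWComplex.injective_map_zero _
            exists_cell := ?_, edge_ne_vtx := ?_, edge_inj := ?_
            locallyFinite_vtx := ?_, locallyFinite_edge := ?_ }, hopen0, hopen1⟩
  · intro x
    have hx : x ∈ (univ : Set X) := mem_univ x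
    rw [← CWComplex.iUnion_openCell_eq_complex (C := (univ : Set X))] at hx
    simp only [mem_iUnion] at hx
    obtain ⟨n, i, hi⟩ := hx
    match n, i, hi with
    | 0, v, hv => rw [hopen0] at hv; exact Or.inl ⟨v, hv.symm⟩
    | 1, e, he => rw [hopen1] at he; obtain ⟨s, hs, h⟩ := he; exact Or.inr ⟨e, s, hs, h⟩
    | n + 2, e, _ => exact ((hX.isEmpty_cell (n + 2) (by omega)).false e).elim
  · intro e s hs v h
    have h1 : edge e s ∈ RelCWComplex.openCell 1 e := by rw [hopen1]; exact ⟨s, hs, rfl⟩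
    have h2 : edge e s ∈ RelCWComplex.openCell 0 v := by rw [hopen0]; exact h
    have hne : (⟨1, e⟩ : Σ n, RelCWComplex.cell (univ : Set X) n) ≠ ⟨0, v⟩ := fun h ↦
      one_ne_zero (congrArg Sigma.fst h)
    exact (RelCWComplex.disjoint_openCell_of_ne hne).notMem_of_mem_left h1 h2
  · intro e e' s hs s' hs' h
    have h1 : edge e s ∈ RelCWComplex.openCell 1 e := by rw [hopen1]; exact ⟨s, hs, rfl⟩
    have h2 : edge e s ∈ RelCWComplex.openCell 1 e' := by rw [hopen1]; exact ⟨s', hs', h.symm⟩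
    have he : e = e' := by
      by_contra hne
      have hne : (⟨1, e⟩ : Σ n, RelCWComplex.cell (univ : Set X) n) ≠ ⟨1, e'⟩ := fun h ↦
        hne (eq_of_heq (Sigma.mk.inj h).2)
      exact (RelCWComplex.disjoint_openCell_of_ne hne).notMem_of_mem_left h1 h2
    subst he
    refine ⟨rfl, hχinj ((RelCWComplex.map 1 e).injOn ?_ ?_ h)⟩
    · rw [RelCWComplex.source_eq]; exact (hχb s).1 hs
    · rw [RelCWComplex.source_eq]; exact (hχb s').1 hs'
  · have := hX.locallyFinite.comp_injective (g := fun v : V ↦ (⟨0, v⟩ : Σ n, RelCWComplex.cell (univ : Set X) n))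
      (fun _ _ h ↦ eq_of_heq (Sigma.mk.inj h).2)
    refine this.subset fun v ↦ ?_
    exact (hclosed0 v).symm.subset
  · have := hX.locallyFinite.comp_injective (g := fun e : E ↦ (⟨1, e⟩ : Σ n, RelCWComplex.cell (univ : Set X) n))
      (fun _ _ h ↦ eq_of_heq (Sigma.mk.inj h).2)
    refine this.subset fun e ↦ ?_
    exact (hclosed1 e).symm.subset

end CW

end LocallyFiniteGraph

end

noncomputable section

namespace LocallyFiniteGraph

universe u v w

/-! ### The order of a rooted tree -/

namespace RootedTree

variable {V : Type*} (t : RootedTree V)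

theorem le_refl (v : V) : t.Le v v := ⟨0, rfl⟩

variable {t}

theorem Le.trans {u v w : V} (h : t.Le u v) (h' : t.Le v w) : t.Le u w := by
  obtain ⟨k, rfl⟩ := h
  obtain ⟨l, rfl⟩ := h'
  exact ⟨k + l, Function.iterate_add_apply _ _ _ _⟩

variable (t)

theorem parent_le (v : V) : t.Le (t.parent v) v := ⟨1, rfl⟩

theorem depth_iterate (v : V) (k : ℕ) : t.depth (t.parent^[k] v) = t.depth v - k := by
  induction k with
  | zero => rfl
  | succ k ih =>
    rw [Function.iterate_succ_apply']
    by_cases h : t.parent^[k] v = t.root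
    · rw [h, t.parent_root, t.depth_root]
      rw [h, t.depth_root] at ih
      omega
    · have := t.depth_parent _ h
      omega

theorem depth_eq_zero {v : V} : t.depth v = 0 ↔ v = t.root := by
  refine ⟨fun h ↦ ?_, fun h ↦ h ▸ t.depth_root⟩
  by_contra hne
  have := t.depth_parent v hne
  omega

/-- The ancestor of `v` of depth `n`, for `n ≤ depth v`. -/
def anc (v : V) (n : ℕ) : V := t.parent^[t.depth v - n] v

theorem anc_le (v : V) (n : ℕ) : t.Le (t.anc v n) v := ⟨_, rfl⟩

theorem depth_anc {v : V} {n : ℕ} (h : n ≤ t.depth v) : t.depth (t.anc v n) = n := by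
  rw [anc, depth_iterate]; omega

variable {t}

theorem Le.depth_le {u v : V} (h : t.Le u v) : t.depth u ≤ t.depth v := by
  obtain ⟨k, rfl⟩ := h
  rw [depth_iterate]; omega

theorem Le.eq_anc {u v : V} (h : t.Le u v) : u = t.anc v (t.depth u) := by
  obtain ⟨k, rfl⟩ := h
  rw [anc, depth_iterate]
  obtain hk | hk := le_total k (t.depth v)
  · rw [Nat.sub_sub_self hk]
  -- Here `k` is at least the depth of `v`, and all further steps stay at the root.
  · have h0 : t.depth v - k = 0 := by omega
    rw [h0, Nat.sub_zero]
    have : ∀ j, t.depth v ≤ j → t.parent^[j] v = t.root := fun j hj ↦ by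
      rw [← t.depth_eq_zero, depth_iterate]; omega
    rw [this k hk, this _ le_rfl]

theorem Le.eq_of_depth_eq {u u' v : V} (h : t.Le u v) (h' : t.Le u' v)
    (hd : t.depth u = t.depth u') : u = u' := by rw [h.eq_anc, h'.eq_anc, hd]

theorem Le.antisymm {u v : V} (h : t.Le u v) (h' : t.Le v u) : u = v :=
  h.eq_of_depth_eq (t.le_refl v) (le_antisymm h.depth_le h'.depth_le)

/-- The ancestors of a vertex form a chain on which depth is strictly increasing. -/
theorem Le.le_of_depth_le {u u' v : V} (h : t.Le u v) (h' : t.Le u' v)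
    (hd : t.depth u ≤ t.depth u') : t.Le u u' := by
  have h1 := (t.anc_le u' (t.depth u)).trans h'
  rw [h.eq_of_depth_eq h1 (t.depth_anc hd).symm]
  exact t.anc_le _ _

variable (t)

theorem root_le (v : V) : t.Le t.root v := by
  have h := t.anc_le v 0
  rwa [t.depth_eq_zero.1 (t.depth_anc (Nat.zero_le _))] at h

variable {t}

theorem le_root_iff {u : V} : t.Le u t.root ↔ u = t.root :=
  ⟨fun h ↦ h.antisymm (t.root_le u), fun h ↦ h ▸ t.le_refl _⟩

theorem le_parent_iff {u v : V} (hv : v ≠ t.root) : t.Le u (t.parent v) ↔ t.Le u v ∧ u ≠ v := by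
  have hd := t.depth_parent v hv
  constructor
  · intro h
    refine ⟨h.trans (t.parent_le v), ?_⟩
    rintro rfl
    have := h.depth_le
    omega
  · rintro ⟨h, hne⟩
    refine h.le_of_depth_le (t.parent_le v) ?_
    by_contra hlt
    refine hne (h.eq_of_depth_eq (t.le_refl v) ?_)
    have := h.depth_le
    omega

theorem Le.eq_of_depth_le {u v : V} (h : t.Le u v) (hd : t.depth v ≤ t.depth u) : u = v :=
  h.eq_of_depth_eq (t.le_refl v) (le_antisymm h.depth_le hd)

end RootedTree

/-- If the image of an ultrafilter converges to `f x`, the ultrafilter contains a compact set and so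
converges to some `y`; then `f y = f x`, since limits in `B` are unique. -/
theorem isInducing_of_isCompact_preimage {A B : Type*} [TopologicalSpace A] [TopologicalSpace B]
    [T2Space B] {f : A → B} (hf : Continuous f) (hinj : Function.Injective f)
    (h : ∀ x, ∃ O, IsOpen O ∧ f x ∈ O ∧ ∃ C, IsCompact C ∧ f ⁻¹' O ⊆ C) : IsInducing f := by
  refine isInducing_iff_nhds.2 fun x ↦ le_antisymm hf.continuousAt.le_comap ?_
  refine Filter.le_iff_ultrafilter.2 fun U hU ↦ ?_
  obtain ⟨O, hO, hxO, C, hC, hOC⟩ := h x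
  have hUC : C ∈ U := hU (Filter.mem_of_superset (Filter.preimage_mem_comap (hO.mem_nhds hxO)) hOC)
  obtain ⟨y, -, hy⟩ := hC.ultrafilter_le_nhds' U hUC
  have h1 : Filter.Tendsto f U (𝓝 (f x)) := Filter.tendsto_iff_comap.2 hU
  have h2 : Filter.Tendsto f U (𝓝 (f y)) := hf.continuousAt.tendsto.mono_left hy
  rw [← hinj (tendsto_nhds_unique h1 h2)] at hy
  exact hy

/-! ### Coordinates, cones and compact balls defined by the spanning tree -/

namespace TreeModel

open unitInterval

variable {X : Type u} [TopologicalSpace X] {V : Type v} {E : Type w} (N : TreeModel X V E)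

/-- A vertex of depth `n + 1` is the target of an edge that starts at depth `n`, and finitely many
edges start at any vertex. -/
theorem finite_depth_eq (n : ℕ) : {v | N.depth v = n}.Finite := by
  induction n with
  | zero =>
    refine (finite_singleton N.root).subset fun v hv ↦ N.depth_eq_zero.1 hv
  | succ n ih =>
    refine (ih.biUnion fun v _ ↦ (N.finite_edges_src v).image N.tgt).subset fun v hv ↦ ?_
    have hne : v ≠ N.root := fun h ↦ by
      rw [mem_ofPred_eq, h, N.depth_root] at hv; omega
    obtain ⟨e, ⟨he, rfl⟩, -⟩ := N.existsUnique_treeEdge v hne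
    refine mem_biUnion (x := N.src e) ?_ ⟨e, rfl, rfl⟩
    have := N.depth_parent _ hne
    rw [N.src_eq_parent e he, mem_ofPred_eq]
    rw [mem_ofPred_eq] at hv
    omega

theorem finite_depth_lt (n : ℕ) : {v | N.depth v < n}.Finite :=
  ((finite_Iio n).biUnion fun k _ ↦ N.finite_depth_eq k).subset fun _ hv ↦ mem_biUnion hv rfl

theorem finite_edges_depth_src_lt (n : ℕ) : {e | N.depth (N.src e) < n}.Finite :=
  ((N.finite_depth_lt n).biUnion fun v _ ↦ N.finite_edges_src v).subset
    fun _ he ↦ mem_biUnion he rfl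

theorem depth_src_le_tgt (e : E) : N.depth (N.src e) ≤ N.depth (N.tgt e) :=
  (N.le_src_tgt e).depth_le

/-- The spanning tree, as a subset of the space. -/
def tree : Set X := range N.vtx ∪ ⋃ e ∈ N.treeEdge, range (N.edge e)

theorem vtx_mem_tree (v : V) : N.vtx v ∈ N.tree := Or.inl ⟨v, rfl⟩

theorem edge_mem_tree {e : E} (he : e ∈ N.treeEdge) (s : I) : N.edge e s ∈ N.tree :=
  Or.inr (mem_biUnion he ⟨s, rfl⟩)

theorem tree_cases {x : X} (hx : x ∈ N.tree) :
    x = N.vtx N.root ∨ ∃ e ∈ N.treeEdge, ∃ s : I, 0 < s ∧ x = N.edge e s := by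
  have hv : ∀ v, N.vtx v = N.vtx N.root ∨ ∃ e ∈ N.treeEdge, ∃ s : I, 0 < s ∧
      N.vtx v = N.edge e s := by
    intro v
    by_cases h : v = N.root
    · exact Or.inl (h ▸ rfl)
    · obtain ⟨e, ⟨he, rfl⟩, -⟩ := N.existsUnique_treeEdge v h
      exact Or.inr ⟨e, he, 1, zero_lt_one, (N.edge_one e).symm⟩
  obtain ⟨v, rfl⟩ | h := hx
  · exact hv v
  · simp only [mem_iUnion, mem_range] at h
    obtain ⟨e, he, s, rfl⟩ := h
    by_cases hs : s = 0
    · rw [hs, N.edge_zero]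
      exact hv _
    · exact Or.inr ⟨e, he, s, unitInterval.pos_iff_ne_zero.2 hs, rfl⟩

section T2

variable [T2Space X]

theorem isClosed_tree : IsClosed N.tree := by
  rw [tree, ← image_univ]
  exact (N.isClosed_image_vtx _).union (N.isClosed_biUnion_edge _)

open Classical in
/-- The coordinate of the part of the graph above the vertex `u`: it is `1` at the vertices above
`u`, `0` at the other vertices, and affine on edges. -/
def coord (u : V) : C(X, ℝ) :=
  N.lift (fun v ↦ if N.Le u v then 1 else 0)
    (fun e ↦ ⟨fun s ↦ (1 - s) * (if N.Le u (N.src e) then 1 else 0) +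
      s * (if N.Le u (N.tgt e) then 1 else 0), by fun_prop⟩) (by simp) (by simp)

open Classical in
theorem coord_vtx (u v : V) : N.coord u (N.vtx v) = if N.Le u v then 1 else 0 :=
  N.lift_vtx _ _ _ _ v

open Classical in
theorem coord_edge (u : V) (e : E) (s : I) : N.coord u (N.edge e s) =
    (1 - s) * (if N.Le u (N.src e) then 1 else 0) + s * (if N.Le u (N.tgt e) then 1 else 0) :=
  N.lift_edge _ _ _ _ e s

theorem coord_nonneg (u : V) (x : X) : 0 ≤ N.coord u x := by
  obtain ⟨v, rfl⟩ | ⟨e, s, rfl⟩ := N.vtx_or_edge x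
  · rw [coord_vtx]; split_ifs <;> norm_num
  · have h0 := s.2.1
    have h1 := s.2.2
    rw [coord_edge]; split_ifs <;> simp <;> linarith

theorem coord_le_one (u : V) (x : X) : N.coord u x ≤ 1 := by
  obtain ⟨v, rfl⟩ | ⟨e, s, rfl⟩ := N.vtx_or_edge x
  · rw [coord_vtx]; split_ifs <;> norm_num
  · have h0 := s.2.1
    have h1 := s.2.2
    rw [coord_edge]; split_ifs <;> simp <;> linarith

theorem coord_root (x : X) : N.coord N.root x = 1 := by
  obtain ⟨v, rfl⟩ | ⟨e, s, rfl⟩ := N.vtx_or_edge x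
  · rw [coord_vtx, if_pos (N.root_le v)]
  · rw [coord_edge, if_pos (N.root_le _), if_pos (N.root_le _)]; ring

/-- The part of the graph above the vertex `u`. -/
def cone (u : V) : Set X := {x | 0 < N.coord u x}

theorem isOpen_cone (u : V) : IsOpen (N.cone u) :=
  isOpen_lt continuous_const (N.coord u).continuous

theorem vtx_mem_cone {u v : V} : N.vtx v ∈ N.cone u ↔ N.Le u v := by
  rw [cone, mem_ofPred_eq, coord_vtx]; split_ifs with h <;> simp [h]

/-- Since edges ascend, an edge whose target lies above `u` belongs to the cone except possibly for
its source. This holds for non-tree edges too, by normality. -/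
theorem edge_mem_cone {u : V} {e : E} {s : I} (hs : 0 < s) :
    N.edge e s ∈ N.cone u ↔ N.Le u (N.tgt e) := by
  have hs' : (0 : ℝ) < s := hs
  have h1 := s.2.2
  have h2 := fun h : N.Le u (N.src e) ↦ h.trans (N.le_src_tgt e)
  rw [cone, mem_ofPred_eq, coord_edge]
  split_ifs with h h' h'
  · simp [h']
  · exact absurd (h2 h) h'
  · simpa [h'] using hs
  · simp [h']

theorem edge_mem_cone_of_src {u : V} {e : E} (h : N.Le u (N.src e)) (s : I) :
    N.edge e s ∈ N.cone u := by
  obtain rfl | hs := eq_or_ne s 0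
  · rwa [N.edge_zero, vtx_mem_cone]
  · exact (N.edge_mem_cone (unitInterval.pos_iff_ne_zero.2 hs)).2 (h.trans (N.le_src_tgt e))

theorem cone_subset_cone {u v : V} (h : N.Le u v) : N.cone v ⊆ N.cone u := by
  intro x hx
  obtain ⟨v, rfl⟩ | ⟨e, s, hs, rfl⟩ := N.exists_cell x
  · exact N.vtx_mem_cone.2 (h.trans (N.vtx_mem_cone.1 hx))
  · exact (N.edge_mem_cone hs.1).2 (h.trans ((N.edge_mem_cone hs.1).1 hx))

/-- Every point of a cone lies below a vertex of the cone. -/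
theorem exists_vertex_of_mem_cone (x : X) : ∃ v, ∀ u, x ∈ N.cone u ↔ N.Le u v := by
  obtain ⟨v, rfl⟩ | ⟨e, s, hs, rfl⟩ := N.exists_cell x
  · exact ⟨v, fun u ↦ N.vtx_mem_cone⟩
  · exact ⟨N.tgt e, fun u ↦ N.edge_mem_cone hs.1⟩

theorem le_of_mem_cone {u v : V} {x : X} (hu : x ∈ N.cone u) (hv : x ∈ N.cone v)
    (h : N.depth u ≤ N.depth v) : N.Le u v := by
  obtain ⟨w, hw⟩ := N.exists_vertex_of_mem_cone x
  exact ((hw u).1 hu).le_of_depth_le ((hw v).1 hv) h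

/-- A vertex above `u` descends to `u` along tree edges inside the cone, and an interior point of an
edge is joined to the target of that edge. -/
theorem isPreconnected_cone (u : V) : IsPreconnected (N.cone u) := by
  have hv : ∀ n v, N.depth v ≤ n → N.Le u v →
      ∃ t ⊆ N.cone u, N.vtx u ∈ t ∧ N.vtx v ∈ t ∧ IsPreconnected t := by
    intro n
    induction n with
    | zero =>
      intro v hv h
      obtain rfl := N.depth_eq_zero.1 (Nat.le_zero.1 hv)
      obtain rfl := RootedTree.le_root_iff.1 h
      exact ⟨{N.vtx N.root}, singleton_subset_iff.2 (N.vtx_mem_cone.2 h), rfl, rfl,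
        isPreconnected_singleton⟩
    | succ n ih =>
      intro v hv h
      by_cases huv : u = v
      · exact ⟨{N.vtx u}, singleton_subset_iff.2 (N.vtx_mem_cone.2 (N.le_refl u)), rfl,
          huv ▸ rfl, isPreconnected_singleton⟩
      have hne : v ≠ N.root := fun h' ↦ by
        subst h'; exact huv (RootedTree.le_root_iff.1 h)
      obtain ⟨e, ⟨he, rfl⟩, -⟩ := N.existsUnique_treeEdge v hne
      have hp : N.Le u (N.src e) := by
        rw [N.src_eq_parent e he]; exact (RootedTree.le_parent_iff hne).2 ⟨h, huv⟩
      have hd := N.depth_parent _ hne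
      obtain ⟨t, ht, h1, h2, h3⟩ := ih (N.src e) (by rw [N.src_eq_parent e he]; omega) hp
      refine ⟨t ∪ range (N.edge e), union_subset ht ?_, Or.inl h1,
        Or.inr ⟨1, N.edge_one e⟩, h3.union (N.vtx (N.src e)) h2 ⟨0, N.edge_zero e⟩
          (isPreconnected_range (N.edge e).continuous)⟩
      rintro _ ⟨s, rfl⟩
      exact N.edge_mem_cone_of_src hp s
  refine isPreconnected_of_forall (N.vtx u) fun x hx ↦ ?_
  obtain ⟨v, rfl⟩ | ⟨e, s, hs, rfl⟩ := N.exists_cell x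
  · exact hv _ v le_rfl (N.vtx_mem_cone.1 hx)
  · have h := (N.edge_mem_cone hs.1).1 hx
    obtain ⟨t, ht, h1, h2, h3⟩ := hv _ _ le_rfl h
    refine ⟨t ∪ N.edge e '' Ioc 0 1, union_subset ht ?_, Or.inl h1, Or.inr ⟨s, ⟨hs.1, hs.2.le⟩, rfl⟩,
      h3.union (N.vtx (N.tgt e)) h2 ⟨1, ⟨zero_lt_one, le_rfl⟩, N.edge_one e⟩
        (isPreconnected_Ioc.image _ (N.edge e).continuous.continuousOn)⟩
    rintro _ ⟨s', hs', rfl⟩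
    exact (N.edge_mem_cone hs'.1).2 h

/-- A connected set that avoids the vertices strictly below `u` lies inside or outside of the
cone of `u`. -/
theorem subset_cone_of_isPreconnected {u : V} {S : Set X} (hS : IsPreconnected S)
    (hmiss : ∀ v, N.depth v < N.depth u → N.vtx v ∉ S) (hmeet : (S ∩ N.cone u).Nonempty) :
    S ⊆ N.cone u := by
  -- This closed set exceeds the cone only by sources of edges entering it. Such a source lies
  -- strictly below `u`, being comparable with `u` through the common target, so `S` avoids it.
  let C : Set X := N.vtx '' {v | N.Le u v} ∪ ⋃ e ∈ {e | N.Le u (N.tgt e)}, range (N.edge e)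
  have hC : IsClosed C := (N.isClosed_image_vtx _).union (N.isClosed_biUnion_edge _)
  have h1 : N.cone u ⊆ C := by
    intro x hx
    obtain ⟨v, rfl⟩ | ⟨e, s, hs, rfl⟩ := N.exists_cell x
    · exact Or.inl ⟨v, N.vtx_mem_cone.1 hx, rfl⟩
    · exact Or.inr (mem_biUnion (x := e) ((N.edge_mem_cone hs.1).1 hx) ⟨s, rfl⟩)
  have h2 : S ∩ C ⊆ N.cone u := by
    rintro x ⟨hxS, ⟨v, hv, rfl⟩ | h⟩
    · exact N.vtx_mem_cone.2 hv
    · simp only [mem_iUnion, mem_range] at h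
      obtain ⟨e, he, s, rfl⟩ := h
      obtain rfl | hs := eq_or_ne s 0
      · rw [N.edge_zero] at hxS ⊢
        rw [vtx_mem_cone]
        have : N.depth u ≤ N.depth (N.src e) := by
          by_contra hlt
          exact hmiss _ (not_le.1 hlt) hxS
        exact RootedTree.Le.le_of_depth_le he (N.le_src_tgt e) this
      · exact (N.edge_mem_cone (unitInterval.pos_iff_ne_zero.2 hs)).2 he
  refine hS.subset_left_of_subset_union (N.isOpen_cone u) hC.isOpen_compl
    (disjoint_compl_right_iff_subset.2 h1) (fun x hx ↦ ?_) hmeet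
  by_cases hxC : x ∈ C
  exacts [Or.inl (h2 ⟨hx, hxC⟩), Or.inr hxC]

/-- The part of the graph outside of the cones of the vertices of depth `n`. -/
def ball (n : ℕ) : Compacts X where
  carrier := (⋃ u ∈ {u | N.depth u = n}, N.cone u)ᶜ
  isCompact' := by
    -- Finitely many closed cells suffice: a vertex of depth at least `n`, or the interior of an
    -- edge that starts there, lies in a cone of depth `n`.
    have hc : IsCompact (N.vtx '' {v | N.depth v < n} ∪
        ⋃ e ∈ {e | N.depth (N.src e) < n}, range (N.edge e)) :=
      ((N.finite_depth_lt n).image _).isCompact.union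
        ((N.finite_edges_depth_src_lt n).isCompact_biUnion fun e _ ↦
          isCompact_range (N.edge e).continuous)
    refine hc.of_isClosed_subset (isOpen_biUnion fun u _ ↦ N.isOpen_cone u).isClosed_compl ?_
    intro x hx
    simp only [mem_compl_iff, mem_iUnion, not_exists] at hx
    obtain ⟨v, rfl⟩ | ⟨e, s, hs, rfl⟩ := N.exists_cell x
    · refine Or.inl ⟨v, not_le.1 fun h ↦ hx (N.anc v n) (N.depth_anc h) ?_, rfl⟩
      exact N.vtx_mem_cone.2 (N.anc_le v n)
    · refine Or.inr (mem_biUnion (x := e) ?_ ⟨s, rfl⟩)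
      by_contra h
      have h' : n ≤ N.depth (N.tgt e) := (not_lt.1 h).trans (N.depth_src_le_tgt e)
      exact hx (N.anc (N.tgt e) n) (N.depth_anc h') ((N.edge_mem_cone hs.1).2 (N.anc_le _ n))

theorem notMem_ball {n : ℕ} {x : X} : x ∉ N.ball n ↔ ∃ u, N.depth u = n ∧ x ∈ N.cone u := by
  change x ∉ (⋃ u ∈ {u | N.depth u = n}, N.cone u)ᶜ ↔ _
  simp

/-- A compact set misses all cones of large depth. -/
theorem exists_disjoint_cone {K : Set X} (hK : IsCompact K) :
    ∃ n, ∀ u, n ≤ N.depth u → Disjoint (N.cone u) K := by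
  obtain ⟨n, hn⟩ := ((N.finite_vertices_mem hK).image N.depth).bddAbove
  obtain ⟨m, hm⟩ := ((N.finite_edges_inter hK).image fun e ↦ N.depth (N.tgt e)).bddAbove
  refine ⟨max n m + 1, fun u hu ↦ disjoint_left.2 fun x hx hxK ↦ ?_⟩
  obtain ⟨v, rfl⟩ | ⟨e, s, hs, rfl⟩ := N.exists_cell x
  · have h1 := (N.vtx_mem_cone.1 hx).depth_le
    have h2 := hn ⟨v, hxK, rfl⟩
    omega
  · have h1 := ((N.edge_mem_cone hs.1).1 hx).depth_le
    have h2 := hm ⟨e, ⟨_, ⟨s, rfl⟩, hxK⟩, rfl⟩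
    simp only at h2
    omega

/-! ### Paths in the spanning tree -/

/-- The child is the only vertex that lies below the target of a tree edge but not below its source,
so just one coordinate varies along the edge. -/
theorem coord_treeEdge {e : E} (he : e ∈ N.treeEdge) (u : V) (s : I) [Decidable (u = N.tgt e)] :
    N.coord u (N.edge e s) = if u = N.tgt e then (s : ℝ) else N.coord u (N.vtx (N.src e)) := by
  have h := RootedTree.le_parent_iff (t := N.toRootedTree) (u := u) (N.tgt_ne_root e he)
  rw [coord_edge, coord_vtx, N.src_eq_parent e he]
  by_cases h1 : u = N.tgt e
  · have h2 : ¬ N.Le u (N.parent (N.tgt e)) := fun h' ↦ (h.1 h').2 h1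
    rw [if_pos h1, if_neg h2, if_pos (h1 ▸ N.le_refl _)]
    ring
  · rw [if_neg h1]
    by_cases h2 : N.Le u (N.parent (N.tgt e))
    · rw [if_pos h2, if_pos (h.1 h2).1]; ring
    · rw [if_neg h2, if_neg fun h' ↦ h2 (h.2 ⟨h', h1⟩)]; ring

/-- The highest vertex with a positive coordinate is the target of the tree edge carrying the point,
and its coordinate is the position on that edge. -/
theorem coord_injOn_tree : InjOn (fun x u ↦ N.coord u x) N.tree := by
  classical
  intro x hx y hy hxy
  have hcone : ∀ u, x ∈ N.cone u ↔ y ∈ N.cone u := fun u ↦ by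
    simp only [cone, mem_ofPred_eq]; rw [show N.coord u x = N.coord u y from congrFun hxy u]
  obtain rfl | ⟨e, he, s, hs, rfl⟩ := N.tree_cases hx <;>
    obtain rfl | ⟨e', he', s', hs', rfl⟩ := N.tree_cases hy
  · rfl
  · have := (hcone (N.tgt e')).2 ((N.edge_mem_cone hs').2 (N.le_refl _))
    exact absurd (RootedTree.le_root_iff.1 (N.vtx_mem_cone.1 this)) (N.tgt_ne_root e' he')
  · have := (hcone (N.tgt e)).1 ((N.edge_mem_cone hs).2 (N.le_refl _))
    exact absurd (RootedTree.le_root_iff.1 (N.vtx_mem_cone.1 this)) (N.tgt_ne_root e he)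
  · have h1 := (N.edge_mem_cone hs').1 ((hcone _).1 ((N.edge_mem_cone hs).2 (N.le_refl _)))
    have h2 := (N.edge_mem_cone hs).1 ((hcone _).2 ((N.edge_mem_cone hs').2 (N.le_refl _)))
    have htgt := h1.antisymm h2
    obtain rfl : e = e' :=
      (N.existsUnique_treeEdge _ (N.tgt_ne_root e he)).unique ⟨he, rfl⟩ ⟨he', htgt.symm⟩
    have h3 := congrFun hxy (N.tgt e)
    simp only [N.coord_treeEdge he, if_true] at h3
    rw [Subtype.ext h3]

/-- The tree carries the topology of pointwise convergence of coordinates, so that paths in it can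
be given by formulas and their continuity checked one coordinate at a time. -/
theorem isInducing_coord : IsInducing fun (x : N.tree) u ↦ N.coord u x := by
  refine isInducing_of_isCompact_preimage (by fun_prop)
    (fun x y h ↦ Subtype.ext (N.coord_injOn_tree x.2 y.2 h)) fun x ↦ ?_
  obtain ⟨v, hv⟩ := N.exists_vertex_of_mem_cone x
  set n := N.depth v + 1
  -- A tree point in a cone of depth `n + 1` has coordinate `1` at its ancestor of depth `n`.
  -- Coordinates below `1` at depth `n` thus confine a point to a compact ball.
  refine ⟨⋂ w ∈ {w | N.depth w = n}, {φ : V → ℝ | φ w < 1},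
    (N.finite_depth_eq n).isOpen_biInter fun w _ ↦ isOpen_lt (continuous_apply w) continuous_const,
    ?_, Subtype.val ⁻¹' (N.ball (n + 1) : Set X),
    N.isClosed_tree.isClosedEmbedding_subtypeVal.isCompact_preimage (N.ball (n + 1)).isCompact, ?_⟩
  · refine mem_iInter₂.2 fun w hw ↦ ?_
    have : ¬ (x : X) ∈ N.cone w := fun h ↦ by
      have := ((hv w).1 h).depth_le
      rw [mem_ofPred_eq] at hw
      omega
    exact (not_lt.1 (show ¬ 0 < N.coord w x from this)).trans_lt zero_lt_one
  · rintro ⟨y, hy⟩ hyO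
    by_contra hball
    obtain ⟨u, hu, hyu⟩ := N.notMem_ball.1 hball
    have hne : u ≠ N.root := fun h ↦ by rw [h, N.depth_root] at hu; omega
    have hd := N.depth_parent u hne
    have h1 := mem_iInter₂.1 hyO (N.parent u) (show N.depth (N.parent u) = n by omega)
    have h2 : N.coord (N.parent u) y = 1 := by
      classical
      obtain rfl | ⟨e, he, s, hs, rfl⟩ := N.tree_cases hy
      · exact absurd (RootedTree.le_root_iff.1 (N.vtx_mem_cone.1 hyu)) hne
      · have h3 := (N.edge_mem_cone hs).1 hyu
        have h4 : N.parent u ≠ N.tgt e := fun h ↦ by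
          have := h3.depth_le; rw [← h] at this; omega
        rw [N.coord_treeEdge he, if_neg h4, coord_vtx, if_pos]
        rw [N.src_eq_parent e he, RootedTree.le_parent_iff (N.tgt_ne_root e he)]
        exact ⟨(N.parent_le u).trans h3, h4⟩
    exact absurd h2 (ne_of_lt h1)

/-- Every point of the tree can be truncated along a profile that is full below its support. -/
theorem exists_truncation {x : X} (hx : x ∈ N.tree) (ψ : V → I) (hroot : ψ N.root = 1)
    (hψ : ∀ u, u ≠ N.root → 0 < ψ u → ψ (N.parent u) = 1) :
    ∃ z ∈ N.tree, ∀ u, N.coord u z = min (N.coord u x) (ψ u) := by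
  classical
  have hbelow : ∀ {u v}, N.Le u v → u ≠ v → 0 < ψ v → ψ u = 1 := by
    rintro u v ⟨k, rfl⟩
    induction k with
    | zero => exact fun h _ ↦ absurd rfl h
    | succ k ih =>
      intro hne hv
      rw [Function.iterate_succ_apply'] at hne ⊢
      by_cases hr : N.parent^[k] v = N.root
      · rw [hr, N.parent_root, hroot]
      · by_cases h : N.parent^[k] v = v
        · rw [h] at hr ⊢
          exact hψ _ hr hv
        · exact hψ _ hr (by rw [ih h hv]; exact zero_lt_one)
  have hbase : ∃ z ∈ N.tree, ∀ u, N.coord u z = min (N.coord u (N.vtx N.root)) (ψ u) := by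
    refine ⟨N.vtx N.root, N.vtx_mem_tree _, fun u ↦ ?_⟩
    rw [coord_vtx]
    split_ifs with h
    · rw [RootedTree.le_root_iff.1 h, hroot]; simp
    · rw [min_eq_left (ψ u).2.1]
  have hedge : ∀ n, ∀ e ∈ N.treeEdge, N.depth (N.tgt e) ≤ n → ∀ s : I,
      ∃ z ∈ N.tree, ∀ u, N.coord u z = min (N.coord u (N.edge e s)) (ψ u) := by
    intro n
    induction n with
    | zero =>
      intro e he hd
      exact absurd (N.depth_eq_zero.1 (Nat.le_zero.1 hd)) (N.tgt_ne_root e he)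
    | succ n ih =>
      intro e he hd s
      -- If the profile is positive at the top of the edge, it is `1` at all lower vertices, and
      -- only the position on this edge is cut. If it is `0` there, the whole edge is cut off and
      -- the truncation is that of its source.
      by_cases hpos : 0 < ψ (N.tgt e)
      · refine ⟨N.edge e (min s (ψ (N.tgt e))), N.edge_mem_tree he _, fun u ↦ ?_⟩
        rw [N.coord_treeEdge he, N.coord_treeEdge he]
        split_ifs with h
        · subst h; rfl
        · rw [coord_vtx, N.src_eq_parent e he]
          split_ifs with h'
          · have := hbelow ((RootedTree.le_parent_iff (N.tgt_ne_root e he)).1 h').1 h hpos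
            rw [this]; simp
          · rw [min_eq_left (ψ u).2.1]
      · have h0 : ψ (N.tgt e) = 0 := le_antisymm (not_lt.1 hpos) (ψ _).2.1
        have hred : ∀ u, min (N.coord u (N.edge e s)) (ψ u) =
            min (N.coord u (N.vtx (N.src e))) (ψ u) := by
          intro u
          rw [N.coord_treeEdge he]
          split_ifs with h
          · subst h
            rw [h0, Icc.coe_zero, min_eq_right s.2.1, min_eq_right (N.coord_nonneg _ _)]
          · rfl
        simp only [hred]
        by_cases hr : N.src e = N.root
        · rw [hr]; exact hbase
        · obtain ⟨e', ⟨he', h'⟩, -⟩ := N.existsUnique_treeEdge _ hr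
          have hd' := N.depth_parent _ (N.tgt_ne_root e he)
          obtain ⟨z, hz, hz'⟩ := ih e' he' (by rw [h', N.src_eq_parent e he]; omega) 1
          refine ⟨z, hz, fun u ↦ ?_⟩
          rw [hz', N.edge_one, h']
  obtain rfl | ⟨e, he, s, -, rfl⟩ := N.tree_cases hx
  · exact hbase
  · exact hedge _ e he le_rfl s

/-- The profile used to shorten a path to the root: at time `t` it is supported on the vertices of
depth less than about `-log₂ t`. -/
def profile (n : ℕ) (t : ℝ) : I := projIcc 0 1 zero_le_one (2 - 4 * 2 ^ n * t)

theorem continuous_profile (n : ℕ) : Continuous (profile n) :=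
  continuous_projIcc.comp (by fun_prop)

theorem profile_zero (n : ℕ) : profile n 0 = 1 :=
  projIcc_of_right_le _ (by norm_num)

theorem profile_eq_zero (n : ℕ) {t : ℝ} (ht : 1 / 2 ≤ t) : profile n t = 0 := by
  refine projIcc_of_le_left _ ?_
  have : (1 : ℝ) ≤ 2 ^ n := one_le_pow₀ (by norm_num)
  nlinarith

/-- Positivity at level `n + 1` means `4 * 2 ^ n * t < 1`, so the value before clamping at level `n`
is above `1`. A level starts to shrink only after the level above it has vanished. -/
theorem profile_eq_one {n : ℕ} {t : ℝ} (h : 0 < profile (n + 1) t) : profile n t = 1 := by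
  refine projIcc_of_right_le _ ?_
  by_contra hlt
  refine h.ne' (projIcc_of_le_left _ ?_)
  rw [pow_succ]
  linarith [not_le.1 hlt]

/-- Truncating `x` to the path of `y` and the levels not yet switched off gives the descent from `x`
to the point where the paths from the root to `x` and `y` branch. -/
theorem exists_geodesic_aux {x y : X} (hx : x ∈ N.tree) (hy : y ∈ N.tree) (t : ℝ) :
    ∃ z ∈ N.tree, ∀ u, N.coord u z = min (N.coord u x) (max (N.coord u y) (profile (N.depth u) t)) := by
  let ψ : V → I := fun u ↦ max ⟨N.coord u y, N.coord_nonneg u y, N.coord_le_one u y⟩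
    (profile (N.depth u) t)
  have hroot : ψ N.root = 1 := by
    refine le_antisymm le_one' (le_trans ?_ (le_max_left _ _))
    rw [← Subtype.coe_le_coe]
    exact (N.coord_root y).ge
  have hψ : ∀ u, u ≠ N.root → 0 < ψ u → ψ (N.parent u) = 1 := by
    intro u hu hpos
    refine le_antisymm le_one' ?_
    obtain h | h := lt_max_iff.1 hpos
    · refine le_trans ?_ (le_max_left _ _)
      rw [← Subtype.coe_le_coe]
      classical
      have h' : y ∈ N.cone u := h
      obtain rfl | ⟨e, he, s, hs, rfl⟩ := N.tree_cases hy
      · exact absurd (RootedTree.le_root_iff.1 (N.vtx_mem_cone.1 h')) hu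
      · have h3 := (N.edge_mem_cone hs).1 h'
        have h4 : N.parent u ≠ N.tgt e := fun h ↦ by
          have h5 := h3.depth_le
          have := N.depth_parent u hu
          rw [← h] at h5; omega
        change (1 : ℝ) ≤ N.coord (N.parent u) (N.edge e s)
        rw [N.coord_treeEdge he, if_neg h4, coord_vtx, if_pos]
        rw [N.src_eq_parent e he, RootedTree.le_parent_iff (N.tgt_ne_root e he)]
        exact ⟨(N.parent_le u).trans h3, h4⟩
    · refine le_trans ?_ (le_max_right _ _)
      rw [N.depth_parent u hu] at h
      exact (profile_eq_one h).ge
  obtain ⟨z, hz, h⟩ := N.exists_truncation hx ψ hroot hψ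
  exact ⟨z, hz, h⟩

/-- Up to time `1 / 2` the last term contributes nothing and the point descends from `x`; afterwards
the other profile vanishes and the point climbs to `y`. One formula covers both halves and is
continuous in all variables. -/
theorem exists_geodesic (x y : N.tree) (t : I) : ∃ z : N.tree, ∀ u, N.coord u z =
    max (min (N.coord u x) (N.coord u y)) (max (min (N.coord u x) (profile (N.depth u) t))
      (min (N.coord u y) (profile (N.depth u) (1 - t)))) := by
  obtain ht | ht := le_total (t : ℝ) (1 / 2)
  · obtain ⟨z, hz, h⟩ := N.exists_geodesic_aux x.2 y.2 t
    refine ⟨⟨z, hz⟩, fun u ↦ ?_⟩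
    rw [profile_eq_zero _ (show 1 / 2 ≤ 1 - (t : ℝ) by linarith)]
    have h1 := N.coord_nonneg u y
    have h2 : (0 : ℝ) ≤ min (N.coord u x) (profile (N.depth u) t) :=
      le_min (N.coord_nonneg u x) (profile _ _).2.1
    rw [Icc.coe_zero, min_eq_right h1, max_eq_left h2, ← min_max_distrib_left]
    exact h u
  · obtain ⟨z, hz, h⟩ := N.exists_geodesic_aux y.2 x.2 (1 - t)
    refine ⟨⟨z, hz⟩, fun u ↦ ?_⟩
    rw [profile_eq_zero _ ht]
    have h1 := N.coord_nonneg u x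
    have h2 : (0 : ℝ) ≤ min (N.coord u y) (profile (N.depth u) (1 - t)) :=
      le_min (N.coord_nonneg u y) (profile _ _).2.1
    rw [Icc.coe_zero, min_eq_right h1, max_eq_right h2, min_comm (N.coord u x),
      ← min_max_distrib_left]
    exact h u

/-- A path between two points of the spanning tree, depending continuously on its endpoints. -/
def geodesic (x y : N.tree) (t : I) : N.tree := (N.exists_geodesic x y t).choose

theorem coord_geodesic (x y : N.tree) (t : I) (u : V) : N.coord u (N.geodesic x y t) =
    max (min (N.coord u x) (N.coord u y)) (max (min (N.coord u x) (profile (N.depth u) t))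
      (min (N.coord u y) (profile (N.depth u) (1 - t)))) :=
  (N.exists_geodesic x y t).choose_spec u

theorem continuous_geodesic :
    Continuous fun p : N.tree × N.tree × I ↦ N.geodesic p.1 p.2.1 p.2.2 := by
  rw [N.isInducing_coord.continuous_iff]
  refine continuous_pi fun u ↦ ?_
  simp only [Function.comp_def, coord_geodesic]
  have h1 := continuous_profile (N.depth u)
  have h2 : Continuous fun t : ℝ ↦ ((profile (N.depth u) t : I) : ℝ) :=
    continuous_subtype_val.comp h1
  fun_prop

theorem tree_ext {x y : N.tree} (h : ∀ u, N.coord u x = N.coord u y) : x = y :=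
  Subtype.ext (N.coord_injOn_tree x.2 y.2 (funext h))

theorem geodesic_zero (x y : N.tree) : N.geodesic x y 0 = x := by
  refine N.tree_ext fun u ↦ ?_
  have h1 := N.coord_le_one u x
  have h2 := N.coord_nonneg u x
  have h3 := N.coord_nonneg u y
  rw [coord_geodesic, Icc.coe_zero, profile_zero, profile_eq_zero _ (by norm_num), Icc.coe_one,
    Icc.coe_zero, min_eq_left h1, min_eq_right h3, max_eq_left h2, max_eq_right (min_le_left _ _)]

theorem geodesic_one (x y : N.tree) : N.geodesic x y 1 = y := by
  refine N.tree_ext fun u ↦ ?_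
  have h1 := N.coord_le_one u y
  have h2 := N.coord_nonneg u x
  have h3 := N.coord_nonneg u y
  rw [coord_geodesic, Icc.coe_one, sub_self, profile_zero, profile_eq_zero _ (by norm_num),
    Icc.coe_one, Icc.coe_zero, min_eq_left h1, min_eq_right h2, max_eq_right h3,
    max_eq_right (min_le_right _ _)]

theorem geodesic_self (x : N.tree) (t : I) : N.geodesic x x t = x := by
  refine N.tree_ext fun u ↦ ?_
  rw [coord_geodesic, min_self]
  exact max_eq_left (max_le (min_le_left _ _) (min_le_left _ _))

/-- Along the path no coordinate falls below the smaller of its two end values. This convexity of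
cones makes geodesic homotopies proper. -/
theorem geodesic_mem_cone {u : V} {x y : N.tree} (hx : (x : X) ∈ N.cone u)
    (hy : (y : X) ∈ N.cone u) (t : I) : (N.geodesic x y t : X) ∈ N.cone u := by
  rw [cone, mem_ofPred_eq, coord_geodesic]
  exact lt_max_of_lt_left (lt_min hx hy)

end T2

end TreeModel

end LocallyFiniteGraph

end

noncomputable section

namespace LocallyFiniteGraph

universe u v w

/-! ### Ends as filters -/

section EndFilter

variable {Y : Type u} [TopologicalSpace Y]

/-- A component of `Y ∖ K`, as a subset of `Y`. -/
def compSet (K : Compacts Y) (U : ConnectedComponents ((K : Set Y)ᶜ : Set Y)) : Set Y :=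
  {y | ∃ h : y ∈ (K : Set Y)ᶜ, ConnectedComponents.mk ⟨y, h⟩ = U}

theorem compSet_subset_compl (K : Compacts Y) (U : ConnectedComponents ((K : Set Y)ᶜ : Set Y)) :
    compSet K U ⊆ (K : Set Y)ᶜ := fun _ h ↦ h.1

theorem compSet_nonempty (K : Compacts Y) (U : ConnectedComponents ((K : Set Y)ᶜ : Set Y)) :
    (compSet K U).Nonempty := by
  obtain ⟨y, rfl⟩ := ConnectedComponents.surjective_coe U
  exact ⟨y, y.2, rfl⟩

theorem isPreconnected_compSet (K : Compacts Y)
    (U : ConnectedComponents ((K : Set Y)ᶜ : Set Y)) : IsPreconnected (compSet K U) := by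
  obtain ⟨y, rfl⟩ := ConnectedComponents.surjective_coe U
  have h : compSet K (ConnectedComponents.mk y) = Subtype.val '' connectedComponent y := by
    ext z
    constructor
    · rintro ⟨hz, h⟩
      exact ⟨⟨z, hz⟩, ConnectedComponents.coe_eq_coe'.1 h, rfl⟩
    · rintro ⟨z, hz, rfl⟩
      exact ⟨z.2, ConnectedComponents.coe_eq_coe'.2 hz⟩
  rw [h]
  exact isPreconnected_connectedComponent.image _ continuous_subtype_val.continuousOn

theorem eq_of_mem_compSet {K : Compacts Y} {U U' : ConnectedComponents ((K : Set Y)ᶜ : Set Y)}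
    {y : Y} (h : y ∈ compSet K U) (h' : y ∈ compSet K U') : U = U' := by
  obtain ⟨_, rfl⟩ := h
  obtain ⟨_, rfl⟩ := h'
  rfl

/-- A connected set missing `K` that meets a component of `Y ∖ K` is contained in it. -/
theorem subset_compSet {K : Compacts Y} {U : ConnectedComponents ((K : Set Y)ᶜ : Set Y)}
    {S : Set Y} (hS : IsPreconnected S) (hK : Disjoint S K) (hmeet : (S ∩ compSet K U).Nonempty) :
    S ⊆ compSet K U := by
  obtain ⟨y, hyS, hy, rfl⟩ := hmeet
  intro z hz
  have hz' : z ∈ (K : Set Y)ᶜ := disjoint_left.1 hK hz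
  refine ⟨hz', ConnectedComponents.coe_eq_coe'.2 ?_⟩
  have hS' : IsPreconnected (Subtype.val ⁻¹' S : Set ((K : Set Y)ᶜ : Set Y)) := by
    refine (IsInducing.subtypeVal.isPreconnected_image).1 ?_
    rwa [Subtype.image_preimage_coe, inter_eq_right.2 (show S ⊆ (K : Set Y)ᶜ from fun w hw ↦ disjoint_left.1 hK hw)]
  exact hS'.subset_connectedComponent (x := ⟨y, hy⟩) hyS
    (show (⟨z, hz'⟩ : ((K : Set Y)ᶜ : Set Y)) ∈ Subtype.val ⁻¹' S from hz)

theorem restrictCompl_eq_iff {K L : Compacts Y} (h : K ≤ L)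
    (U : ConnectedComponents ((L : Set Y)ᶜ : Set Y)) {y : Y} (hy : y ∈ compSet L U) :
    y ∈ compSet K (restrictCompl h U) := by
  obtain ⟨hy, rfl⟩ := hy
  exact ⟨fun h' ↦ hy (h h'), rfl⟩

/-- The filter of neighbourhoods of an end, on the space itself. -/
def endFilter (ω : EndSpace Y) : Filter Y := ⨅ K : Compacts Y, Filter.principal (compSet K (ω.component K))

theorem compSet_subset_of_le (ω : EndSpace Y) {K L : Compacts Y} (h : K ≤ L) :
    compSet L (ω.component L) ⊆ compSet K (ω.component K) := fun y hy ↦ by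
  rw [← ω.compatible K L h]
  exact restrictCompl_eq_iff h _ hy

theorem hasBasis_endFilter (ω : EndSpace Y) :
    (endFilter ω).HasBasis (fun _ : Compacts Y ↦ True) fun K ↦ compSet K (ω.component K) := by
  refine Filter.hasBasis_iInf_principal fun K L ↦ ⟨K ⊔ L, ?_, ?_⟩
  · exact compSet_subset_of_le ω le_sup_left
  · exact compSet_subset_of_le ω le_sup_right

theorem compSet_mem_endFilter (ω : EndSpace Y) (K : Compacts Y) :
    compSet K (ω.component K) ∈ endFilter ω := (hasBasis_endFilter ω).mem_of_mem trivial

instance (ω : EndSpace Y) : (endFilter ω).NeBot :=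
  (hasBasis_endFilter ω).neBot_iff.2 fun _ ↦ compSet_nonempty _ _

theorem endFilter_le_cocompact (ω : EndSpace Y) : endFilter ω ≤ Filter.cocompact Y := by
  refine (Filter.hasBasis_cocompact).ge_iff.2 fun K hK ↦ ?_
  exact Filter.mem_of_superset (compSet_mem_endFilter ω ⟨K, hK⟩) (compSet_subset_compl _ _)

theorem eq_of_le_endFilter {F : Filter Y} [F.NeBot] {ω η : EndSpace Y} (h : F ≤ endFilter ω)
    (h' : F ≤ endFilter η) : ω = η := by
  refine EndSpace.ext (funext fun K ↦ ?_)
  obtain ⟨y, hy, hy'⟩ := Filter.nonempty_of_mem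
    (Filter.inter_mem (h (compSet_mem_endFilter ω K)) (h' (compSet_mem_endFilter η K)))
  exact eq_of_mem_compSet hy hy'

/-- A filter that picks out a component of the complement of every compact set converges to an
end. -/
theorem exists_end_of_filter (F : Filter Y) [F.NeBot]
    (h : ∀ K : Compacts Y, ∃ U, compSet K U ∈ F) : ∃ ω, F ≤ endFilter ω := by
  choose U hU using h
  refine ⟨⟨U, fun K L hKL ↦ ?_⟩, le_iInf fun K ↦ Filter.le_principal_iff.2 (hU K)⟩
  obtain ⟨y, hy, hy'⟩ := Filter.nonempty_of_mem (Filter.inter_mem (hU K) (hU L))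
  exact eq_of_mem_compSet (restrictCompl_eq_iff hKL _ hy') hy

variable {Z : Type v} [TopologicalSpace Z]

theorem ProperMap.tendsto_endFilter (f : ProperMap Y Z) (ω : EndSpace Y) :
    Filter.Tendsto f.map (endFilter ω) (endFilter (f.endMap ω)) := by
  refine (hasBasis_endFilter _).tendsto_right_iff.2 fun K _ ↦ ?_
  refine Filter.mem_of_superset (compSet_mem_endFilter ω (f.preimage K)) ?_
  rintro y ⟨hy, h⟩
  refine ⟨hy, ?_⟩
  change _ = complMap f.map (f.preimage K) K _ (ω.component (f.preimage K))
  rw [← h]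
  rfl

theorem ProperMap.endMap_eq_of_tendsto (f : ProperMap Y Z) {F : Filter Y} [F.NeBot]
    {ω : EndSpace Y} {η : EndSpace Z} (h : F ≤ endFilter ω)
    (h' : Filter.Tendsto f.map F (endFilter η)) : f.endMap ω = η :=
  eq_of_le_endFilter (F := F.map f.map) ((f.tendsto_endFilter ω).mono_left h) h'

end EndFilter

/-! ### Ends of a graph with a normal spanning tree -/

namespace TreeModel

variable {X : Type u} [TopologicalSpace X] [T2Space X] {V : Type v} {E : Type w}
  (N : TreeModel X V E)

theorem vtx_mem_ball {n : ℕ} {v : V} (h : N.depth v < n) : N.vtx v ∈ N.ball n := by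
  by_contra hv
  obtain ⟨u, hu, hx⟩ := N.notMem_ball.1 hv
  have := (N.vtx_mem_cone.1 hx).depth_le
  omega

/-- The ball contains all vertices of depth less than `n`, so a component of its complement cannot
cross the frontier of a cone of depth `n`. -/
theorem exists_ray (ω : EndSpace X) (n : ℕ) : ∃ u, N.depth u = n ∧
    compSet (N.ball n) (ω.component (N.ball n)) ⊆ N.cone u := by
  obtain ⟨x, hx⟩ := compSet_nonempty (N.ball n) (ω.component (N.ball n))
  obtain ⟨u, hu, hxu⟩ := N.notMem_ball.1 (compSet_subset_compl _ _ hx)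
  refine ⟨u, hu, N.subset_cone_of_isPreconnected (isPreconnected_compSet _ _) (fun v hv h ↦ ?_)
    ⟨x, hx, hxu⟩⟩
  exact compSet_subset_compl _ _ h (N.vtx_mem_ball (hu ▸ hv))

/-- The vertex of depth `n` on the ray of the spanning tree that represents the end `ω`. -/
def ray (ω : EndSpace X) (n : ℕ) : V := (N.exists_ray ω n).choose

@[simp]
theorem depth_ray (ω : EndSpace X) (n : ℕ) : N.depth (N.ray ω n) = n :=
  (N.exists_ray ω n).choose_spec.1

theorem compSet_subset_cone_ray (ω : EndSpace X) (n : ℕ) :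
    compSet (N.ball n) (ω.component (N.ball n)) ⊆ N.cone (N.ray ω n) :=
  (N.exists_ray ω n).choose_spec.2

theorem cone_ray_mem (ω : EndSpace X) (n : ℕ) : N.cone (N.ray ω n) ∈ endFilter ω :=
  Filter.mem_of_superset (compSet_mem_endFilter ω _) (N.compSet_subset_cone_ray ω n)

theorem le_of_cone_mem {F : Filter X} [F.NeBot] {u v : V} (hu : N.cone u ∈ F) (hv : N.cone v ∈ F)
    (h : N.depth u ≤ N.depth v) : N.Le u v := by
  obtain ⟨x, hx, hx'⟩ := Filter.nonempty_of_mem (Filter.inter_mem hu hv)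
  exact N.le_of_mem_cone hx hx' h

theorem eq_ray {ω : EndSpace X} {F : Filter X} [F.NeBot] (hF : F ≤ endFilter ω) {u : V}
    (h : N.cone u ∈ F) : u = N.ray ω (N.depth u) :=
  (N.le_of_cone_mem h (hF (N.cone_ray_mem ω _)) (by simp)).eq_of_depth_le (by simp)

theorem ray_le {ω : EndSpace X} {m n : ℕ} (h : m ≤ n) : N.Le (N.ray ω m) (N.ray ω n) :=
  N.le_of_cone_mem (N.cone_ray_mem ω m) (N.cone_ray_mem ω n) (by simpa)

theorem anc_ray {ω : EndSpace X} {m n : ℕ} (h : m ≤ n) : N.anc (N.ray ω n) m = N.ray ω m := by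
  have := (N.ray_le (ω := ω) h).eq_anc
  rw [depth_ray] at this
  exact this.symm

theorem ray_eq_of_le {ω η : EndSpace X} {m n : ℕ} (h : m ≤ n) (he : N.ray ω n = N.ray η n) :
    N.ray ω m = N.ray η m := by rw [← N.anc_ray h, he, N.anc_ray h]

/-- A component of the complement of a compact set contains the cones of small ends in it. -/
theorem exists_cone_subset_compSet (K : Compacts X) :
    ∃ n, ∀ u, n ≤ N.depth u → ∃ U, N.cone u ⊆ compSet K U := by
  obtain ⟨n, hn⟩ := N.exists_disjoint_cone K.isCompact
  refine ⟨n, fun u hu ↦ ?_⟩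
  have hd := hn u hu
  have hx : N.vtx u ∈ N.cone u := N.vtx_mem_cone.2 (N.le_refl u)
  exact ⟨ConnectedComponents.mk ⟨N.vtx u, disjoint_left.1 hd hx⟩,
    subset_compSet (N.isPreconnected_cone u) hd ⟨_, hx, _, rfl⟩⟩

/-- A cone of large depth is connected and misses `K`, hence lies in one component of the
complement. For a cone on the ray of `ω` this is the component chosen by `ω`, as both belong to
`endFilter ω`. -/
theorem hasBasis_endFilter_cone (ω : EndSpace X) :
    (endFilter ω).HasBasis (fun _ : ℕ ↦ True) fun n ↦ N.cone (N.ray ω n) := by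
  refine (hasBasis_endFilter ω).to_hasBasis (fun K _ ↦ ?_) fun n _ ↦
    ⟨N.ball n, trivial, N.compSet_subset_cone_ray ω n⟩
  obtain ⟨n, hn⟩ := N.exists_cone_subset_compSet K
  obtain ⟨U, hU⟩ := hn (N.ray ω n) (by simp)
  refine ⟨n, trivial, ?_⟩
  obtain ⟨x, hx, hx'⟩ := Filter.nonempty_of_mem
    (Filter.inter_mem (compSet_mem_endFilter ω K) (N.cone_ray_mem ω n))
  rwa [eq_of_mem_compSet hx (hU hx')]

theorem exists_end_of_cones (F : Filter X) [F.NeBot] (h : ∀ n, ∃ u, N.depth u = n ∧ N.cone u ∈ F) :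
    ∃ ω, F ≤ endFilter ω := by
  refine exists_end_of_filter F fun K ↦ ?_
  obtain ⟨n, hn⟩ := N.exists_cone_subset_compSet K
  obtain ⟨u, hu, huF⟩ := h n
  obtain ⟨U, hU⟩ := hn u hu.ge
  exact ⟨U, Filter.mem_of_superset huF hU⟩

include N in
/-- An ultrafilter leaving all compact sets converges to an end. -/
theorem exists_end_of_ultrafilter (F : Ultrafilter X) (h : (F : Filter X) ≤ Filter.cocompact X) :
    ∃ ω : EndSpace X, (F : Filter X) ≤ endFilter ω := by
  refine N.exists_end_of_cones (F : Filter X) fun n ↦ ?_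
  have h1 : (N.ball n : Set X)ᶜ ∈ F := h (N.ball n).isCompact.compl_mem_cocompact
  have h2 : ⋃ u ∈ {u | N.depth u = n}, N.cone u ∈ F := by
    refine Filter.mem_of_superset h1 fun x hx ↦ ?_
    obtain ⟨u, hu, hxu⟩ := N.notMem_ball.1 hx
    exact mem_biUnion hu hxu
  obtain ⟨u, hu, huF⟩ := (Ultrafilter.finite_biUnion_mem_iff (N.finite_depth_eq n)).1 h2
  exact ⟨u, hu, huF⟩

/-- An increasing chain of vertices represents an end. -/
theorem exists_end_of_chain (u : ℕ → V) (hd : ∀ n, N.depth (u n) = n)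
    (hle : ∀ n, N.Le (u n) (u (n + 1))) : ∃ ω, ∀ n, N.ray ω n = u n := by
  have hmono : ∀ m n, m ≤ n → N.Le (u m) (u n) := by
    intro m n h
    induction n, h using Nat.le_induction with
    | base => exact N.le_refl _
    | succ n _ ih => exact ih.trans (hle n)
  have hc : ∀ n, N.cone (u n) ∈ Filter.map (fun k ↦ N.vtx (u k)) Filter.atTop := fun n ↦
    Filter.mem_map.2 (Filter.mem_of_superset (Filter.mem_atTop n) fun k hk ↦
      N.vtx_mem_cone.2 (hmono n k hk))
  obtain ⟨ω, hω⟩ := N.exists_end_of_cones (Filter.map (fun k ↦ N.vtx (u k)) Filter.atTop)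
    fun n ↦ ⟨u n, hd n, hc n⟩
  exact ⟨ω, fun n ↦ by rw [N.eq_ray hω (hc n), hd]⟩

theorem isOpen_ray_eq (n : ℕ) (u : V) : IsOpen {ω : EndSpace X | N.ray ω n = u} := by
  refine isOpen_iff_forall_mem_open.2 fun ω hω ↦ ?_
  refine ⟨(fun ω : EndSpace X ↦ ω.component (N.ball n)) ⁻¹' {ω.component (N.ball n)}, ?_, ?_, rfl⟩
  · rintro η hη
    rw [mem_preimage, mem_singleton_iff] at hη
    have h1 := N.compSet_subset_cone_ray η n
    rw [hη] at h1
    obtain ⟨x, hx⟩ := compSet_nonempty (N.ball n) (ω.component (N.ball n))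
    rw [mem_ofPred_eq, ← hω]
    exact (N.le_of_mem_cone (h1 hx) (N.compSet_subset_cone_ray ω n hx) (by simp)).eq_of_depth_le
      (by simp)
  · let _ : TopologicalSpace (ConnectedComponents ((N.ball n : Set X)ᶜ : Set X)) := ⊥
    have : DiscreteTopology (ConnectedComponents ((N.ball n : Set X)ᶜ : Set X)) := ⟨rfl⟩
    exact (isOpen_discrete _).preimage (EndSpace.continuous_eval (N.ball n))

/-- The component off a compact set `K` chosen by an end is determined by the vertex of its ray at
one depth depending only on `K`. -/
theorem hasBasis_nhds_end (ω : EndSpace X) :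
    (𝓝 ω).HasBasis (fun _ : ℕ ↦ True) fun n ↦ {η | N.ray η n = N.ray ω n} := by
  have hmem : ∀ n, {η | N.ray η n = N.ray ω n} ∈ 𝓝 ω := fun n ↦
    (N.isOpen_ray_eq n _).mem_nhds rfl
  refine ⟨fun s ↦ ⟨fun hs ↦ ?_, fun ⟨n, _, hn⟩ ↦ Filter.mem_of_superset (hmem n) hn⟩⟩
  have hb : (⨅ n, Filter.principal {η | N.ray η n = N.ray ω n}).HasBasis (fun _ : ℕ ↦ True)
      fun n ↦ {η | N.ray η n = N.ray ω n} := by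
    refine Filter.hasBasis_iInf_principal (directed_of_isDirected_le ?_)
    intro m n h η hη
    exact N.ray_eq_of_le h hη
  have hle : ⨅ n, Filter.principal {η | N.ray η n = N.ray ω n} ≤ 𝓝 ω := by
    rw [nhds_iInf]
    refine le_iInf fun K ↦ ?_
    refine (@le_nhds_iff (EndSpace X) (TopologicalSpace.induced (fun ω : EndSpace X ↦ ω.component K) ⊥) _ _).2 ?_
    rintro _ hs' ⟨t, -, rfl⟩
    obtain ⟨n, hn⟩ := N.exists_cone_subset_compSet K
    obtain ⟨U, hU⟩ := hn (N.ray ω n) (by simp)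
    refine hb.mem_iff.2 ⟨n, trivial, fun η hη ↦ ?_⟩
    have key : ∀ ξ : EndSpace X, N.ray ξ n = N.ray ω n → ξ.component K = U := by
      intro ξ hξ
      obtain ⟨x, hx, hx'⟩ := Filter.nonempty_of_mem
        (Filter.inter_mem (compSet_mem_endFilter ξ K) (N.cone_ray_mem ξ n))
      rw [hξ] at hx'
      exact eq_of_mem_compSet hx (hU hx')
    rw [mem_preimage, key η hη, ← key ω rfl]
    exact hs'
  exact hb.mem_iff.1 (hle hs)

-- This is König's lemma: an ultrafilter of ends selects one of the finitely many vertices at every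
-- depth, and these vertices form a ray.
include N in
theorem compactSpace_end : CompactSpace (EndSpace X) := by
  refine isCompact_univ_iff.1 (isCompact_iff_ultrafilter_le_nhds.2 fun F _ ↦ ?_)
  have h : ∀ n, ∃ u, N.depth u = n ∧ {ω | N.ray ω n = u} ∈ F := by
    intro n
    have : ⋃ u ∈ {u | N.depth u = n}, {ω : EndSpace X | N.ray ω n = u} ∈ F :=
      Filter.mem_of_superset Filter.univ_mem fun ω _ ↦
        mem_biUnion (x := N.ray ω n) (N.depth_ray ω n) rfl
    exact (Ultrafilter.finite_biUnion_mem_iff (N.finite_depth_eq n)).1 this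
  choose u hd hu using h
  obtain ⟨ω, hω⟩ := N.exists_end_of_chain u hd fun n ↦ by
    obtain ⟨η, h1, h2⟩ := Filter.nonempty_of_mem (Filter.inter_mem (hu n) (hu (n + 1)))
    rw [← h1, ← h2]
    exact N.ray_le n.le_succ
  refine ⟨ω, trivial, (N.hasBasis_nhds_end ω).ge_iff.2 fun n _ ↦ ?_⟩
  rw [hω]
  exact hu n

theorem exists_ray_eq_imp {h : EndSpace X → EndSpace X} (hc : Continuous h) (ω : EndSpace X)
    (n : ℕ) : ∃ m, ∀ η, N.ray η m = N.ray ω m → N.ray (h η) n = N.ray (h ω) n := by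
  have := (hc.tendsto ω) ((N.hasBasis_nhds_end (h ω)).mem_of_mem (i := n) trivial)
  obtain ⟨m, -, hm⟩ := (N.hasBasis_nhds_end ω).mem_iff.1 (Filter.mem_map.1 this)
  exact ⟨m, fun η hη ↦ hm hη⟩

end TreeModel

end LocallyFiniteGraph

end

noncomputable section

namespace LocallyFiniteGraph

universe u v w

theorem ProperMap.endMap_eq {X : Type u} [TopologicalSpace X] (f : ProperMap X X)
    {h : EndSpace X → EndSpace X}
    (hf : ∀ ω, Filter.Tendsto f.map (endFilter ω) (endFilter (h ω))) : f.endMap = h :=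
  funext fun ω ↦ f.endMap_eq_of_tendsto le_rfl (hf ω)

namespace TreeModel

open unitInterval

variable {X : Type u} [TopologicalSpace X] [T2Space X] {V : Type v} {E : Type w}
  (N : TreeModel X V E)

/-! ### Proper maps and proper homotopies through ends -/

include N in
theorem tendsto_cocompact_of_ends {f : X → X} {h : EndSpace X → EndSpace X}
    (hf : ∀ ω, Filter.Tendsto f (endFilter ω) (endFilter (h ω))) :
    Filter.Tendsto f (Filter.cocompact X) (Filter.cocompact X) := by
  refine Filter.tendsto_iff_ultrafilter _ _ _ |>.2 fun U hU ↦ ?_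
  obtain ⟨ω, hω⟩ := N.exists_end_of_ultrafilter U hU
  exact ((hf ω).mono_left hω).mono_right (endFilter_le_cocompact _)

include N in
theorem isProperMap_of_ends (f : C(X, X)) {h : EndSpace X → EndSpace X}
    (hf : ∀ ω, Filter.Tendsto f (endFilter ω) (endFilter (h ω))) : IsProperMap f := by
  have := N.weaklyLocallyCompactSpace
  exact isProperMap_iff_tendsto_cocompact.2 ⟨f.continuous, N.tendsto_cocompact_of_ends hf⟩

-- As `I` is compact, an ultrafilter on `I × X` that leaves all compact sets projects to one on `X`
-- that does so too and hence converges to an end; the hypothesis is uniform in the time variable.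
include N in
theorem isProperMap_homotopy {H : I × X → X} (hc : Continuous H) {h : EndSpace X → EndSpace X}
    (hH : ∀ ω, Filter.Tendsto H (Filter.comap Prod.snd (endFilter ω)) (endFilter (h ω))) :
    IsProperMap H := by
  have := N.weaklyLocallyCompactSpace
  refine isProperMap_iff_tendsto_cocompact.2 ⟨hc, ?_⟩
  refine Filter.tendsto_iff_ultrafilter _ _ _ |>.2 fun U hU ↦ ?_
  have hsnd : Filter.Tendsto (Prod.snd : I × X → X) U (Filter.cocompact X) :=
    Filter.hasBasis_cocompact.tendsto_right_iff.2 fun K hK ↦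
      hU (isProperMap_snd_of_compactSpace.isCompact_preimage hK).compl_mem_cocompact
  obtain ⟨ω, hω⟩ := N.exists_end_of_ultrafilter (U.map Prod.snd) hsnd
  exact ((hH ω).mono_left (Filter.map_le_iff_le_comap.1 hω)).mono_right
    (endFilter_le_cocompact (h ω))

/-- Proper maps with the same action on ends are properly homotopic if at every point they
agree or take values in the spanning tree. -/
theorem properHomotopic_of_tree {F G : ProperMap X X}
    (hFG : ∀ x, F.map x = G.map x ∨ F.map x ∈ N.tree ∧ G.map x ∈ N.tree)
    (hend : F.endMap = G.endMap) : ProperHomotopic F G := by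
  classical
  have := N.weaklyLocallyCompactSpace
  -- Move along the tree path where both values lie in the tree and rest elsewhere. Where the two
  -- maps agree the path is constant, so the definitions on the closed sets `A` and `B` fit
  -- together.
  let H : I × X → X := fun p ↦ if h : F.map p.2 ∈ N.tree ∧ G.map p.2 ∈ N.tree then
    N.geodesic ⟨_, h.1⟩ ⟨_, h.2⟩ p.1 else F.map p.2
  have hH1 : ∀ p : I × X, F.map p.2 = G.map p.2 → H p = F.map p.2 := by
    intro p hp
    by_cases h : F.map p.2 ∈ N.tree ∧ G.map p.2 ∈ N.tree
    · simp only [H, dif_pos h]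
      have : (⟨G.map p.2, h.2⟩ : N.tree) = ⟨F.map p.2, h.1⟩ := Subtype.ext hp.symm
      rw [this, geodesic_self]
    · simp only [H, dif_neg h]
  let A : Set (I × X) := {p | F.map p.2 = G.map p.2}
  let B : Set (I × X) := {p | F.map p.2 ∈ N.tree ∧ G.map p.2 ∈ N.tree}
  have hA : IsClosed A := isClosed_eq (by fun_prop) (by fun_prop)
  have hB : IsClosed B := (N.isClosed_tree.preimage (by fun_prop)).inter
    (N.isClosed_tree.preimage (by fun_prop))
  have hAB : A ∪ B = univ := eq_univ_of_forall fun p ↦ hFG p.2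
  have hHc : Continuous H := by
    rw [← continuousOn_univ, ← hAB]
    refine ContinuousOn.union_of_isClosed ?_ ?_ hA hB
    · exact ContinuousOn.congr (f := fun p ↦ F.map p.2) (by fun_prop) fun p hp ↦ hH1 p hp
    · rw [continuousOn_iff_continuous_domRestrict]
      have : B.domRestrict H = fun p : B ↦
          (N.geodesic ⟨F.map p.1.2, p.2.1⟩ ⟨G.map p.1.2, p.2.2⟩ p.1.1 : X) := by
        funext p
        exact dif_pos p.2
      rw [this]
      have hc : Continuous fun p : B ↦ ((⟨F.map p.1.2, p.2.1⟩ : N.tree),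
          (⟨G.map p.1.2, p.2.2⟩ : N.tree), p.1.1) := by fun_prop
      exact continuous_subtype_val.comp (N.continuous_geodesic.comp hc)
  refine ⟨⟨⟨H, hHc⟩, fun x ↦ ?_, fun x ↦ ?_⟩, ?_⟩
  · change H (0, x) = F.map x
    by_cases h : F.map x ∈ N.tree ∧ G.map x ∈ N.tree
    · simp only [H, dif_pos h, geodesic_zero]
    · simp only [H, dif_neg h]
  · change H (1, x) = G.map x
    by_cases h : F.map x ∈ N.tree ∧ G.map x ∈ N.tree
    · simp only [H, dif_pos h, geodesic_one]
    · rw [hH1 _ ((hFG x).resolve_right h)]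
      exact (hFG x).resolve_right h
  -- Near `ω` both maps take values in the same deep cone, and cones are convex, so the homotopy
  -- stays in that cone at all times.
  · refine N.isProperMap_homotopy hHc (h := F.endMap) fun ω ↦
      (N.hasBasis_endFilter_cone _).tendsto_right_iff.2 fun n _ ↦ ?_
    have hF := (F.tendsto_endFilter ω).comp (Filter.tendsto_comap (f := (Prod.snd : I × X → X)))
    have hG := (G.tendsto_endFilter ω).comp (Filter.tendsto_comap (f := (Prod.snd : I × X → X)))
    rw [← hend] at hG
    filter_upwards [hF (N.cone_ray_mem _ n), hG (N.cone_ray_mem _ n)] with p hp hp'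
    change H p ∈ N.cone _
    by_cases h : F.map p.2 ∈ N.tree ∧ G.map p.2 ∈ N.tree
    · simp only [H, dif_pos h]
      exact N.geodesic_mem_cone (x := ⟨_, h.1⟩) (y := ⟨_, h.2⟩) hp hp' _
    · simp only [H, dif_neg h]
      exact hp

end TreeModel

end LocallyFiniteGraph

end

noncomputable section

namespace LocallyFiniteGraph

universe u v w

open unitInterval

/-! ### Loops from closed edge walks -/

namespace GraphModel

variable {X : Type u} [TopologicalSpace X] {V : Type v} {E : Type w} (M : GraphModel X V E)

/-- The initial vertex of a directed edge. -/
def dartSrc (d : E × Bool) : V := if d.2 then M.src d.1 else M.tgt d.1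

/-- The terminal vertex of a directed edge. -/
def dartTgt (d : E × Bool) : V := if d.2 then M.tgt d.1 else M.src d.1

/-- The parametrisation of a directed edge. -/
def dartPath (d : E × Bool) (s : I) : X := M.edge d.1 (if d.2 then s else σ s)

/-- A directed edge with the opposite direction. -/
def dartRev (d : E × Bool) : E × Bool := (d.1, !d.2)

/-- Two directed edges can follow each other in a walk without backtracking. -/
def DartStep (d d' : E × Bool) : Prop := M.dartTgt d = M.dartSrc d' ∧ d' ≠ dartRev d

theorem dartSrc_dartRev (d : E × Bool) : M.dartSrc (dartRev d) = M.dartTgt d := by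
  obtain ⟨e, b⟩ := d
  cases b <;> rfl

theorem dartTgt_dartRev (d : E × Bool) : M.dartTgt (dartRev d) = M.dartSrc d := by
  obtain ⟨e, b⟩ := d
  cases b <;> rfl

theorem continuous_dartPath (d : E × Bool) : Continuous (M.dartPath d) := by
  obtain ⟨e, b⟩ := d
  cases b
  · exact (M.edge e).continuous.comp continuous_symm
  · exact (M.edge e).continuous

theorem dartPath_zero (d : E × Bool) : M.dartPath d 0 = M.vtx (M.dartSrc d) := by
  obtain ⟨e, b⟩ := d
  cases b <;> simp [dartPath, dartSrc, M.edge_zero, M.edge_one]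

theorem dartPath_one (d : E × Bool) : M.dartPath d 1 = M.vtx (M.dartTgt d) := by
  obtain ⟨e, b⟩ := d
  cases b <;> simp [dartPath, dartTgt, M.edge_zero, M.edge_one]

theorem range_dartPath (d : E × Bool) : range (M.dartPath d) = range (M.edge d.1) := by
  obtain ⟨e, b⟩ := d
  cases b
  · exact (unitInterval.symm_bijective.surjective).range_comp (M.edge e)
  · rfl

theorem dartPath_ne_vtx (d : E × Bool) {s : I} (hs : s ∈ Ioo (0 : I) 1) (v : V) :
    M.dartPath d s ≠ M.vtx v := by
  obtain ⟨e, b⟩ := d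
  cases b
  · exact M.edge_ne_vtx e _ ⟨unitInterval.symm_one ▸ unitInterval.symm_lt_symm.2 hs.2,
      unitInterval.symm_zero ▸ unitInterval.symm_lt_symm.2 hs.1⟩ v
  · exact M.edge_ne_vtx e s hs v

theorem dartPath_inj {d d' : E × Bool} {s s' : I} (hs : s ∈ Ioo (0 : I) 1)
    (hs' : s' ∈ Ioo (0 : I) 1) (h : M.dartPath d s = M.dartPath d' s') :
    d = d' ∧ s = s' ∨ d' = dartRev d := by
  have hσ : ∀ (b : Bool) s, s ∈ Ioo (0 : I) 1 → (if b then s else σ s) ∈ Ioo (0 : I) 1 := by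
    intro b s hs
    cases b
    · exact ⟨unitInterval.symm_one ▸ unitInterval.symm_lt_symm.2 hs.2,
        unitInterval.symm_zero ▸ unitInterval.symm_lt_symm.2 hs.1⟩
    · exact hs
  obtain ⟨e, b⟩ := d
  obtain ⟨e', b'⟩ := d'
  obtain ⟨h1, h2⟩ := M.edge_inj _ _ _ (hσ b s hs) _ (hσ b' s' hs') h
  obtain rfl : e = e' := h1
  cases b <;> cases b' <;> simp [dartRev] at h2 ⊢ <;> exact h2

theorem fract_mem (x : ℝ) : Int.fract x ∈ Icc (0 : ℝ) 1 :=
  ⟨Int.fract_nonneg x, (Int.fract_lt_one x).le⟩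

/-- The concatenation of a bi-infinite sequence of directed edges. -/
def walkMap (d : ℤ → E × Bool) (x : ℝ) : X := M.dartPath (d ⌊x⌋) ⟨Int.fract x, fract_mem x⟩

variable {M} {d : ℤ → E × Bool}

theorem walkMap_eq (hd : ∀ i, M.DartStep (d i) (d (i + 1))) {i : ℤ} {x : ℝ}
    (hx : x ∈ Icc (i : ℝ) (i + 1)) :
    M.walkMap d x = M.dartPath (d i) (projIcc 0 1 zero_le_one (x - i)) := by
  obtain ⟨h0, h1⟩ := hx
  obtain h1 | rfl := h1.lt_or_eq
  · have hf : ⌊x⌋ = i := Int.floor_eq_iff.2 ⟨h0, h1⟩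
    rw [walkMap, hf]
    congr 1
    rw [projIcc_of_mem zero_le_one (show x - i ∈ Icc (0 : ℝ) 1 from ⟨by linarith, by linarith⟩)]
    refine Subtype.ext ?_
    change Int.fract x = x - i
    rw [← hf, Int.self_sub_floor]
  · have hf : ⌊(i : ℝ) + 1⌋ = i + 1 := by simp
    have hp : projIcc (0 : ℝ) 1 zero_le_one ((i : ℝ) + 1 - i) = 1 :=
      projIcc_of_right_le _ (by linarith)
    have h0 : (⟨Int.fract ((i : ℝ) + 1), fract_mem _⟩ : I) = 0 :=
      Subtype.ext (by simp)
    rw [walkMap, hf, hp, h0, dartPath_one, dartPath_zero, (hd i).1]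

theorem continuous_walkMap (hd : ∀ i, M.DartStep (d i) (d (i + 1))) :
    Continuous (M.walkMap d) := by
  have hlf : LocallyFinite fun i : ℤ ↦ Icc (i : ℝ) (i + 1) := by
    intro x
    refine ⟨Ioo (x - 1) (x + 1), Ioo_mem_nhds (by linarith) (by linarith),
      (finite_Icc (⌊x⌋ - 2) (⌊x⌋ + 2)).subset ?_⟩
    rintro i ⟨y, ⟨h1, h2⟩, h3, h4⟩
    have h5 := Int.floor_le x
    have h6 := Int.lt_floor_add_one x
    constructor
    · have : (⌊x⌋ : ℝ) - 2 < i := by linarith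
      exact_mod_cast this.le
    · have : (i : ℝ) < ⌊x⌋ + 2 := by linarith
      exact_mod_cast this.le
  refine hlf.continuous (eq_univ_of_forall fun x ↦ mem_iUnion.2 ⟨⌊x⌋, Int.floor_le x,
    (Int.lt_floor_add_one x).le⟩) (fun _ ↦ isClosed_Icc) fun i ↦ ?_
  refine ContinuousOn.congr (Continuous.continuousOn ?_) fun x hx ↦ walkMap_eq hd hx
  exact (M.continuous_dartPath _).comp (continuous_projIcc.comp (by fun_prop))

theorem fract_mem_Ioo {x : ℝ} (h : Int.fract x ≠ 0) :
    (⟨Int.fract x, fract_mem x⟩ : I) ∈ Ioo (0 : I) 1 :=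
  ⟨unitInterval.pos_iff_ne_zero.2 fun h' ↦ h (congrArg Subtype.val h'), Int.fract_lt_one x⟩

theorem walkMap_eq_vtx {x : ℝ} (h : Int.fract x = 0) :
    M.walkMap d x = M.vtx (M.dartSrc (d ⌊x⌋)) := by
  rw [walkMap, ← dartPath_zero]
  congr 1
  exact Subtype.ext h

theorem fract_eq_zero_iff_of_walkMap_eq {x y : ℝ} (h : M.walkMap d x = M.walkMap d y) :
    Int.fract x = 0 ↔ Int.fract y = 0 := by
  constructor <;> intro h' <;> by_contra hne
  · rw [walkMap_eq_vtx h'] at h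
    exact M.dartPath_ne_vtx _ (fract_mem_Ioo hne) _ h.symm
  · rw [walkMap_eq_vtx (x := y) h'] at h
    exact M.dartPath_ne_vtx _ (fract_mem_Ioo hne) _ h

/-- Parameters less than `1 / 2` apart lie on the same or on consecutive directed edges. Equal
values force equal positions, and a distance of `1` is excluded, or else a reversed edge, which
would be backtracking. -/
theorem walkMap_locally_injective (hd : ∀ i, M.DartStep (d i) (d (i + 1))) {x y : ℝ} (hxy : x ≤ y)
    (hlt : y < x + 1 / 2) (h : M.walkMap d x = M.walkMap d y) : x = y := by
  have hfx := Int.floor_add_fract x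
  have hfy := Int.floor_add_fract y
  have hx0 := Int.fract_nonneg x
  have hy0 := Int.fract_nonneg y
  have hx1 := Int.fract_lt_one x
  have hy1 := Int.fract_lt_one y
  have hle : ⌊x⌋ ≤ ⌊y⌋ := Int.floor_mono hxy
  have hle' : ⌊y⌋ ≤ ⌊x⌋ + 1 := by
    have : (⌊y⌋ : ℝ) < ⌊x⌋ + 2 := by linarith
    have : ⌊y⌋ < ⌊x⌋ + 2 := by exact_mod_cast this
    omega
  have hz := fract_eq_zero_iff_of_walkMap_eq h
  have hcase : ⌊y⌋ = ⌊x⌋ ∨ ⌊y⌋ = ⌊x⌋ + 1 := by omega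
  obtain he | he := hcase
  · have he' : (⌊y⌋ : ℝ) = ⌊x⌋ := by exact_mod_cast he
    by_cases hx : Int.fract x = 0
    · have := hz.1 hx
      linarith
    · have h2 := h
      rw [walkMap, walkMap, he] at h2
      obtain ⟨-, h3⟩ | h3 := M.dartPath_inj (fract_mem_Ioo hx) (fract_mem_Ioo (mt hz.2 hx)) h2
      · have := congrArg Subtype.val h3
        simp only at this
        linarith
      · have := congrArg Prod.snd h3
        simp [dartRev] at this
  · have he' : (⌊y⌋ : ℝ) = ⌊x⌋ + 1 := by exact_mod_cast he
    by_cases hx : Int.fract x = 0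
    · linarith
    · have h2 := h
      rw [walkMap, walkMap, he] at h2
      obtain ⟨-, h3⟩ | h3 := M.dartPath_inj (fract_mem_Ioo hx) (fract_mem_Ioo (mt hz.2 hx)) h2
      · have := congrArg Subtype.val h3
        simp only at this
        linarith
      · exact absurd h3 (hd _).2

variable {n : ℕ}

theorem walkMap_periodic (hn : ∀ i, d (i + n) = d i) :
    Function.Periodic (M.walkMap d) (n : ℝ) := by
  intro x
  rw [walkMap, walkMap]
  congr 1
  · rw [Int.floor_add_natCast, hn]
  · exact Subtype.ext (Int.fract_add_natCast x n)

/-- The loop that runs through a periodic sequence of directed edges. -/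
def walkLoop (M : GraphModel X V E) (n : ℕ) (hpos : n ≠ 0) (d : ℤ → E × Bool)
    (hn : ∀ i, d (i + n) = d i) (hd : ∀ i, M.DartStep (d i) (d (i + 1))) : C(Circle, X) :=
  ContinuousMap.comp ⟨(walkMap_periodic hn).lift, (continuous_walkMap hd).quotient_lift _⟩
    ⟨(AddCircle.homeomorphCircle (T := (n : ℝ)) (Nat.cast_ne_zero.2 hpos)).symm,
      Homeomorph.continuous _⟩

theorem range_walkLoop (hpos : n ≠ 0) (hn : ∀ i, d (i + n) = d i)
    (hd : ∀ i, M.DartStep (d i) (d (i + 1))) (i : ℤ) :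
    range (M.edge (d i).1) ⊆ range (M.walkLoop n hpos d hn hd) := by
  rw [← range_dartPath]
  rintro _ ⟨s, rfl⟩
  let θ := AddCircle.homeomorphCircle (T := (n : ℝ)) (Nat.cast_ne_zero.2 hpos)
  refine ⟨θ ((i + s : ℝ) : AddCircle (n : ℝ)), ?_⟩
  change (walkMap_periodic hn).lift (θ.symm (θ _)) = _
  rw [θ.symm_apply_apply, Function.Periodic.lift_coe, walkMap_eq hd (i := i)]
  · congr 1
    rw [add_sub_cancel_left, projIcc_val]
  · exact ⟨by linarith [s.2.1], by linarith [s.2.2]⟩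

theorem isImmersedLoop_walkLoop (hpos : n ≠ 0) (hn : ∀ i, d (i + n) = d i)
    (hd : ∀ i, M.DartStep (d i) (d (i + 1))) : IsImmersedLoop (M.walkLoop n hpos d hn hd) := by
  intro c
  let θ := AddCircle.homeomorphCircle (T := (n : ℝ)) (Nat.cast_ne_zero.2 hpos)
  obtain ⟨x, hx⟩ := QuotientAddGroup.mk_surjective (θ.symm c)
  refine ⟨θ.symm ⁻¹' ((fun y : ℝ ↦ (y : AddCircle (n : ℝ))) '' Ioo (x - 1 / 4) (x + 1 / 4)),
    (QuotientAddGroup.isOpenMap_coe _ isOpen_Ioo).preimage θ.symm.continuous,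
    ⟨x, ⟨by linarith, by linarith⟩, hx⟩, ?_⟩
  rintro a ⟨y, hy, hya⟩ b ⟨z, hz, hzb⟩ hab
  change (walkMap_periodic hn).lift (θ.symm a) = (walkMap_periodic hn).lift (θ.symm b) at hab
  rw [← hya, ← hzb] at hab
  change M.walkMap d y = M.walkMap d z at hab
  have : y = z := by
    obtain h | h := le_total y z
    · exact walkMap_locally_injective hd h (by linarith [hy.1, hz.2]) hab
    · exact (walkMap_locally_injective hd h (by linarith [hz.1, hy.2]) hab.symm).symm
  exact θ.symm.injective (by rw [← hya, ← hzb, this])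

theorem injective_walkLoop (hpos : n ≠ 0) (hn : ∀ i, d (i + n) = d i)
    (hd : ∀ i, M.DartStep (d i) (d (i + 1)))
    (hinj : ∀ i j, M.dartSrc (d i) = M.dartSrc (d j) → (n : ℤ) ∣ i - j) :
    Function.Injective (M.walkLoop n hpos d hn hd) := by
  intro a b hab
  let θ := AddCircle.homeomorphCircle (T := (n : ℝ)) (Nat.cast_ne_zero.2 hpos)
  obtain ⟨x, hx⟩ := QuotientAddGroup.mk_surjective (θ.symm a)
  obtain ⟨y, hy⟩ := QuotientAddGroup.mk_surjective (θ.symm b)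
  refine θ.symm.injective ?_
  change (walkMap_periodic hn).lift (θ.symm a) = (walkMap_periodic hn).lift (θ.symm b) at hab
  rw [← hx, ← hy] at hab ⊢
  change M.walkMap d x = M.walkMap d y at hab
  have hz := fract_eq_zero_iff_of_walkMap_eq hab
  have key : Int.fract x = Int.fract y ∧ M.dartSrc (d ⌊x⌋) = M.dartSrc (d ⌊y⌋) := by
    by_cases hx0 : Int.fract x = 0
    · rw [walkMap_eq_vtx hx0, walkMap_eq_vtx (hz.1 hx0)] at hab
      exact ⟨hx0.trans (hz.1 hx0).symm, M.vtx_injective hab⟩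
    · obtain ⟨h1, h2⟩ | h1 := M.dartPath_inj (fract_mem_Ioo hx0) (fract_mem_Ioo (mt hz.2 hx0)) hab
      · exact ⟨congrArg Subtype.val h2, by rw [h1]⟩
      -- The two points lie on one edge traversed in opposite directions. The second directed edge
      -- starts where the first ends, so by `hinj` it is the successor of the first, which
      -- contradicts the absence of backtracking.
      · exfalso
        have h2 : M.dartSrc (d ⌊y⌋) = M.dartSrc (d (⌊x⌋ + 1)) := by
          rw [← (hd _).1, h1, dartSrc_dartRev]
        obtain ⟨k, hk⟩ := hinj _ _ h2
        have hper : ∀ i k : ℤ, d (i + n * k) = d i := by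
          intro i k
          induction k with
          | zero => simp
          | succ k ih => rw [mul_add, mul_one, ← add_assoc, hn, ih]
          | pred k ih =>
            rw [← ih, ← hn (i + n * (-(k : ℤ) - 1))]
            congr 1
            ring
        have h3 : d ⌊y⌋ = d (⌊x⌋ + 1) := by
          rw [← hper (⌊x⌋ + 1) k, ← hk]
          congr 1
          ring
        exact (hd ⌊x⌋).2 (h3 ▸ h1)
  obtain ⟨k, hk⟩ := hinj _ _ key.2
  have hxy : x = y + k * n := by
    have h1 := Int.floor_add_fract x
    have h2 := Int.floor_add_fract y
    have h3 : (⌊x⌋ : ℝ) - ⌊y⌋ = n * k := by exact_mod_cast hk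
    linarith [key.1]
  rw [hxy, ← zsmul_eq_mul]
  change ((y + k • (n : ℝ) : ℝ) : AddCircle (n : ℝ)) = y
  rw [AddCircle.coe_add, AddCircle.coe_zsmul, AddCircle.coe_period, smul_zero, add_zero]

theorem dartStep_emod (hn : n ≠ 0) {f : ℕ → E × Bool}
    (hf : ∀ k < n, M.DartStep (f k) (f ((k + 1) % n))) (i : ℤ) :
    M.DartStep (f (i % n).toNat) (f ((i + 1) % n).toNat) := by
  have hn' : (0 : ℤ) < n := by exact_mod_cast Nat.pos_of_ne_zero hn
  have h2 := Int.emod_nonneg i hn'.ne'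
  have h3 := Int.emod_lt_of_pos i hn'
  obtain ⟨k, hk⟩ := Int.eq_ofNat_of_zero_le h2
  have h4 := hf k (by omega)
  rwa [← Int.emod_add_emod, hk, show ((k : ℤ) + 1) % n = ((k + 1) % n : ℕ) by norm_cast,
    Int.toNat_natCast, Int.toNat_natCast]

/-- A directed edge that lies on a closed walk without backtracking lies on an immersed loop. -/
theorem exists_immersedLoop {t : E × Bool} (h : Relation.TransGen M.DartStep t t) :
    ∃ γ : C(Circle, X), IsImmersedLoop γ ∧ range (M.edge t.1) ⊆ range γ := by
  have key : ∀ {a b : E × Bool}, Relation.TransGen M.DartStep a b → ∃ n : ℕ, n ≠ 0 ∧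
      ∃ f : ℕ → E × Bool, f 0 = a ∧ f n = b ∧ ∀ k < n, M.DartStep (f k) (f (k + 1)) := by
    intro a b h
    induction h with
    | @single b hb =>
      refine ⟨1, one_ne_zero, fun k ↦ if k = 0 then a else b, rfl, rfl, fun k hk ↦ ?_⟩
      obtain rfl : k = 0 := by omega
      exact hb
    | @tail b c _ hbc ih =>
      obtain ⟨n, hn, f, h0, h1, hf⟩ := ih
      refine ⟨n + 1, by omega, fun k ↦ if k ≤ n then f k else c, by simp [h0], by simp,
        fun k hk ↦ ?_⟩
      obtain hk | rfl := (Nat.lt_succ_iff.1 hk).lt_or_eq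
      · simpa [hk.le, Nat.succ_le_of_lt hk] using hf k hk
      · simpa [h1] using hbc
  obtain ⟨n, hn, f, h0, h1, hf⟩ := key h
  let d : ℤ → E × Bool := fun i ↦ f (i % n).toNat
  have hper : ∀ i, d (i + n) = d i := fun i ↦ by simp [d]
  have hd : ∀ i, M.DartStep (d i) (d (i + 1)) := by
    refine dartStep_emod hn fun k hk ↦ ?_
    have h4 := hf k hk
    obtain h5 | h5 : k + 1 < n ∨ k + 1 = n := by omega
    · rwa [Nat.mod_eq_of_lt h5]
    · rwa [h5, Nat.mod_self, h0, ← h1, ← h5]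
  refine ⟨M.walkLoop n hn d hper hd, isImmersedLoop_walkLoop hn hper hd, ?_⟩
  have := range_walkLoop hn hper hd 0
  simpa [d, h0] using this

end GraphModel

end LocallyFiniteGraph

end

noncomputable section

namespace LocallyFiniteGraph

universe u v w

open unitInterval

/-! ### The core of a graph and its ends -/

namespace TreeModel

variable {X : Type u} [TopologicalSpace X] {V : Type v} {E : Type w} (N : TreeModel X V E)

/-- The ends that are limits of edges outside the spanning tree. -/
def loopEnds [T2Space X] : Set (EndSpace X) :=
  {ω | ∀ n, ∃ e, e ∉ N.treeEdge ∧ N.Le (N.ray ω n) (N.src e)}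

theorem exists_treeEdge {v : V} (hv : v ≠ N.root) : ∃ e ∈ N.treeEdge, N.tgt e = v :=
  (N.existsUnique_treeEdge v hv).exists

theorem treeEdge_ext {e e' : E} (he : e ∈ N.treeEdge) (he' : e' ∈ N.treeEdge)
    (h : N.tgt e = N.tgt e') : e = e' :=
  (N.existsUnique_treeEdge (N.tgt e') (N.tgt_ne_root e' he')).unique ⟨he, h⟩ ⟨he', rfl⟩

theorem le_src_of_mem_treeEdge {e : E} (he : e ∈ N.treeEdge) {u : V} :
    N.Le u (N.src e) ↔ N.Le u (N.tgt e) ∧ u ≠ N.tgt e := by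
  rw [N.src_eq_parent e he, N.le_parent_iff (N.tgt_ne_root e he)]

/-- Only finitely many edges start at depth less than `n`. Beyond the depths of their targets, an
edge with target above the ray also has its source above the ray vertex of depth `n`. -/
theorem exists_ray_of_notMem_loopEnds [T2Space X] {ω : EndSpace X} (hω : ω ∉ N.loopEnds) :
    ∃ n, ∀ e ∉ N.treeEdge, ¬ N.Le (N.ray ω n) (N.tgt e) := by
  simp only [loopEnds, mem_ofPred_eq, not_forall, not_exists, not_and] at hω
  obtain ⟨n, hno⟩ := hω
  obtain ⟨m, hm⟩ := ((N.finite_edges_depth_src_lt n).image fun e ↦ N.depth (N.tgt e)).bddAbove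
  refine ⟨max n (m + 1), fun e het hle ↦ hno e het ?_⟩
  refine ((N.ray_le (le_max_left n (m + 1))).trans hle).le_of_depth_le (N.le_src_tgt e) ?_
  rw [N.depth_ray]
  by_contra! hlt
  have h1 := hm ⟨e, hlt, rfl⟩
  have h2 := hle.depth_le
  simp only [N.depth_ray] at h1 h2
  omega

theorem cone_subset_tree [T2Space X] {u : V} (h : ∀ e ∉ N.treeEdge, ¬ N.Le u (N.tgt e)) :
    N.cone u ⊆ N.tree := by
  intro x hx
  obtain ⟨v, rfl⟩ | ⟨e, s, hs, rfl⟩ := N.exists_cell x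
  · exact N.vtx_mem_tree v
  · exact N.edge_mem_tree (by_contra fun he ↦ h e he ((N.edge_mem_cone hs.1).1 hx)) s

/-! #### Closed walks through tree edges -/

section Walks

/-- A walk without backtracking, in the spanning tree after its first directed edge. -/
def TreeWalk : E × Bool → E × Bool → Prop :=
  Relation.ReflTransGen fun a b ↦ N.DartStep a b ∧ b.1 ∈ N.treeEdge

variable {N}

theorem TreeWalk.reflTransGen {a b : E × Bool} (h : N.TreeWalk a b) :
    Relation.ReflTransGen N.DartStep a b :=
  Relation.ReflTransGen.mono (fun _ _ h ↦ h.1) _ _ h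

theorem TreeWalk.eq_or_mem {a b : E × Bool} (h : N.TreeWalk a b) : b = a ∨ b.1 ∈ N.treeEdge := by
  obtain h | ⟨c, -, h⟩ := Relation.ReflTransGen.cases_tail h
  exacts [Or.inl h, Or.inr h.2]

/-- If the new tree edge would undo the last step, that step is deleted instead. The initial edge is
not in the tree and so is never undone. -/
theorem TreeWalk.extend {d c t : E × Bool} (hd : d.1 ∉ N.treeEdge) (h : N.TreeWalk d c)
    (ht : t.1 ∈ N.treeEdge) (hct : N.dartTgt c = N.dartSrc t) :
    ∃ c', N.TreeWalk d c' ∧ N.dartTgt c' = N.dartTgt t := by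
  by_cases hrev : t = GraphModel.dartRev c
  · obtain h | ⟨c', hc', hstep, -⟩ := Relation.ReflTransGen.cases_tail h
    · subst h
      subst hrev
      exact absurd ht hd
    · exact ⟨c', hc', by rw [hstep.1, hrev, N.dartTgt_dartRev]⟩
  · exact ⟨t, Relation.ReflTransGen.tail h ⟨⟨hct, hrev⟩, ht⟩, rfl⟩

theorem exists_treeWalk_root {d : E × Bool} (hd : d.1 ∉ N.treeEdge) :
    ∃ c, N.TreeWalk d c ∧ N.dartTgt c = N.root := by
  suffices H : ∀ n c, N.TreeWalk d c → N.depth (N.dartTgt c) = n →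
      ∃ c', N.TreeWalk d c' ∧ N.dartTgt c' = N.root from
    H _ d Relation.ReflTransGen.refl rfl
  intro n
  induction n with
  | zero => exact fun c hc h ↦ ⟨c, hc, N.depth_eq_zero.1 h⟩
  | succ n ih =>
    intro c hc h
    have hne : N.dartTgt c ≠ N.root := fun h' ↦ by rw [h', N.depth_root] at h; omega
    obtain ⟨e, he, het⟩ := N.exists_treeEdge hne
    obtain ⟨c', hc', h'⟩ := hc.extend (t := (e, false)) hd he het.symm
    refine ih c' hc' ?_
    rw [h']
    change N.depth (N.src e) = n
    have := N.depth_parent _ hne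
    rw [N.src_eq_parent e he, het]
    omega

theorem exists_treeWalk {d : E × Bool} (hd : d.1 ∉ N.treeEdge) (w : V) :
    ∃ c, N.TreeWalk d c ∧ N.dartTgt c = w := by
  induction hn : N.depth w generalizing w with
  | zero =>
    rw [N.depth_eq_zero.1 hn]
    exact exists_treeWalk_root hd
  | succ n ih =>
    have hne : w ≠ N.root := fun h' ↦ by rw [h', N.depth_root] at hn; omega
    obtain ⟨e, he, het⟩ := N.exists_treeEdge hne
    have := N.depth_parent _ hne
    obtain ⟨c, hc, h⟩ := ih (N.src e) (by rw [N.src_eq_parent e he, het]; omega)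
    obtain ⟨c', hc', h'⟩ := hc.extend (t := (e, true)) hd he h
    exact ⟨c', hc', h'.trans het⟩

/-- The last directed edge of the walk is `d` itself or lies in the tree, so `d'` cannot reverse it.
-/
theorem exists_treeWalk_step {d d' : E × Bool} (hd : d.1 ∉ N.treeEdge) (hd' : d'.1 ∉ N.treeEdge)
    (hne : d' ≠ GraphModel.dartRev d) : ∃ c, N.TreeWalk d c ∧ N.DartStep c d' := by
  obtain ⟨c, hc, h⟩ := exists_treeWalk hd (N.dartSrc d')
  refine ⟨c, hc, h, ?_⟩
  rintro rfl
  obtain rfl | h' := hc.eq_or_mem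
  exacts [hne rfl, hd' h']

/-- Within the tree, the only way out of the part above `u` is the tree edge with target `u`. -/
theorem TreeWalk.exists_crossing {d c : E × Bool} (h : N.TreeWalk d c) {u : V}
    (hd : N.Le u (N.dartTgt d)) (hc : ¬ N.Le u (N.dartTgt c)) :
    ∃ t, N.TreeWalk d t ∧ N.TreeWalk t c ∧ t.1 ∈ N.treeEdge ∧ N.tgt t.1 = u := by
  induction h with
  | refl => exact absurd hd hc
  | @tail b c hdb hbc ih =>
    by_cases hb : N.Le u (N.dartTgt b)
    · refine ⟨c, Relation.ReflTransGen.tail hdb hbc, Relation.ReflTransGen.refl, hbc.2, ?_⟩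
      rw [hbc.1.1] at hb
      have he := hbc.2
      obtain ⟨e, _ | _⟩ := c
      · change N.Le u (N.tgt e) at hb
        change ¬ N.Le u (N.src e) at hc
        rw [N.le_src_of_mem_treeEdge he] at hc
        by_contra hne
        exact hc ⟨hb, fun h ↦ hne h.symm⟩
      · exact absurd (((N.le_src_of_mem_treeEdge he).1 hb).1) hc
    · obtain ⟨t, h1, h2, h3⟩ := ih hb
      exact ⟨t, h1, Relation.ReflTransGen.tail h2 hbc, h3⟩

/-- Tree walks from `e` to `e'` and back close up to a walk without backtracking. It is above `u` at
the end of `e` and no longer so at the start of `e'`, hence it crosses the tree edge into `u`. -/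
theorem exists_immersedLoop_treeEdge {e e' : E} (he : e ∉ N.treeEdge) (he' : e' ∉ N.treeEdge)
    {u : V} (hu : N.Le u (N.tgt e)) (hu' : ¬ N.Le u (N.src e')) :
    ∃ t ∈ N.treeEdge, N.tgt t = u ∧
      ∃ γ : C(Circle, X), IsImmersedLoop γ ∧ range (N.edge t) ⊆ range γ := by
  obtain ⟨c, hc, hcd⟩ := exists_treeWalk_step (d := (e, true)) (d' := (e', true)) he he'
    (fun h ↦ by simpa [GraphModel.dartRev] using congrArg Prod.snd h)
  obtain ⟨c', hc', hcd'⟩ := exists_treeWalk_step (d := (e', true)) (d' := (e, true)) he' he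
    (fun h ↦ by simpa [GraphModel.dartRev] using congrArg Prod.snd h)
  obtain ⟨t, h1, h2, h3, h4⟩ := hc.exists_crossing (u := u) hu (by rwa [hcd.1])
  refine ⟨t.1, h3, h4, GraphModel.exists_immersedLoop (t := t) ?_⟩
  exact ((Relation.TransGen.tail' h2.reflTransGen hcd).trans_left hc'.reflTransGen).trans
    (Relation.TransGen.head' hcd' h1.reflTransGen)

end Walks

/-! #### Immersed loops and cones -/

/-- Otherwise the cone is a piece of the tree, and the loop would have to turn around at its highest
point. At that place a single coordinate determines the loop, and an injective continuous real
function has no interior maximum. -/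
theorem exists_notTreeEdge_of_immersedLoop [T2Space X] {γ : C(Circle, X)} (hγ : IsImmersedLoop γ) {u : V} {c : Circle}
    (hc : γ c ∈ N.cone u) : ∃ e ∉ N.treeEdge, N.Le u (N.tgt e) := by
  by_contra! hno
  have hno : ∀ e, N.Le u (N.tgt e) → e ∈ N.treeEdge := fun e he ↦ by
    by_contra h
    exact hno e h he
  obtain ⟨n, hn⟩ := N.exists_disjoint_cone (isCompact_range γ.continuous)
  let A : Set ℕ := {k | ∃ v, N.Le u v ∧ N.depth v = k ∧ ∃ c, γ c ∈ N.cone v}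
  have hA : A.Nonempty := ⟨_, u, N.le_refl u, rfl, c, hc⟩
  have hAb : BddAbove A := by
    refine ⟨n, ?_⟩
    rintro _ ⟨v, -, rfl, c, hc⟩
    by_contra! h
    exact disjoint_left.1 (hn v h.le) hc ⟨c, rfl⟩
  obtain ⟨v, huv, hv, c₁, hc₁⟩ := Nat.sSup_mem hA hAb
  have hmax : ∀ w, N.Le v w → (∃ c, γ c ∈ N.cone w) → v = w := fun w hw hcw ↦
    hw.eq_of_depth_le (by rw [hv]; exact le_csSup hAb ⟨w, huv.trans hw, rfl, hcw⟩)
  -- By maximality of `v`, inside the cone of `v` the loop meets only `v` and the interior of the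
  -- tree edge into `v`, where the coordinate of `v` determines the point.
  have hinj : ∀ a b, 0 < N.coord v (γ a) → N.coord v (γ a) = N.coord v (γ b) → γ a = γ b := by
    have hkey : ∀ a, 0 < N.coord v (γ a) → γ a = N.vtx v ∨
        ∃ e ∈ N.treeEdge, ∃ s : I, N.tgt e = v ∧ γ a = N.edge e s ∧ N.coord v (γ a) = s := by
      classical
      intro a ha
      obtain ⟨w, hw⟩ | ⟨e, s, hs, he⟩ := N.exists_cell (γ a)
      · have hvw : N.Le v w := by
          rw [← N.vtx_mem_cone, hw]
          exact ha
        have h := hmax w hvw ⟨a, by rw [← hw, N.vtx_mem_cone]; exact N.le_refl w⟩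
        exact Or.inl (by rw [← hw, h])
      · have hvw : N.Le v (N.tgt e) := by
          rw [← N.edge_mem_cone hs.1, he]
          exact ha
        have h := hmax _ hvw ⟨a, by rw [← he, N.edge_mem_cone hs.1]; exact N.le_refl _⟩
        have het := hno e (huv.trans hvw)
        refine Or.inr ⟨e, het, s, h.symm, he.symm, ?_⟩
        rw [← he, N.coord_treeEdge het, if_pos h]
    have hv1 : N.coord v (N.vtx v) = 1 := by
      rw [N.coord_vtx, if_pos (N.le_refl v)]
    intro a b ha hab
    obtain h1 | ⟨e, he, s, hev, h1, h2⟩ := hkey a ha <;>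
      obtain h3 | ⟨e', he', s', hev', h3, h4⟩ := hkey b (hab ▸ ha)
    · rw [h1, h3]
    · rw [h1, hv1, h4] at hab
      rw [h1, h3, show s' = 1 from Subtype.ext hab.symm, N.edge_one, hev']
    · rw [h3, hv1, h2] at hab
      rw [h1, h3, show s = 1 from Subtype.ext hab, N.edge_one, hev]
    · obtain rfl := N.treeEdge_ext he he' (hev.trans hev'.symm)
      rw [h1, h3, show s = s' from Subtype.ext (by rw [← h2, hab, h4])]
  let g : ℝ → ℝ := fun t ↦ N.coord v (γ (Circle.exp t))
  have hg : Continuous g := by fun_prop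
  obtain ⟨c₀, -, hc₀⟩ := isCompact_univ.exists_isMaxOn univ_nonempty
    (show Continuous fun c ↦ N.coord v (γ c) by fun_prop).continuousOn
  replace hc₀ : ∀ c, N.coord v (γ c) ≤ N.coord v (γ c₀) := fun c ↦ hc₀ (mem_univ c)
  obtain ⟨t₀, rfl⟩ := Circle.exp_surjective c₀
  have hpos : 0 < g t₀ := hc₁.trans_le (hc₀ c₁)
  obtain ⟨U, hU, hU₀, hUinj⟩ := hγ (Circle.exp t₀)
  have hnhds : {t | Circle.exp t ∈ U ∧ 0 < g t} ∈ 𝓝 t₀ :=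
    ((hU.preimage Circle.exp.continuous).inter (isOpen_lt continuous_const hg)).mem_nhds
      ⟨hU₀, hpos⟩
  obtain ⟨δ, hδ, hball⟩ := Metric.mem_nhds_iff.1 hnhds
  -- The bound `δ / 2` keeps the closed interval inside the ball. The bound `1` makes its length at
  -- most `2`, less than the period of `Circle.exp`.
  let ε := min (δ / 2) 1
  have hε : 0 < ε := by positivity
  have hε' : ε ≤ 1 := min_le_right _ _
  have hεδ : ε < δ := (min_le_left _ _).trans_lt (by linarith)
  have hI : ∀ t ∈ Icc (t₀ - ε) (t₀ + ε), Circle.exp t ∈ U ∧ 0 < g t := fun t ht ↦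
    hball (by rw [Real.ball_eq_Ioo]; exact ⟨by linarith [ht.1], by linarith [ht.2]⟩)
  have hinjOn : InjOn g (Icc (t₀ - ε) (t₀ + ε)) := by
    intro s hs t ht hst
    obtain ⟨m, hm⟩ := Circle.exp_eq_exp.1 (hUinj (hI s hs).1 (hI t ht).1
      (hinj _ _ (hI s hs).2 hst))
    have hpi := Real.pi_gt_three
    have h1 : m * (2 * Real.pi) < 1 * (2 * Real.pi) := by linarith [hs.2, ht.1]
    have h2 : (-1) * (2 * Real.pi) < m * (2 * Real.pi) := by linarith [hs.1, ht.2]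
    have h3 : (m : ℝ) < 1 := lt_of_mul_lt_mul_right h1 (by positivity)
    have h4 : (-1 : ℝ) < m := lt_of_mul_lt_mul_right h2 (by positivity)
    have h5 : m < 1 := by exact_mod_cast h3
    have h6 : -1 < m := by exact_mod_cast h4
    obtain rfl : m = 0 := by omega
    simpa using hm
  have hmem₀ : t₀ ∈ Icc (t₀ - ε) (t₀ + ε) := ⟨by linarith, by linarith⟩
  obtain h | h := ContinuousOn.strictMonoOn_of_injOn_Icc' (by linarith) hg.continuousOn hinjOn
  · exact absurd (hc₀ _) (not_le.2 (h hmem₀ (right_mem_Icc.2 (by linarith)) (by linarith)))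
  · exact absurd (hc₀ _) (not_le.2 (h (left_mem_Icc.2 (by linarith)) hmem₀ (by linarith)))

/-- In a graph without embedded circles, every edge belongs to the spanning tree. -/
theorem treeEdge_eq_univ (hX : IsTree X) : N.treeEdge = univ := by
  refine eq_univ_of_forall fun e ↦ by_contra fun he ↦ ?_
  have hle := N.le_src_tgt e
  obtain ⟨m, hm⟩ := id hle
  have : ∀ v, ∃ e', v ≠ N.root → e' ∈ N.treeEdge ∧ N.tgt e' = v := by
    intro v
    by_cases hv : v = N.root
    · exact ⟨e, fun h ↦ absurd hv h⟩
    · obtain ⟨e', h⟩ := N.exists_treeEdge hv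
      exact ⟨e', fun _ ↦ h⟩
  choose te hte using this
  set b := N.tgt e
  have hex : ∃ m, N.parent^[m] b = N.src e := ⟨m, hm⟩
  classical
  -- The number of steps is taken minimal, since a larger one might include repeated steps at the
  -- root.
  let m := Nat.find hex
  have hm : N.parent^[m] b = N.src e := Nat.find_spec hex
  have hlt : ∀ k < m, N.parent^[k] b ≠ N.root := by
    intro k hk h
    refine Nat.find_min hex hk ?_
    rw [h, ← hm]
    obtain ⟨j, hj⟩ := Nat.exists_eq_add_of_lt hk
    rw [hj, show k + j + 1 = (j + 1) + k by ring, Function.iterate_add_apply, h,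
      Function.iterate_fixed N.parent_root]
  -- The circle descends the tree from the target of `e` to its source and returns along `e`. If `m
  -- = 0`, the edge `e` alone is a loop.
  let f : ℕ → E × Bool := fun k ↦ if k < m then (te (N.parent^[k] b), false) else (e, true)
  have hsrc : ∀ k ≤ m, N.dartSrc (f k) = N.parent^[k] b := by
    intro k hk
    obtain hk | rfl := hk.lt_or_eq
    · simp only [f, if_pos hk]
      exact (hte _ (hlt k hk)).2
    · simp only [f, lt_irrefl, if_false]
      exact hm.symm
  have htree : ∀ k < m, (f k).1 ∈ N.treeEdge := fun k hk ↦ by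
    simpa only [f, if_pos hk] using (hte _ (hlt k hk)).1
  have hfm : f m = (e, true) := by simp [f]
  have hstep : ∀ k < m + 1, N.DartStep (f k) (f ((k + 1) % (m + 1))) := by
    intro k hk
    obtain hk | rfl := (Nat.lt_succ_iff.1 hk).lt_or_eq
    · rw [Nat.mod_eq_of_lt (by omega)]
      refine ⟨?_, ?_⟩
      · rw [hsrc _ hk, Function.iterate_succ_apply']
        simp only [f, if_pos hk]
        change N.src _ = _
        rw [N.src_eq_parent _ (hte _ (hlt k hk)).1, (hte _ (hlt k hk)).2]
      · obtain hk' | hk' := (Nat.succ_le_of_lt hk).lt_or_eq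
        · intro h
          have := congrArg Prod.snd h
          simp [GraphModel.dartRev, f, if_pos hk, if_pos hk'] at this
        · rw [Nat.succ_eq_add_one] at hk'
          rw [hk', hfm]
          intro h
          have := congrArg Prod.fst h
          simp only [GraphModel.dartRev] at this
          exact he (this ▸ htree k hk)
    · rw [Nat.mod_self, hfm]
      refine ⟨(hsrc 0 (Nat.zero_le _)).symm, fun h ↦ ?_⟩
      obtain hm0 | hm0 := Nat.eq_zero_or_pos m
      · rw [← hm0, hfm] at h
        simpa [GraphModel.dartRev] using congrArg Prod.snd h
      · have := congrArg Prod.fst h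
        simp only [GraphModel.dartRev] at this
        exact he (this ▸ htree 0 hm0)
  have hd := GraphModel.dartStep_emod (M := N.toGraphModel) (Nat.succ_ne_zero m) hstep
  refine hX _ (GraphModel.injective_walkLoop (M := N.toGraphModel) (n := m + 1) (Nat.succ_ne_zero m)
    (d := fun i ↦ f (i % (m + 1 : ℕ)).toNat) (fun i ↦ by simp) hd fun i j hij ↦ ?_)
  have hi := Int.emod_nonneg i (b := (m + 1 : ℕ)) (by omega)
  have hj := Int.emod_nonneg j (b := (m + 1 : ℕ)) (by omega)
  have hi' := Int.emod_lt_of_pos i (b := (m + 1 : ℕ)) (by omega)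
  have hj' := Int.emod_lt_of_pos j (b := (m + 1 : ℕ)) (by omega)
  rw [hsrc _ (by omega), hsrc _ (by omega)] at hij
  have hinj : ∀ k ≤ m, ∀ l ≤ m, N.parent^[k] b = N.parent^[l] b → k = l := by
    suffices H : ∀ k l, k < l → l ≤ m → N.parent^[k] b ≠ N.parent^[l] b by
      intro k hk l hl h
      obtain h' | h' | h' := lt_trichotomy k l
      exacts [absurd h (H k l h' hl), h', absurd h.symm (H l k h' hk)]
    intro k l hkl hl h
    have h1 := N.depth_parent _ (hlt k (hkl.trans_le hl))
    have h2 : N.depth (N.parent^[l] b) ≤ N.depth (N.parent^[k + 1] b) := by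
      obtain ⟨j, rfl⟩ := Nat.exists_eq_add_of_le (Nat.succ_le_of_lt hkl)
      refine RootedTree.Le.depth_le ⟨j, ?_⟩
      rw [← Function.iterate_add_apply]
      congr 1
      omega
    rw [← h, Function.iterate_succ_apply'] at h2
    omega
  have := hinj _ (by omega) _ (by omega) hij
  exact Int.ModEq.dvd (show j % (m + 1 : ℕ) = i % (m + 1 : ℕ) by omega)

theorem tree_eq_univ (h : N.treeEdge = univ) : N.tree = univ := by
  refine eq_univ_of_forall fun x ↦ ?_
  obtain ⟨v, rfl⟩ | ⟨e, s, rfl⟩ := N.vtx_or_edge x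
  exacts [N.vtx_mem_tree v, N.edge_mem_tree (h ▸ mem_univ e) s]

/-! ### The ends of the core are the ends accumulated by non-tree edges -/

section Core

variable [T2Space X] [CWComplex (univ : Set X)]
  {N : TreeModel X (RelCWComplex.cell (univ : Set X) 0) (RelCWComplex.cell (univ : Set X) 1)}

/-- The complement of a cone, as a subcomplex. -/
def coneCompl (hX : IsLocallyFiniteGraph X) (hv : ∀ v, RelCWComplex.openCell 0 v = {N.vtx v})
    (he : ∀ e, RelCWComplex.openCell 1 e = N.edge e '' Ioo 0 1)
    (u : RelCWComplex.cell (univ : Set X) 0) : RelCWComplex.Subcomplex (univ : Set X) :=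
  ⟨(N.cone u)ᶜ, fun n ↦ match n with
    | 0 => {v | ¬ N.Le u v}
    | 1 => {e | ¬ N.Le u (N.tgt e)}
    | _ => ∅, (N.isOpen_cone u).isClosed_compl, by
    rw [empty_union]
    ext x
    simp only [mem_iUnion, mem_compl_iff]
    constructor
    · rintro ⟨n, ⟨i, hi⟩, hx⟩
      match n, i, hi, hx with
      | 0, v, hi, hx =>
        rw [hv] at hx
        rw [mem_singleton_iff.1 hx]
        exact fun h ↦ hi (N.vtx_mem_cone.1 h)
      | 1, e, hi, hx =>
        rw [he] at hx
        obtain ⟨s, hs, rfl⟩ := hx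
        exact fun h ↦ hi ((N.edge_mem_cone hs.1).1 h)
      | n + 2, e, _, _ => exact ((hX.isEmpty_cell (n + 2) (by omega)).false e).elim
    · intro hx
      obtain ⟨v, rfl⟩ | ⟨e, s, hs, rfl⟩ := N.exists_cell x
      · exact ⟨0, ⟨v, fun h ↦ hx (N.vtx_mem_cone.2 h)⟩, by rw [hv]; rfl⟩
      · exact ⟨1, ⟨e, fun h ↦ hx ((N.edge_mem_cone hs.1).2 h)⟩, by rw [he]; exact ⟨s, hs, rfl⟩⟩⟩

theorem core_eq : (core X : Set X) =
    ⋂ (E : RelCWComplex.Subcomplex (univ : Set X)) (_ : ContainsImmersedLoops X E), (E : Set X) :=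
  rfl

/-- If no non-tree edge ends above `u`, then immersed loops avoid the cone of `u`. The complement of
the cone is therefore a subgraph containing the core, and no end of the core leads into the cone. -/
theorem coreEnds_subset (hX : IsLocallyFiniteGraph X)
    (hv : ∀ v, RelCWComplex.openCell 0 v = {N.vtx v})
    (he : ∀ e, RelCWComplex.openCell 1 e = N.edge e '' Ioo 0 1) : coreEnds X ⊆ N.loopEnds := by
  rintro ω ⟨η, hη⟩
  by_contra hω
  obtain ⟨n, hnu⟩ := N.exists_ray_of_notMem_loopEnds hω
  set u := N.ray ω n
  have hcore : (core X : Set X) ⊆ (N.cone u)ᶜ := by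
    rw [core_eq]
    refine iInter₂_subset_of_subset (coneCompl hX hv he u) ?_ (subset_refl _)
    rintro γ hγ _ ⟨c, rfl⟩ hc
    obtain ⟨e, h1, h2⟩ := N.exists_notTreeEdge_of_immersedLoop hγ hc
    exact hnu e h1 h2
  have ht := ProperMap.tendsto_endFilter (⟨⟨Subtype.val, continuous_subtype_val⟩,
    (core X).closed.isProperMap_subtypeVal⟩ : ProperMap ((core X : Set X) : Type _) X) η
  rw [hη] at ht
  obtain ⟨y, hy⟩ := Filter.nonempty_of_mem (Filter.mem_map.1 (ht (N.cone_ray_mem ω n)))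
  exact hcore y.2 hy

/-- Above the depth of a fixed non-tree edge `e₀`, every tree edge on the ray of `ω` separates `e₀`
from a non-tree edge further out, so it lies on an immersed loop. A tail of the ray thus runs in the
core and defines an end of it. -/
theorem subset_coreEnds : N.loopEnds ⊆ coreEnds X := by
  intro ω hω
  obtain ⟨e₀, he₀, -⟩ := hω 0
  let m := N.depth (N.src e₀) + 1
  have hcore : ∀ n, m ≤ n → ∃ t ∈ N.treeEdge, N.tgt t = N.ray ω n ∧
      range (N.edge t) ⊆ (core X : Set X) := by
    intro n hn
    obtain ⟨e, he, hle⟩ := hω n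
    obtain ⟨t, ht, htn, γ, hγ, hsub⟩ := exists_immersedLoop_treeEdge he he₀
      (hle.trans (N.le_src_tgt e)) (u := N.ray ω n) fun h ↦ by
        have := h.depth_le
        rw [N.depth_ray] at this
        omega
    refine ⟨t, ht, htn, hsub.trans ?_⟩
    rw [core_eq]
    exact subset_iInter₂ fun F hF ↦ hF γ hγ
  have : Nonempty (RelCWComplex.cell (univ : Set X) 1) := ⟨e₀⟩
  choose! t ht htn htc using hcore
  let y : ℕ → (core X : Set X) := fun k ↦
    ⟨N.edge (t (m + k)) 1, htc (m + k) (Nat.le_add_right _ _) ⟨1, rfl⟩⟩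
  have hyv : ∀ k, (y k : X) = N.vtx (N.ray ω (m + k)) := fun k ↦ by
    change N.edge _ 1 = _
    rw [N.edge_one, htn _ (Nat.le_add_right _ _)]
  have hedge : ∀ k, N.edge (t (m + (k + 1))) 0 = y k := fun k ↦ by
    rw [N.edge_zero, hyv, N.src_eq_parent _ (ht _ (Nat.le_add_right _ _)),
      htn _ (Nat.le_add_right _ _)]
    congr 1
    have h1 := N.anc_ray (ω := ω) (show m + k ≤ m + (k + 1) by omega)
    rw [← h1, RootedTree.anc, N.depth_ray, show m + (k + 1) - (m + k) = 1 by omega,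
      Function.iterate_one]
  obtain ⟨η, hη⟩ := exists_end_of_filter (Filter.map y Filter.atTop) fun K ↦ by
    obtain ⟨n, hn⟩ := N.exists_disjoint_cone (K.isCompact.image continuous_subtype_val)
    -- Far out, the ray edges avoid `K`. They lie in the core and join consecutive vertices, so all
    -- later vertices belong to one component of the core minus `K`.
    have hdisj : ∀ k, n ≤ k → ∀ s (h : N.edge (t (m + (k + 1))) s ∈ (core X : Set X)),
        (⟨_, h⟩ : (core X : Set X)) ∉ (K : Set _) := by
      intro k hk s h hK
      refine disjoint_left.1 (hn (N.ray ω (m + k)) (by rw [N.depth_ray]; omega)) ?_ ⟨_, hK, rfl⟩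
      refine N.edge_mem_cone_of_src ?_ s
      rw [← N.vtx_mem_cone, ← N.edge_zero, hedge, hyv, N.vtx_mem_cone]
      exact N.le_refl _
    have hyK : y n ∉ (K : Set _) := by
      have := hdisj n le_rfl 0 (htc _ (Nat.le_add_right _ _) ⟨0, rfl⟩)
      simpa only [hedge] using this
    refine ⟨ConnectedComponents.mk ⟨y n, hyK⟩, Filter.mem_map.2
      (Filter.mem_of_superset (Filter.mem_atTop n) fun k hk ↦ ?_)⟩
    induction k, hk using Nat.le_induction with
    | base => exact ⟨hyK, rfl⟩
    | succ k hk ih =>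
      let q : I → (core X : Set X) := fun s ↦
        ⟨N.edge (t (m + (k + 1))) s, htc _ (Nat.le_add_right _ _) ⟨s, rfl⟩⟩
      have hq : Continuous q := by fun_prop
      refine subset_compSet (isPreconnected_range hq) ?_ ⟨y k, ⟨0, Subtype.ext (hedge k)⟩, ih⟩
        ⟨1, rfl⟩
      rw [disjoint_left]
      rintro _ ⟨s, rfl⟩
      exact hdisj k hk s _
  refine ⟨η, ProperMap.endMap_eq_of_tendsto _ hη ?_⟩
  refine (N.hasBasis_endFilter_cone ω).tendsto_right_iff.2 fun n _ ↦ ?_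
  refine Filter.mem_map.2 (Filter.mem_of_superset (Filter.mem_atTop n) fun k hk ↦ ?_)
  change (y k : X) ∈ N.cone _
  rw [hyv, N.vtx_mem_cone]
  exact N.ray_le (le_trans hk (Nat.le_add_left k m))

theorem coreEnds_eq (hX : IsLocallyFiniteGraph X)
    (hv : ∀ v, RelCWComplex.openCell 0 v = {N.vtx v})
    (he : ∀ e, RelCWComplex.openCell 1 e = N.edge e '' Ioo 0 1) : coreEnds X = N.loopEnds :=
  (coreEnds_subset hX hv he).antisymm subset_coreEnds

end Core

end TreeModel

end LocallyFiniteGraph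

end

noncomputable section

namespace LocallyFiniteGraph

universe u v w

open unitInterval

/-! ### Invariance of the set of ends accumulated by loops -/

section Winding

variable {X : Type u} [TopologicalSpace X]

/-- The quotient of a circle-valued function along two paths. -/
def pathQuotient (p₀ p₁ : C(I, X)) (φ : C(X, Circle)) : C(I, Circle) :=
  ⟨fun s ↦ φ (p₀ s) / φ (p₁ s), by fun_prop⟩

/-- A free homotopy suffices: the two paths share their endpoints, so the quotient is `1` there at
all times. -/
theorem homotopicRel_pathQuotient {p₀ p₁ : C(I, X)} (h0 : p₀ 0 = p₁ 0) (h1 : p₀ 1 = p₁ 1)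
    {f g : C(X, X)} (H : ContinuousMap.Homotopy f g) (φ : C(X, Circle)) :
    (pathQuotient p₀ p₁ (φ.comp f)).HomotopicRel (pathQuotient p₀ p₁ (φ.comp g)) {0, 1} := by
  refine ⟨⟨⟨⟨fun p ↦ φ (H (p.1, p₀ p.2)) / φ (H (p.1, p₁ p.2)), by fun_prop⟩, fun s ↦ ?_,
    fun s ↦ ?_⟩, ?_⟩⟩
  · simp [pathQuotient]
  · simp [pathQuotient]
  · rintro t s (rfl | rfl) <;> simp [pathQuotient, h0, h1]

end Winding

namespace TreeModel

variable {X : Type u} [TopologicalSpace X] [T2Space X] {V : Type v} {E : Type w}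
  (N : TreeModel X V E)

open Classical in
/-- The map to the circle that winds along the edge `e` and collapses the rest of the graph. -/
def edgeCircle (e : E) : C(X, Circle) :=
  N.lift (fun _ ↦ 1) (fun e' ↦ if e' = e then ⟨fun s ↦ Circle.exp (2 * Real.pi * s), by fun_prop⟩
    else .const I 1) (fun e' ↦ by split_ifs <;> simp) (fun e' ↦ by split_ifs <;> simp)

theorem edgeCircle_edge (e : E) (s : I) :
    N.edgeCircle e (N.edge e s) = Circle.exp (2 * Real.pi * s) := by
  rw [edgeCircle, N.lift_edge, if_pos rfl]
  rfl

theorem edgeCircle_tree {e : E} (he : e ∉ N.treeEdge) {x : X} (hx : x ∈ N.tree) :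
    N.edgeCircle e x = 1 := by
  obtain rfl | ⟨e', he', s, -, rfl⟩ := N.tree_cases hx
  · rw [edgeCircle, N.lift_vtx]
  · rw [edgeCircle, N.lift_edge, if_neg (fun h : e' = e ↦ he (h ▸ he'))]
    rfl

variable {N}

/-- The quotient winds once around the circle: its lift to the line that starts at `0` ends at `2π`.
-/
theorem not_homotopicRel_one {e : E} (he : e ∉ N.treeEdge) {p₀ p₁ : C(I, X)}
    (h0 : ∀ s, p₀ s = N.edge e s) (h1 : ∀ s, p₁ s ∈ N.tree) :
    ¬ (pathQuotient p₀ p₁ (N.edgeCircle e)).HomotopicRel (.const I 1) {0, 1} := by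
  intro h
  have hv : ∀ s, pathQuotient p₀ p₁ (N.edgeCircle e) s = Circle.exp (2 * Real.pi * s) := fun s ↦ by
    change N.edgeCircle e (p₀ s) / N.edgeCircle e (p₁ s) = _
    rw [h0, N.edgeCircle_edge, N.edgeCircle_tree he (h1 s), div_one]
  have h2 := Circle.isCoveringMap_exp.liftPath_apply_one_eq_of_homotopicRel h 0
    (by rw [hv]; simp) (by simp)
  have h3 : (⟨fun s ↦ 2 * Real.pi * s, by fun_prop⟩ : C(I, ℝ)) =
      Circle.isCoveringMap_exp.liftPath (pathQuotient p₀ p₁ (N.edgeCircle e)) 0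
        (by rw [hv]; simp) :=
    (Circle.isCoveringMap_exp.eq_liftPath_iff' _).2 ⟨funext fun s ↦ (hv s).symm, by simp⟩
  rw [← h3, Circle.isCoveringMap_exp.liftPath_const] at h2
  have h4 : 2 * Real.pi * ((1 : I) : ℝ) = 0 := h2
  simp [Real.pi_ne_zero] at h4

/-- A proper map with a left inverse up to homotopy preserves the ends accumulated by loops. -/
theorem endMap_mem_loopEnds {F G : ProperMap X X}
    (hGF : ProperHomotopic (G.comp F) (ProperMap.id X)) {ω : EndSpace X} (hω : ω ∈ N.loopEnds) :
    F.endMap ω ∈ N.loopEnds := by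
  -- Near the image end the graph is a tree. Choose a non-tree edge `e` so close to `ω` that `F`
  -- sends `e` and the tree path with the same endpoints into this tree. There the winding number of
  -- the pair is trivial, whereas `G ∘ F`, being homotopic to the identity, preserves the winding
  -- number one around `e`.
  by_contra hno
  obtain ⟨n, hn⟩ := N.exists_ray_of_notMem_loopEnds hno
  set u := N.ray (F.endMap ω) n
  have hu := N.cone_subset_tree hn
  obtain ⟨m, -, hm⟩ := (N.hasBasis_endFilter_cone ω).mem_iff.1
    (F.tendsto_endFilter ω (N.cone_ray_mem (F.endMap ω) n))
  obtain ⟨e, he, hle⟩ := hω m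
  let a : N.tree := ⟨_, N.vtx_mem_tree (N.src e)⟩
  let b : N.tree := ⟨_, N.vtx_mem_tree (N.tgt e)⟩
  let p₀ : C(I, X) := N.edge e
  let p₁ : C(I, X) := ⟨fun s ↦ N.geodesic a b s,
    continuous_subtype_val.comp (N.continuous_geodesic.comp
      (continuous_const.prodMk (continuous_const.prodMk continuous_id)))⟩
  have h0 : p₀ 0 = p₁ 0 := by
    change N.edge e 0 = N.geodesic a b 0
    rw [N.edge_zero, N.geodesic_zero]
  have h1 : p₀ 1 = p₁ 1 := by
    change N.edge e 1 = N.geodesic a b 1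
    rw [N.edge_one, N.geodesic_one]
  have hp₀ : ∀ s, F.map (p₀ s) ∈ N.tree := fun s ↦ hu (hm (N.edge_mem_cone_of_src hle s))
  have hp₁ : ∀ s, F.map (p₁ s) ∈ N.tree := fun s ↦ hu (hm (N.geodesic_mem_cone
    (N.vtx_mem_cone.2 hle) (N.vtx_mem_cone.2 (hle.trans (N.le_src_tgt e))) s))
  obtain ⟨H, -⟩ := hGF
  refine not_homotopicRel_one he (p₀ := p₀) (p₁ := p₁) (fun _ ↦ rfl)
    (fun s ↦ (N.geodesic a b s).2) ?_
  have key := (homotopicRel_pathQuotient h0 h1 H (N.edgeCircle e)).symm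
  refine key.trans ?_
  let r : N.tree := ⟨_, N.vtx_mem_tree N.root⟩
  let φ : C(X, Circle) := (N.edgeCircle e).comp G.map
  let q₀ : C(I, N.tree) := ⟨fun s ↦ ⟨_, hp₀ s⟩, by fun_prop⟩
  let q₁ : C(I, N.tree) := ⟨fun s ↦ ⟨_, hp₁ s⟩, by fun_prop⟩
  have hc : ∀ q : C(I, N.tree), Continuous fun p : I × I ↦ φ (N.geodesic (q p.2) r p.1) := fun q ↦
    φ.continuous.comp (continuous_subtype_val.comp (N.continuous_geodesic.comp
      ((q.continuous.comp continuous_snd).prodMk (continuous_const.prodMk continuous_fst))))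
  have hq0 : q₀ 0 = q₁ 0 := Subtype.ext (congrArg F.map h0)
  have hq1 : q₀ 1 = q₁ 1 := Subtype.ext (congrArg F.map h1)
  -- Both paths are contracted to the root along geodesics; at common endpoints they move together,
  -- so the quotient stays `1`.
  refine ⟨⟨⟨⟨fun p ↦ φ (N.geodesic (q₀ p.2) r p.1) / φ (N.geodesic (q₁ p.2) r p.1),
    (hc q₀).div' (hc q₁)⟩, fun s ↦ ?_, fun s ↦ ?_⟩, ?_⟩⟩
  · simp only [N.geodesic_zero]
    rfl
  · simp [N.geodesic_one]
  · rintro t s (rfl | rfl)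
    · simp only [hq0, ContinuousMap.coe_mk, div_self']
      exact (div_eq_one.2 (congrArg φ (congrArg F.map h0))).symm
    · simp only [hq1, ContinuousMap.coe_mk, div_self']
      exact (div_eq_one.2 (congrArg φ (congrArg F.map h1))).symm

end TreeModel

end LocallyFiniteGraph

end

noncomputable section

namespace LocallyFiniteGraph

universe u v w

open unitInterval

namespace TreeModel

variable {X : Type u} [TopologicalSpace X] [T2Space X] {V : Type v} {E : Type w}
  (N : TreeModel X V E)

/-! ### Maps defined on vertices and edges -/

omit [T2Space X] in
theorem exists_le_src_of_le_tgt (n : ℕ) : ∃ m, n ≤ m ∧ ∀ e, m ≤ N.depth (N.tgt e) →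
    n ≤ N.depth (N.src e) := by
  obtain ⟨m, hm⟩ := ((N.finite_edges_depth_src_lt n).image fun e ↦ N.depth (N.tgt e)).bddAbove
  refine ⟨max n (m + 1), le_max_left _ _, fun e he ↦ ?_⟩
  by_contra! hlt
  have := hm ⟨e, hlt, rfl⟩
  simp only at this
  omega

theorem exists_ray_le_src (ω : EndSpace X) (n : ℕ) : ∃ m, n ≤ m ∧ ∀ e,
    N.Le (N.ray ω m) (N.tgt e) → N.Le (N.ray ω n) (N.src e) := by
  obtain ⟨m, hnm, hm⟩ := N.exists_le_src_of_le_tgt n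
  refine ⟨m, hnm, fun e he ↦ ((N.ray_le hnm).trans he).le_of_depth_le (N.le_src_tgt e) ?_⟩
  rw [N.depth_ray]
  exact hm e (by simpa using he.depth_le)

/-- To check convergence at an end, it suffices to consider vertices and edges. -/
theorem tendsto_endFilter_of_cells {Y : Type*} {f : Y × X → X} {ω η : EndSpace X}
    (hv : ∀ n, ∃ m, ∀ v, N.Le (N.ray ω m) v → ∀ y, f (y, N.vtx v) ∈ N.cone (N.ray η n))
    (he : ∀ n, ∃ m, ∀ e, N.Le (N.ray ω m) (N.src e) → ∀ s y,
      f (y, N.edge e s) ∈ N.cone (N.ray η n)) :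
    Filter.Tendsto f (Filter.comap Prod.snd (endFilter ω)) (endFilter η) := by
  refine (N.hasBasis_endFilter_cone _).tendsto_right_iff.2 fun n _ ↦ ?_
  obtain ⟨m₁, h₁⟩ := hv n
  obtain ⟨m₂, h₂⟩ := he n
  obtain ⟨m₃, h₂₃, h₃⟩ := N.exists_ray_le_src ω m₂
  filter_upwards [Filter.preimage_mem_comap (N.cone_ray_mem ω (max m₁ m₃))]
  rintro ⟨y, x⟩ hx
  change x ∈ N.cone _ at hx
  obtain ⟨v, rfl⟩ | ⟨e, s, hs, rfl⟩ := N.exists_cell x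
  · exact h₁ v ((N.ray_le (le_max_left _ _)).trans (N.vtx_mem_cone.1 hx)) y
  · exact h₂ e (h₃ e ((N.ray_le (le_max_right _ _)).trans ((N.edge_mem_cone hs.1).1 hx))) s y

/-- Reparametrising the edges is properly homotopic to the identity. -/
theorem exists_edgeMap (ρ : E → C(I, I)) (h0 : ∀ e, ρ e 0 = 0) (h1 : ∀ e, ρ e 1 = 1) :
    ∃ S : ProperMap X X, (∀ v, S.map (N.vtx v) = N.vtx v) ∧
      (∀ e s, S.map (N.edge e s) = N.edge e (ρ e s)) ∧ ProperHomotopic S (ProperMap.id X) := by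
  let c : E → I × I → I := fun e p ↦ ⟨(1 - p.2) * ρ e p.1 + p.2 * p.1, by
    have h2 := (ρ e p.1).2
    have h3 := p.1.2
    have h4 := p.2.2
    constructor
    · nlinarith [h2.1, h3.1, h4.1, h4.2, mul_nonneg (sub_nonneg.2 h4.2) h2.1, mul_nonneg h4.1 h3.1]
    · nlinarith [mul_nonneg (sub_nonneg.2 h4.2) (sub_nonneg.2 h2.2),
        mul_nonneg h4.1 (sub_nonneg.2 h3.2)]⟩
  have hc : ∀ e, Continuous (c e) := fun e ↦ by fun_prop
  -- Lifting to the path space `C(I, X)` yields joint continuity of the homotopy in point and time.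
  let q : E → C(I, C(I, X)) := fun e ↦ ContinuousMap.curry ⟨fun p ↦ N.edge e (c e p), by fun_prop⟩
  have hq : ∀ e s t, q e s t = N.edge e (c e (s, t)) := fun e s t ↦ rfl
  let L : C(X, C(I, X)) := N.lift (fun v ↦ .const I (N.vtx v)) q
    (fun e ↦ by
      ext t
      rw [hq, ContinuousMap.const_apply, ← N.edge_zero]
      congr 1
      exact Subtype.ext (by simp [c, h0]))
    (fun e ↦ by
      ext t
      rw [hq, ContinuousMap.const_apply, ← N.edge_one]
      congr 1
      exact Subtype.ext (by simp [c, h1]))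
  have hLv : ∀ v t, L (N.vtx v) t = N.vtx v := fun v t ↦ by
    rw [N.lift_vtx]
    rfl
  have hLe : ∀ e s t, L (N.edge e s) t = N.edge e (c e (s, t)) := fun e s t ↦ by
    rw [N.lift_edge, hq]
  let H : I × X → X := fun p ↦ L p.2 p.1
  have hH : Continuous H := by fun_prop
  have hHt : ∀ ω, Filter.Tendsto H (Filter.comap Prod.snd (endFilter ω)) (endFilter (id ω)) := by
    refine fun ω ↦ N.tendsto_endFilter_of_cells (fun n ↦ ⟨n, fun v hv t ↦ ?_⟩)
      fun n ↦ ⟨n, fun e he s t ↦ ?_⟩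
    · change L _ _ ∈ _
      rw [hLv]
      exact N.vtx_mem_cone.2 hv
    · change L _ _ ∈ _
      rw [hLe]
      exact N.edge_mem_cone_of_src he _
  have hS : IsProperMap fun x ↦ H (0, x) :=
    (N.isProperMap_homotopy hH hHt).comp (IsClosedEmbedding.isProperMap
      ⟨isEmbedding_prodMkRight 0, by
        rw [show range (Prod.mk (0 : I)) = {0} ×ˢ (univ : Set X) by ext ⟨t, x⟩; simp [eq_comm]]
        exact isClosed_singleton.prod isClosed_univ⟩)
  refine ⟨⟨⟨fun x ↦ H (0, x), by fun_prop⟩, hS⟩, fun v ↦ hLv v 0, fun e s ↦ ?_,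
    ⟨⟨⟨H, hH⟩, fun x ↦ rfl, fun x ↦ ?_⟩, N.isProperMap_homotopy hH hHt⟩⟩
  · refine (hLe e s 0).trans ?_
    congr 1
    exact Subtype.ext (by simp [c])
  · refine congrFun (N.ext_of_cells (f := fun x ↦ H (1, x)) (g := id) (fun v ↦ hLv v 1)
      fun e s ↦ ?_) x
    refine (hLe e s 1).trans ?_
    congr 1
    exact Subtype.ext (by simp [c])

/-- The map of the unit interval that stretches the middle third. -/
def stretch : C(I, I) := ⟨fun s ↦ projIcc 0 1 zero_le_one (3 * s - 1), by fun_prop⟩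

theorem stretch_eq_zero {s : I} (hs : (s : ℝ) ≤ 1 / 3) : stretch s = 0 :=
  projIcc_of_le_left zero_le_one (by linarith)

theorem stretch_eq_one {s : I} (hs : 2 / 3 ≤ (s : ℝ)) : stretch s = 1 :=
  projIcc_of_right_le zero_le_one (by linarith)

/-- A path between two points of the spanning tree that runs through a given edge in its middle
third. -/
theorem exists_pathThrough (x y : N.tree) (e : E) : ∃ P : C(I, X), P 0 = x ∧ P 1 = y ∧
    (∀ s, P s = N.edge e (stretch s) ∨ P s ∈ N.tree ∧ (stretch s = 0 ∨ stretch s = 1)) ∧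
    ∀ u, (x : X) ∈ N.cone u → (y : X) ∈ N.cone u → N.Le u (N.src e) → ∀ s, P s ∈ N.cone u := by
  let a : N.tree := ⟨_, N.vtx_mem_tree (N.src e)⟩
  let b : N.tree := ⟨_, N.vtx_mem_tree (N.tgt e)⟩
  let α : I → I := fun s ↦ projIcc 0 1 zero_le_one (3 * s)
  let β : I → I := fun s ↦ projIcc 0 1 zero_le_one (3 * s - 2)
  have hα : Continuous α := by fun_prop
  have hβ : Continuous β := by fun_prop
  have hcg : ∀ p q : N.tree, ∀ f : I → I, Continuous f → Continuous fun s ↦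
      (N.geodesic p q (f s) : X) := fun p q f hf ↦
    continuous_subtype_val.comp (N.continuous_geodesic.comp
      (continuous_const.prodMk (continuous_const.prodMk hf)))
  let P : I → X := fun s ↦ if (s : ℝ) ≤ 1 / 3 then N.geodesic x a (α s) else
    if (s : ℝ) ≤ 2 / 3 then N.edge e (stretch s) else N.geodesic b y (β s)
  have hP : Continuous P := by
    refine Continuous.if_le (hcg _ _ _ hα) (Continuous.if_le ((N.edge e).continuous.comp
      stretch.continuous) (hcg _ _ _ hβ) continuous_subtype_val continuous_const fun s hs ↦ ?_)
      continuous_subtype_val continuous_const fun s hs ↦ ?_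
    · have h1 : β s = 0 := projIcc_of_le_left _ (by linarith)
      rw [stretch_eq_one hs.ge, h1, N.edge_one, N.geodesic_zero]
    · have h1 : α s = 1 := projIcc_of_right_le _ (by linarith)
      rw [if_pos (by rw [hs]; norm_num), stretch_eq_zero hs.le, h1, N.edge_zero, N.geodesic_one]
  refine ⟨⟨P, hP⟩, ?_, ?_, fun s ↦ ?_, fun u hx hy hu s ↦ ?_⟩
  · have h1 : α 0 = 0 := projIcc_of_le_left _ (by simp)
    change P 0 = x
    simp only [P, h1, Icc.coe_zero]
    rw [if_pos (by norm_num), N.geodesic_zero]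
  · have h1 : β 1 = 1 := projIcc_of_right_le _ (by norm_num)
    change P 1 = y
    simp only [P, h1, Icc.coe_one]
    rw [if_neg (by norm_num), if_neg (by norm_num), N.geodesic_one]
  · change P s = _ ∨ P s ∈ _ ∧ _
    simp only [P]
    split_ifs with h1 h2
    · exact Or.inr ⟨Subtype.property _, Or.inl (stretch_eq_zero h1)⟩
    · exact Or.inl rfl
    · exact Or.inr ⟨Subtype.property _, Or.inr (stretch_eq_one (not_le.1 h2).le)⟩
  · change P s ∈ _
    have ha : (a : X) ∈ N.cone u := N.vtx_mem_cone.2 hu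
    have hb : (b : X) ∈ N.cone u := N.vtx_mem_cone.2 (hu.trans (N.le_src_tgt e))
    simp only [P]
    split_ifs with h1 h2
    · exact N.geodesic_mem_cone hx ha _
    · exact N.edge_mem_cone_of_src hu _
    · exact N.geodesic_mem_cone hb hy _

end TreeModel

end LocallyFiniteGraph

end

noncomputable section

namespace LocallyFiniteGraph

universe u v w

/-! ### Approximating homeomorphisms of the space of ends on vertices and edges -/

/-- Choose greedily along an enumeration: an infinite set has elements outside the finite set
already used. -/
theorem exists_injective_choice {ι : Type*} [Countable ι] {α : Type*} (S : ι → Set α)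
    (hS : ∀ i, (S i).Infinite) : ∃ f : ι → α, Function.Injective f ∧ ∀ i, f i ∈ S i := by
  classical
  obtain hι | hι := isEmpty_or_nonempty ι
  · exact ⟨isEmptyElim, fun i ↦ isEmptyElim i, fun i ↦ isEmptyElim i⟩
  obtain ⟨idx, hidx⟩ := Countable.exists_injective_nat ι
  have hc : ∀ (n : ℕ) (T : Finset α), ∃ a ∈ S (Function.invFun idx n), a ∉ T := fun n T ↦
    (hS _).exists_notMem_finset T
  choose c hcS hcT using hc
  let T : ℕ → Finset α := fun n ↦ Nat.rec ∅ (fun n T ↦ insert (c n T) T) n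
  have hT : ∀ n, T (n + 1) = insert (c n (T n)) (T n) := fun n ↦ rfl
  have hmono : Monotone T := monotone_nat_of_le_succ fun n ↦ by
    rw [hT]
    exact Finset.subset_insert _ _
  have hne : ∀ m n, m < n → c m (T m) ≠ c n (T n) := fun m n h he ↦
    hcT n (T n) (he ▸ hmono (Nat.succ_le_of_lt h) (hT m ▸ Finset.mem_insert_self _ _))
  refine ⟨fun i ↦ c (idx i) (T (idx i)), fun i j hij ↦ ?_, fun i ↦ ?_⟩
  · obtain h | h | h := lt_trichotomy (idx i) (idx j)
    exacts [absurd hij (hne _ _ h), hidx h, absurd hij.symm (hne _ _ h)]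
  · have := hcS (idx i) (T (idx i))
    rwa [Function.leftInverse_invFun hidx i] at this

namespace TreeModel

variable {X : Type u} [TopologicalSpace X] [T2Space X] {V : Type v} {E : Type w}
  (N : TreeModel X V E)

/-- A non-principal ultrafilter on `S` is pushed forward to one that leaves all compact sets and
hence converges to an end. -/
theorem exists_accumulation {ι : Type*} {p : ι → X} (hp : ∀ K, IsCompact K → {i | p i ∈ K}.Finite)
    {S : Set ι} (hS : S.Infinite) : ∃ ω, ∀ n, (S ∩ {i | p i ∈ N.cone (N.ray ω n)}).Infinite := by
  have := hS.cofinite_inf_principal_neBot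
  let U := Ultrafilter.of (Filter.cofinite ⊓ Filter.principal S)
  have hU : (U : Filter ι) ≤ Filter.cofinite ⊓ Filter.principal S := Ultrafilter.of_le _
  obtain ⟨ω, hω⟩ := N.exists_end_of_ultrafilter (U.map p) fun s hs ↦ by
    obtain ⟨K, hK, hKs⟩ := Filter.mem_cocompact.1 hs
    refine hU.trans inf_le_left ?_
    exact (hp K hK).subset fun i hi ↦ by_contra fun h ↦ hi (hKs h)
  refine ⟨ω, fun n hfin ↦ ?_⟩
  have h1 : S ∩ {i | p i ∈ N.cone (N.ray ω n)} ∈ U :=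
    Filter.inter_mem (hU.trans inf_le_right (Filter.mem_principal_self S)) (hω (N.cone_ray_mem ω n))
  have h2 := (hU.trans inf_le_left) hfin.compl_mem_cofinite
  exact Ultrafilter.compl_notMem_iff.2 h1 h2

omit [T2Space X] in
theorem finite_edges_src_mem {K : Set X} (hK : IsCompact K) :
    {e | N.vtx (N.src e) ∈ K}.Finite :=
  (N.finite_edges_inter hK).subset fun e he ↦ ⟨_, ⟨0, N.edge_zero e⟩, he⟩

/-- Infinitely many such edges would accumulate at an end, which is then in `loopEnds`, and so would
enter its cone of depth `n`. -/
theorem finite_loops (n : ℕ) :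
    {e | e ∉ N.treeEdge ∧ ∀ ω ∈ N.loopEnds, ¬ N.Le (N.ray ω n) (N.src e)}.Finite := by
  by_contra hS
  obtain ⟨ω, hω⟩ := N.exists_accumulation (p := fun e ↦ N.vtx (N.src e))
    (fun K hK ↦ N.finite_edges_src_mem hK) hS
  have hωL : ω ∈ N.loopEnds := fun k ↦ by
    obtain ⟨e, ⟨he, -⟩, h⟩ := (hω k).nonempty
    exact ⟨e, he, N.vtx_mem_cone.1 h⟩
  obtain ⟨e, ⟨-, he⟩, h⟩ := (hω n).nonempty
  exact he ω hωL (N.vtx_mem_cone.1 h)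

variable {N} in
theorem infinite_loops {ω : EndSpace X} (hω : ω ∈ N.loopEnds) (n : ℕ) :
    {e | e ∉ N.treeEdge ∧ N.Le (N.ray ω n) (N.src e)}.Infinite := by
  intro hfin
  obtain ⟨k, hk⟩ := (hfin.image fun e ↦ N.depth (N.src e)).bddAbove
  obtain ⟨e, he, hle⟩ := hω (max n (k + 1))
  have h1 := hk ⟨e, ⟨he, (N.ray_le (le_max_left _ _)).trans hle⟩, rfl⟩
  have h2 := hle.depth_le
  simp only [N.depth_ray] at h1 h2
  omega

/-- In a nonempty set of ends there is one that follows the path to a given vertex for as long as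
possible. -/
theorem exists_nearest_end {A : Set (EndSpace X)} (hA : A.Nonempty) (v : V) :
    ∃ η ∈ A, ∀ k, ∀ ω ∈ A, N.Le (N.ray ω k) v → N.ray η k = N.ray ω k := by
  let B : Set ℕ := {k | ∃ ω ∈ A, N.Le (N.ray ω k) v}
  have hB : BddAbove B := ⟨N.depth v, by
    rintro k ⟨ω, -, hω⟩
    simpa using hω.depth_le⟩
  have hB0 : B.Nonempty := by
    obtain ⟨ω, hω⟩ := hA
    refine ⟨0, ω, hω, ?_⟩
    rw [N.depth_eq_zero.1 (N.depth_ray ω 0)]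
    exact N.root_le v
  obtain ⟨η, hη, hηv⟩ := Nat.sSup_mem hB0 hB
  refine ⟨η, hη, fun k ω hω hle ↦ ?_⟩
  exact ((N.ray_le (le_csSup hB ⟨ω, hω, hle⟩)).trans hηv).eq_of_depth_eq hle (by simp)

/-- A vertex `v` follows an end `η` nearest to it: it moves to the vertex of the same depth on the
ray of `h η`. Vertices not above any ray vertex of depth `m` stay fixed. If `v` is close to `ω`, so
is `η`, and the image is close to `h ω`. -/
theorem exists_vertexMap {h : EndSpace X → EndSpace X} (hc : Continuous h) {m : ℕ}
    (hm : ∀ ω, N.ray (h ω) m = N.ray ω m) : ∃ f : V → V,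
      (∀ v, f v = v ∨ ∃ u, N.depth u = m ∧ N.Le u v ∧ N.Le u (f v)) ∧
      ∀ ω n, ∃ k, ∀ v, N.Le (N.ray ω k) v → N.Le (N.ray (h ω) n) (f v) := by
  have key : ∀ v, ∃ w, (w = v ∨ ∃ u, N.depth u = m ∧ N.Le u v ∧ N.Le u w) ∧
      ∀ ω k, m ≤ k → N.Le (N.ray ω k) v → ∃ η, N.ray η k = N.ray ω k ∧
        w = N.ray (h η) (N.depth v) := by
    intro v
    by_cases H : ∃ ω, N.Le (N.ray ω m) v
    · obtain ⟨ω, hω⟩ := H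
      obtain ⟨η, -, hη⟩ := N.exists_nearest_end (A := univ) ⟨ω, trivial⟩ v
      refine ⟨N.ray (h η) (N.depth v), Or.inr ⟨N.ray ω m, by simp, hω, ?_⟩, fun ω k _ hk ↦
        ⟨η, hη k ω trivial hk, rfl⟩⟩
      rw [← hη m ω trivial hω, ← hm]
      exact N.ray_le (by simpa using hω.depth_le)
    · exact ⟨v, Or.inl rfl, fun ω k hk hle ↦ absurd ⟨ω, (N.ray_le hk).trans hle⟩ H⟩
  choose f hf hft using key
  refine ⟨f, hf, fun ω n ↦ ?_⟩
  obtain ⟨k, hk⟩ := N.exists_ray_eq_imp hc ω n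
  refine ⟨max (max k n) m, fun v hv ↦ ?_⟩
  obtain ⟨η, hη, hfv⟩ := hft v ω _ (le_max_right _ _) hv
  have h1 := hv.depth_le
  rw [N.depth_ray] at h1
  rw [hfv, ← hk η (N.ray_eq_of_le (by omega) hη)]
  exact N.ray_le (by omega)

omit [T2Space X] in
include N in
theorem countable_edges : Countable E := by
  have : (univ : Set E) = ⋃ n, {e | N.depth (N.src e) < n} :=
    (iUnion_eq_univ_iff.2 fun e ↦ ⟨_, Nat.lt_succ_self _⟩).symm
  rw [← countable_univ_iff, this]
  exact countable_iUnion fun n ↦ (N.finite_edges_depth_src_lt n).countable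

/-- Each relevant non-tree edge `i` has a nearest end `π i` in `loopEnds`. A neighbourhood of such
an end catches infinitely many edges, so there are injections of the edges following `h` and its
inverse with errors that tend to `0`. Schröder–Bernstein merges them into a permutation following
`h`. -/
theorem exists_edgePerm {h : EndSpace X ≃ₜ EndSpace X}
    (hL : ∀ ω, h ω ∈ N.loopEnds ↔ ω ∈ N.loopEnds) {m : ℕ}
    (hm : ∀ ω, N.ray (h ω) m = N.ray ω m) : ∃ β : Equiv.Perm E,
      (∀ e ∈ N.treeEdge, β e = e) ∧
      (∀ e, β e = e ∨ ∃ u, N.depth u = m ∧ N.Le u (N.src e) ∧ N.Le u (N.src (β e))) ∧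
      (∀ ω n, ∃ k, ∀ e ∉ N.treeEdge, N.Le (N.ray ω k) (N.src e) →
        N.Le (N.ray (h ω) n) (N.src (β e))) ∧
      ∀ ω n, ∃ k, ∀ e ∉ N.treeEdge, N.Le (N.ray ω k) (N.src e) →
        N.Le (N.ray (h.symm ω) n) (N.src (β.symm e)) := by
  classical
  have := N.countable_edges
  let P : E → Prop := fun e ↦ e ∉ N.treeEdge ∧ ∃ ω ∈ N.loopEnds, N.Le (N.ray ω m) (N.src e)
  let ι := {e // P e}
  have hnear : ∀ i : ι, ∃ η ∈ N.loopEnds, ∀ k, ∀ ω ∈ N.loopEnds, N.Le (N.ray ω k) (N.src i) →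
      N.ray η k = N.ray ω k := fun i ↦ by
    obtain ⟨-, ω, hω, -⟩ := i.2
    exact N.exists_nearest_end ⟨ω, hω⟩ _
  choose π hπL hπ using hnear
  have hπm : ∀ i, N.Le (N.ray (π i) m) (N.src i) := fun i ↦ by
    obtain ⟨-, ω, hω, hle⟩ := i.2
    rwa [hπ i m ω hω hle]
  have hinf : ∀ ω ∈ N.loopEnds, ∀ n, {i : ι | N.ray (π i) n = N.ray ω n}.Infinite := by
    intro ω hω n hfin
    refine infinite_loops hω (max n m) ((hfin.image Subtype.val).subset ?_)
    rintro e ⟨he, hle⟩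
    refine ⟨⟨e, he, ω, hω, (N.ray_le (le_max_right _ _)).trans hle⟩, ?_, rfl⟩
    exact hπ _ n ω hω ((N.ray_le (le_max_left _ _)).trans hle)
  have hfin : ∀ n, {i : ι | ¬ N.Le (N.ray (π i) n) (N.src i)}.Finite := by
    intro n
    refine ((N.finite_loops n).preimage Subtype.val_injective.injOn).subset fun i hi ↦
      ⟨i.2.1, fun ω hω hle ↦ hi ?_⟩
    rwa [hπ i n ω hω hle]
  obtain ⟨idx, hidx⟩ := Countable.exists_injective_nat ι
  have hchoice : ∀ k : EndSpace X ≃ₜ EndSpace X, (∀ ω ∈ N.loopEnds, k ω ∈ N.loopEnds) →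
      ∃ f : ι → ι, Function.Injective f ∧ ∀ i,
        N.ray (k (π i)) (m + idx i) = N.ray (π (f i)) (m + idx i) ∧
        N.ray (k.symm (π (f i))) (m + idx i) = N.ray (π i) (m + idx i) := by
    intro k hk
    obtain ⟨f, hf, hfS⟩ := exists_injective_choice (fun i : ι ↦ {j : ι |
        N.ray (k (π i)) (m + idx i) = N.ray (π j) (m + idx i) ∧
        N.ray (k.symm (π j)) (m + idx i) = N.ray (π i) (m + idx i)}) fun i ↦ by
      obtain ⟨n, hn⟩ := N.exists_ray_eq_imp k.symm.continuous (k (π i)) (m + idx i)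
      refine (hinf _ (hk _ (hπL i)) (max n (m + idx i))).mono fun j hj ↦ ⟨?_, ?_⟩
      · exact (N.ray_eq_of_le (le_max_right _ _) hj).symm
      · rw [hn _ (N.ray_eq_of_le (le_max_left _ _) hj), k.symm_apply_apply]
    exact ⟨f, hf, hfS⟩
  obtain ⟨f, hf, hfR⟩ := hchoice h fun ω hω ↦ (hL ω).2 hω
  obtain ⟨g, hg, hgR⟩ := hchoice h.symm fun ω hω ↦ by
    rwa [← hL, h.apply_symm_apply]
  obtain ⟨b, hb, hbR⟩ := Function.Embedding.schroeder_bernstein_of_rel hf hg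
    -- The relation holds for pairs `(i, f i)` and `(g j, j)`, with precision at least the index of
    -- the edge for which the choice was made. Any fixed precision therefore fails for finitely many
    -- edges only.
    (fun i j ↦ ∃ n, m ≤ n ∧ (idx i ≤ n ∨ idx j ≤ n) ∧ N.ray (h (π i)) n = N.ray (π j) n ∧
      N.ray (h.symm (π j)) n = N.ray (π i) n)
    (fun i ↦ ⟨m + idx i, by omega, Or.inl (by omega), (hfR i).1, (hfR i).2⟩)
    (fun j ↦ ⟨m + idx j, by omega, Or.inr (by omega), (hgR j).2, (hgR j).1⟩)
  let B : Equiv.Perm ι := Equiv.ofBijective b hb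
  -- Up to finitely many exceptions, an edge close to `ω` has its `π` close to `ω`, the `π` of its
  -- image is close to `k ω`, and the image edge lies close to its own `π`. Ends outside `loopEnds`
  -- have no non-tree edges nearby.
  have htame : ∀ (k : EndSpace X ≃ₜ EndSpace X) (c : Equiv.Perm ι),
      (∀ n, {i | N.ray (k (π i)) n ≠ N.ray (π (c i)) n}.Finite) →
      ∀ ω n, ∃ j, ∀ e ∉ N.treeEdge, N.Le (N.ray ω j) (N.src e) →
        N.Le (N.ray (k ω) n) (N.src (Equiv.Perm.ofSubtype c e)) := by
    intro k c hkc ω n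
    by_cases hω : ω ∈ N.loopEnds
    · obtain ⟨n₁, hn₁⟩ := N.exists_ray_eq_imp k.continuous ω n
      have hbad := (hkc n).union ((hfin n).preimage c.injective.injOn)
      obtain ⟨d, hd⟩ := (hbad.image fun i : ι ↦ N.depth (N.src i)).bddAbove
      refine ⟨max (max n₁ m) (d + 1), fun e he hle ↦ ?_⟩
      let i : ι := ⟨e, he, ω, hω, (N.ray_le (by omega)).trans hle⟩
      have hi : i ∉ {i | N.ray (k (π i)) n ≠ N.ray (π (c i)) n} ∪
          c ⁻¹' {i : ι | ¬ N.Le (N.ray (π i) n) (N.src i)} := fun h ↦ by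
        have h1 := hd ⟨i, h, rfl⟩
        have h2 := hle.depth_le
        simp only [N.depth_ray, i] at h1 h2
        omega
      simp only [mem_union, mem_ofPred_eq, mem_preimage, not_or, not_not, ne_eq] at hi
      rw [show Equiv.Perm.ofSubtype c e = c i from Equiv.Perm.ofSubtype_apply_of_mem c i.2,
        ← hn₁ (π i) (hπ i n₁ ω hω ((N.ray_le (by omega)).trans hle)), hi.1]
      exact hi.2
    · simp only [loopEnds, mem_ofPred_eq, not_forall, not_exists, not_and] at hω
      obtain ⟨j, hj⟩ := hω
      exact ⟨j, fun e he hle ↦ absurd hle (hj e he)⟩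
  have hbad : ∀ n, {i | idx i < n ∨ idx (b i) < n}.Finite := fun n ↦
    ((finite_lt_nat n).preimage hidx.injOn).union
      ((finite_lt_nat n).preimage (hidx.comp hb.1).injOn)
  refine ⟨Equiv.Perm.ofSubtype B, fun e he ↦ Equiv.Perm.ofSubtype_apply_of_not_mem B
    fun h ↦ h.1 he, fun e ↦ ?_, htame h B fun n ↦ (hbad n).subset fun i hi ↦ ?_, ?_⟩
  · by_cases he : P e
    · let i : ι := ⟨e, he⟩
      rw [show Equiv.Perm.ofSubtype B e = b i from Equiv.Perm.ofSubtype_apply_of_mem B he]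
      refine Or.inr ⟨N.ray (π i) m, by simp, hπm i, ?_⟩
      obtain ⟨n, hmn, -, h1, -⟩ := hbR i
      rw [← hm, N.ray_eq_of_le hmn h1]
      exact hπm _
    · exact Or.inl (Equiv.Perm.ofSubtype_apply_of_not_mem B he)
  · obtain ⟨k, -, hk, h1, -⟩ := hbR i
    by_contra hno
    simp only [mem_ofPred_eq, not_or, not_lt] at hno
    exact hi (N.ray_eq_of_le (by omega) h1)
  · change ∀ ω n, ∃ k, ∀ e ∉ N.treeEdge, N.Le (N.ray ω k) (N.src e) →
        N.Le (N.ray (h.symm ω) n) (N.src ((Equiv.Perm.ofSubtype B)⁻¹ e))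
    rw [← map_inv]
    refine htame h.symm B⁻¹ fun n ↦ ((hbad n).preimage B⁻¹.injective.injOn).subset fun j hj ↦ ?_
    obtain ⟨i, rfl⟩ := B.surjective j
    have hB : B⁻¹ (B i) = i := B.symm_apply_apply i
    rw [mem_preimage, hB]
    rw [mem_ofPred_eq, hB] at hj
    obtain ⟨k, -, hk, -, h1⟩ := hbR i
    by_contra hno
    simp only [mem_ofPred_eq, not_or, not_lt] at hno
    exact hj (N.ray_eq_of_le (by omega) h1)

end TreeModel

end LocallyFiniteGraph

end

noncomputable section

namespace LocallyFiniteGraph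

universe u v w

open unitInterval

namespace TreeModel

variable {X : Type u} [TopologicalSpace X] [T2Space X] {V : Type v} {E : Type w}
  (N : TreeModel X V E)

/-! ### Realising homeomorphisms of the space of ends by proper homotopy equivalences -/

/-- A proper map is close to the identity beyond depth `n` if it moves points only inside cones of
depth `n`. -/
def IsClose (n : ℕ) (F : ProperMap X X) : Prop :=
  ∀ x, F.map x = x ∨ ∃ u, N.depth u = n ∧ x ∈ N.cone u ∧ F.map x ∈ N.cone u

/-- A proper map with prescribed behaviour on vertices and edges. -/
theorem exists_realization {h : EndSpace X → EndSpace X} {m n : ℕ} (hmn : n ≤ m)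
    (hsrc : ∀ e, m ≤ N.depth (N.tgt e) → n ≤ N.depth (N.src e)) {f : V → V} {b : E → E}
    (hf : ∀ v, f v = v ∨ ∃ u, N.depth u = m ∧ N.Le u v ∧ N.Le u (f v))
    (hft : ∀ ω n, ∃ k, ∀ v, N.Le (N.ray ω k) v → N.Le (N.ray (h ω) n) (f v))
    (hb : ∀ e, b e = e ∨ ∃ u, N.depth u = m ∧ N.Le u (N.src e) ∧ N.Le u (N.src (b e)))
    (hbt : ∀ ω n, ∃ k, ∀ e ∉ N.treeEdge, N.Le (N.ray ω k) (N.src e) →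
        N.Le (N.ray (h ω) n) (N.src (b e))) :
    ∃ F : ProperMap X X, F.endMap = h ∧ N.IsClose n F ∧ (∀ x ∈ N.tree, F.map x ∈ N.tree) ∧
      (∀ e s, N.depth (N.tgt e) < m → F.map (N.edge e s) = N.edge e s) ∧
      ∀ e ∉ N.treeEdge, m ≤ N.depth (N.tgt e) → ∀ s,
        F.map (N.edge e s) = N.edge (b e) (stretch s) ∨
          F.map (N.edge e s) ∈ N.tree ∧ (stretch s = 0 ∨ stretch s = 1) := by
  classical
  have hlow : ∀ v, N.depth v < m → f v = v := fun v hv ↦ (hf v).resolve_right (by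
    rintro ⟨u, hu, hle, -⟩
    have := hle.depth_le
    omega)
  let p : V → N.tree := fun v ↦ ⟨_, N.vtx_mem_tree v⟩
  -- Edges with target of depth less than `m` are kept, other tree edges become tree paths, and
  -- other non-tree edges run through `b e` in their middle third. Convexity keeps each new path in
  -- every cone that contains its pieces.
  have hP : ∀ e, ∃ P : C(I, X), P 0 = p (f (N.src e)) ∧ P 1 = p (f (N.tgt e)) ∧
      (N.depth (N.tgt e) < m → ∀ s, P s = N.edge e s) ∧ (e ∈ N.treeEdge → ∀ s, P s ∈ N.tree) ∧
      (e ∉ N.treeEdge → m ≤ N.depth (N.tgt e) → ∀ s, P s = N.edge (b e) (stretch s) ∨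
        P s ∈ N.tree ∧ (stretch s = 0 ∨ stretch s = 1)) ∧
      (m ≤ N.depth (N.tgt e) → ∀ u, N.Le u (f (N.src e)) → N.Le u (f (N.tgt e)) →
        (e ∉ N.treeEdge → N.Le u (N.src (b e))) → ∀ s, P s ∈ N.cone u) := by
    intro e
    by_cases hem : N.depth (N.tgt e) < m
    · refine ⟨N.edge e, ?_, ?_, fun _ _ ↦ rfl, fun he s ↦ N.edge_mem_tree he s,
        fun _ h ↦ absurd hem (not_lt.2 h), fun h ↦ absurd hem (not_lt.2 h)⟩
      · rw [hlow _ ((N.depth_src_le_tgt e).trans_lt hem), N.edge_zero]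
      · rw [hlow _ hem, N.edge_one]
    by_cases het : e ∈ N.treeEdge
    · refine ⟨⟨fun s ↦ N.geodesic (p (f (N.src e))) (p (f (N.tgt e))) s,
        continuous_subtype_val.comp (N.continuous_geodesic.comp
          (continuous_const.prodMk (continuous_const.prodMk continuous_id)))⟩,
        congrArg Subtype.val (N.geodesic_zero _ _), congrArg Subtype.val (N.geodesic_one _ _),
        fun h ↦ absurd h hem, fun _ s ↦ Subtype.property _, fun h ↦ absurd het h,
        fun _ u h1 h2 _ s ↦ N.geodesic_mem_cone (N.vtx_mem_cone.2 h1) (N.vtx_mem_cone.2 h2) s⟩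
    · obtain ⟨P, h0, h1, h2, h3⟩ :=
        N.exists_pathThrough (p (f (N.src e))) (p (f (N.tgt e))) (b e)
      exact ⟨P, h0, h1, fun h ↦ absurd h hem, fun h ↦ absurd h het, fun _ _ ↦ h2,
        fun _ u hu hu' hub ↦ h3 u (N.vtx_mem_cone.2 hu) (N.vtx_mem_cone.2 hu') (hub het)⟩
  choose P hP0 hP1 hPlow hPtree hPb hPc using hP
  let F : C(X, X) := N.lift (fun v ↦ p (f v)) P hP0 hP1
  have hFv : ∀ v, F (N.vtx v) = N.vtx (f v) := fun v ↦ N.lift_vtx _ _ _ _ v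
  have hFe : ∀ e s, F (N.edge e s) = P e s := fun e s ↦ N.lift_edge _ _ _ _ e s
  have ht : ∀ ω, Filter.Tendsto F (endFilter ω) (endFilter (h ω)) := by
    intro ω
    have h1 : Filter.Tendsto (fun q : Unit × X ↦ F q.2) (Filter.comap Prod.snd (endFilter ω))
        (endFilter (h ω)) := by
      refine N.tendsto_endFilter_of_cells (fun n ↦ ?_) fun n ↦ ?_
      · obtain ⟨k, hk⟩ := hft ω n
        refine ⟨k, fun v hv _ ↦ ?_⟩
        rw [hFv]
        exact N.vtx_mem_cone.2 (hk v hv)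
      · obtain ⟨k, hk⟩ := hft ω n
        obtain ⟨l, hl⟩ := hbt ω n
        refine ⟨max (max k l) m, fun e he s _ ↦ ?_⟩
        have hk' := (N.ray_le (ω := ω) (show k ≤ max (max k l) m by omega)).trans he
        have hl' := (N.ray_le (ω := ω) (show l ≤ max (max k l) m by omega)).trans he
        have hd := (he.trans (N.le_src_tgt e)).depth_le
        rw [N.depth_ray] at hd
        rw [hFe]
        exact hPc e (by omega) _ (hk _ hk') (hk _ (hk'.trans (N.le_src_tgt e)))
          (fun het ↦ hl e het hl') s
    have h2 : Filter.Tendsto (fun x : X ↦ ((), x)) (endFilter ω)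
        (Filter.comap Prod.snd (endFilter ω)) := Filter.tendsto_comap_iff.2 Filter.tendsto_id
    exact h1.comp h2
  refine ⟨⟨F, N.isProperMap_of_ends F ht⟩, ProperMap.endMap_eq _ ht, fun x ↦ ?_, fun x hx ↦ ?_,
    fun e s he ↦ (hFe e s).trans (hPlow e he s), fun e he hem s ↦ ?_⟩
  · change F x = x ∨ ∃ u, N.depth u = n ∧ x ∈ N.cone u ∧ F x ∈ N.cone u
    obtain ⟨v, rfl⟩ | ⟨e, s, rfl⟩ := N.vtx_or_edge x
    · rw [hFv]
      obtain h1 | ⟨u, hu, h1, h2⟩ := hf v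
      · exact Or.inl (by rw [h1])
      · have h3 := N.anc_le u n
        exact Or.inr ⟨N.anc u n, N.depth_anc (by omega), N.vtx_mem_cone.2 (h3.trans h1),
          N.vtx_mem_cone.2 (h3.trans h2)⟩
    · rw [hFe]
      obtain hem | hem := lt_or_ge (N.depth (N.tgt e)) m
      · exact Or.inl (hPlow e hem s)
      -- The source still has depth at least `n`, so its ancestor `u` of depth `n` has a cone
      -- containing the edge; vertex and edge moves happen inside cones of depth `m ≥ n` and do not
      -- leave it.
      · have hd := hsrc e hem
        set u := N.anc (N.src e) n
        have hu : N.depth u = n := N.depth_anc hd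
        have hus : N.Le u (N.src e) := N.anc_le _ _
        have hmove : ∀ v w, N.Le u v → (w = v ∨ ∃ u', N.depth u' = m ∧ N.Le u' v ∧ N.Le u' w) →
            N.Le u w := by
          rintro v w huv (rfl | ⟨u', hu', h1, h2⟩)
          · exact huv
          · exact (huv.le_of_depth_le h1 (by omega)).trans h2
        refine Or.inr ⟨u, hu, N.edge_mem_cone_of_src hus s, hPc e hem u (hmove _ _ hus (hf _))
          (hmove _ _ (hus.trans (N.le_src_tgt e)) (hf _)) (fun _ ↦ hmove _ _ hus ((hb e).imp_left (congrArg N.src))) s⟩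
  · change F x ∈ _
    obtain ⟨v, rfl⟩ | ⟨e, he, s, -, rfl⟩ : (∃ v, N.vtx v = x) ∨ ∃ e ∈ N.treeEdge, ∃ s : I,
        True ∧ N.edge e s = x := by
      obtain ⟨v, rfl⟩ | h := hx
      · exact Or.inl ⟨v, rfl⟩
      · obtain ⟨e, he, s, hs⟩ := mem_iUnion₂.1 h
        exact Or.inr ⟨e, he, s, trivial, hs⟩
    · rw [hFv]
      exact N.vtx_mem_tree _
    · rw [hFe]
      exact hPtree e he s
  · change F _ = _ ∨ F _ ∈ _ ∧ _
    rw [hFe]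
    exact hPb e he hem s

/-- Build `F` from `h` and the permutation `b`, and `G` from their inverses. On a non-tree edge the
composite either runs along the same edge with parameter `stretch ∘ stretch` or lies in the tree. It
thus differs from a reparametrisation `S` of the edges only inside the tree, where equal action on
ends suffices for a proper homotopy. -/
theorem exists_equivalence {h : EndSpace X ≃ₜ EndSpace X}
    (hL : ∀ ω, h ω ∈ N.loopEnds ↔ ω ∈ N.loopEnds) {m n : ℕ} (hmn : n ≤ m)
    (hsrc : ∀ e, m ≤ N.depth (N.tgt e) → n ≤ N.depth (N.src e))
    (hm : ∀ ω, N.ray (h ω) m = N.ray ω m) : ∃ F G : ProperMap X X,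
      ProperHomotopic (F.comp G) (ProperMap.id X) ∧ ProperHomotopic (G.comp F) (ProperMap.id X) ∧
      F.endMap = h ∧ N.IsClose n F ∧ N.IsClose n G := by
  classical
  have hm' : ∀ ω, N.ray (h.symm ω) m = N.ray ω m := fun ω ↦ by
    rw [← hm, h.apply_symm_apply]
  obtain ⟨b, hb1, hb2, hb3, hb4⟩ := N.exists_edgePerm hL hm
  obtain ⟨f, hf1, hf2⟩ := N.exists_vertexMap h.continuous hm
  obtain ⟨g, hg1, hg2⟩ := N.exists_vertexMap h.symm.continuous hm'
  have hb2' : ∀ e, b.symm e = e ∨ ∃ u, N.depth u = m ∧ N.Le u (N.src e) ∧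
      N.Le u (N.src (b.symm e)) := by
    intro e
    obtain ⟨e, rfl⟩ := b.surjective e
    rw [b.symm_apply_apply]
    obtain h1 | ⟨u, hu, h1, h2⟩ := hb2 e
    exacts [Or.inl h1.symm, Or.inr ⟨u, hu, h2, h1⟩]
  obtain ⟨F, hF, hFc, hFt, hFl, hFe⟩ := N.exists_realization hmn hsrc hf1 hf2 hb2 hb3
  obtain ⟨G, hG, hGc, hGt, hGl, hGe⟩ := N.exists_realization hmn hsrc hg1 hg2 hb2' hb4
  have hbt : ∀ e, e ∉ N.treeEdge → b e ∉ N.treeEdge := fun e he hbe ↦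
    he (b.injective (hb1 _ hbe) ▸ hbe)
  have hbt' : ∀ e, e ∉ N.treeEdge → b.symm e ∉ N.treeEdge := fun e he hbe ↦ by
    have := hb1 _ hbe
    rw [b.apply_symm_apply] at this
    exact he (this ▸ hbe)
  have hbm : ∀ c : Equiv.Perm E, (∀ e, c e = e ∨ ∃ u, N.depth u = m ∧ N.Le u (N.src e) ∧
      N.Le u (N.src (c e))) → ∀ e, m ≤ N.depth (N.tgt e) → m ≤ N.depth (N.tgt (c e)) := by
    intro c hc e he
    obtain h1 | ⟨u, hu, -, h2⟩ := hc e
    · rwa [h1]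
    · exact hu ▸ (h2.trans (N.le_src_tgt _)).depth_le
  obtain ⟨S, hSv, hSe, hS⟩ := N.exists_edgeMap
    (fun e ↦ if e ∈ N.treeEdge ∨ N.depth (N.tgt e) < m then .id I else stretch.comp stretch)
    (fun e ↦ by
      split_ifs
      · rfl
      · simp [stretch_eq_zero])
    (fun e ↦ by
      split_ifs
      · rfl
      · have : stretch 1 = 1 := stretch_eq_one (by norm_num)
        simp [this])
  have hSend : S.endMap = id := by
    rw [hS.endMap_eq]
    exact funext ProperMap.endMap_id
  have key : ∀ (P Q : ProperMap X X) (c : Equiv.Perm E),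
      (∀ e, e ∉ N.treeEdge → c e ∉ N.treeEdge) →
      (∀ e, m ≤ N.depth (N.tgt e) → m ≤ N.depth (N.tgt (c e))) →
      (∀ x ∈ N.tree, P.map x ∈ N.tree) → (∀ x ∈ N.tree, Q.map x ∈ N.tree) →
      (∀ e s, N.depth (N.tgt e) < m → P.map (N.edge e s) = N.edge e s) →
      (∀ e s, N.depth (N.tgt e) < m → Q.map (N.edge e s) = N.edge e s) →
      (∀ e ∉ N.treeEdge, m ≤ N.depth (N.tgt e) → ∀ s,
        P.map (N.edge e s) = N.edge (c e) (stretch s) ∨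
          P.map (N.edge e s) ∈ N.tree ∧ (stretch s = 0 ∨ stretch s = 1)) →
      (∀ e ∉ N.treeEdge, m ≤ N.depth (N.tgt e) → ∀ s,
        Q.map (N.edge e s) = N.edge (c.symm e) (stretch s) ∨
          Q.map (N.edge e s) ∈ N.tree ∧ (stretch s = 0 ∨ stretch s = 1)) →
      (∀ ω, Q.endMap (P.endMap ω) = ω) → ProperHomotopic (Q.comp P) (ProperMap.id X) := by
    intro P Q c hct hcm hPt hQt hPl hQl hPe hQe hend
    refine (N.properHomotopic_of_tree (fun x ↦ ?_) ?_ : ProperHomotopic (Q.comp P) S).trans hS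
    · have h01 : ∀ (e : E) (t : I), t = 0 ∨ t = 1 → N.edge e t ∈ N.tree := by
        rintro e t (rfl | rfl)
        · rw [N.edge_zero]
          exact N.vtx_mem_tree _
        · rw [N.edge_one]
          exact N.vtx_mem_tree _
      have hst : ∀ t : I, t = 0 ∨ t = 1 → stretch t = 0 ∨ stretch t = 1 := by
        rintro t (rfl | rfl)
        · exact Or.inl (stretch_eq_zero (by norm_num))
        · exact Or.inr (stretch_eq_one (by norm_num))
      change Q.map (P.map x) = S.map x ∨ Q.map (P.map x) ∈ _ ∧ S.map x ∈ _
      obtain ⟨v, rfl⟩ | ⟨e, s, rfl⟩ := N.vtx_or_edge x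
      · exact Or.inr ⟨hQt _ (hPt _ (N.vtx_mem_tree v)), by rw [hSv]; exact N.vtx_mem_tree v⟩
      · rw [hSe]
        by_cases he : e ∈ N.treeEdge ∨ N.depth (N.tgt e) < m
        · rw [if_pos he]
          obtain he | he := he
          · exact Or.inr ⟨hQt _ (hPt _ (N.edge_mem_tree he s)), N.edge_mem_tree he _⟩
          · exact Or.inl (by rw [hPl e s he, hQl e s he]; rfl)
        · rw [if_neg he]
          rw [not_or, not_lt] at he
          rw [ContinuousMap.comp_apply]
          obtain h1 | ⟨h1, h2⟩ := hPe e he.1 he.2 s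
          · rw [h1]
            obtain h3 | ⟨h3, h4⟩ := hQe (c e) (hct e he.1) (hcm e he.2) (stretch s)
            · exact Or.inl (by rw [h3, c.symm_apply_apply])
            · exact Or.inr ⟨h3, h01 _ _ h4⟩
          · exact Or.inr ⟨hQt _ h1, h01 _ _ (hst _ h2)⟩
    · rw [hSend]
      funext ω
      rw [ProperMap.endMap_comp]
      exact hend ω
  refine ⟨F, G, ?_, ?_, hF, hFc, hGc⟩
  · exact key G F b.symm hbt' (hbm _ hb2') hGt hFt hGl hFl hGe hFe fun ω ↦ by
      rw [hF, hG, h.apply_symm_apply]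
  · exact key F G b hbt (hbm _ hb2) hFt hGt hFl hGl hFe hGe fun ω ↦ by
      rw [hF, hG, h.symm_apply_apply]

end TreeModel

end LocallyFiniteGraph

end

noncomputable section

namespace LocallyFiniteGraph

universe u v w

open unitInterval

/-! ### The topology of the end compactification -/

section Limit

variable {X : Type u} [TopologicalSpace X]

theorem Freudenthal.preimage_limit_basicSet (K : Compacts X)
    (U : ConnectedComponents ((K : Set X)ᶜ : Set X)) :
    Freudenthal.limit ⁻¹' Freudenthal.basicSet K U = {ω : EndSpace X | ω.component K = U} := by
  ext ω
  constructor
  · rintro (⟨_, _, h⟩ | ⟨η, hη, h⟩)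
    · cases h
    · cases h
      exact hη
  · exact fun h ↦ Or.inr ⟨ω, h, rfl⟩

theorem Freudenthal.preimage_point_basicSet (K : Compacts X)
    (U : ConnectedComponents ((K : Set X)ᶜ : Set X)) :
    Freudenthal.point ⁻¹' Freudenthal.basicSet K U = compSet K U := by
  ext x
  constructor
  · rintro (⟨y, hy, h⟩ | ⟨_, _, h⟩)
    · cases h
      exact hy
    · cases h
  · exact fun h ↦ Or.inl ⟨x, h, rfl⟩

theorem Freudenthal.isOpen_basicSet (K : Compacts X)
    (U : ConnectedComponents ((K : Set X)ᶜ : Set X)) : IsOpen (Freudenthal.basicSet K U) :=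
  isOpen_generateFrom_of_mem (Or.inr ⟨K, U, rfl⟩)

theorem EndSpace.isOpen_component_eq (K : Compacts X)
    (U : ConnectedComponents ((K : Set X)ᶜ : Set X)) :
    IsOpen {ω : EndSpace X | ω.component K = U} := by
  let _ : TopologicalSpace (ConnectedComponents ((K : Set X)ᶜ : Set X)) := ⊥
  have : DiscreteTopology (ConnectedComponents ((K : Set X)ᶜ : Set X)) := ⟨rfl⟩
  exact (isOpen_discrete {U}).preimage (EndSpace.continuous_eval K)

theorem Freudenthal.isInducing_limit :
    IsInducing (Freudenthal.limit : EndSpace X → Freudenthal X) := by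
  refine ⟨le_antisymm ?_ (le_iInf fun K ↦ ?_)⟩
  · rw [← continuous_iff_le_induced]
    refine continuous_generateFrom_iff.2 ?_
    rintro s (⟨U, hU, rfl⟩ | ⟨K, U, rfl⟩)
    · convert isOpen_empty
      ext ω
      simp
    · rw [Freudenthal.preimage_limit_basicSet]
      exact EndSpace.isOpen_component_eq K U
  · let _ : TopologicalSpace (ConnectedComponents ((K : Set X)ᶜ : Set X)) := ⊥
    have : DiscreteTopology (ConnectedComponents ((K : Set X)ᶜ : Set X)) := ⟨rfl⟩
    rw [← continuous_iff_le_induced]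
    let _ : TopologicalSpace (EndSpace X) :=
      TopologicalSpace.induced Freudenthal.limit Freudenthal.instTopologicalSpace
    refine continuous_discrete_rng.2 fun U ↦ ⟨_, Freudenthal.isOpen_basicSet K U, ?_⟩
    rw [Freudenthal.preimage_limit_basicSet]
    rfl

/-- The map induced on ends depends continuously on the extension to the compactification. -/
theorem continuous_endAction_toMaps :
    Continuous fun p : HomotopyInversePair X ↦ endAction p.toMaps := by
  refine continuous_induced_rng.2 ?_
  let L : C(EndSpace X, Freudenthal X) := ⟨_, Freudenthal.isInducing_limit.continuous⟩
  -- After including `∂X` in the compactification, the map to be checked is restriction of `f̂` to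
  -- `∂X`, a precomposition.
  refine (ContinuousMap.isInducing_postcomp L Freudenthal.isInducing_limit).continuous_iff.2 ?_
  have h : Continuous fun p : HomotopyInversePair X ↦ (p.1.1.hat, p.1.2.hat) :=
    continuous_induced_dom
  exact (ContinuousMap.continuous_precomp L).comp (continuous_fst.comp h)

theorem continuous_endAction : Continuous (endAction (X := X)) :=
  continuous_coinduced_dom.2 continuous_endAction_toMaps

theorem exists_toMaps_eq (φ : Maps X) : ∃ p : HomotopyInversePair X, p.toMaps = φ := by
  obtain ⟨f, hf⟩ := Quotient.exists_rep φ.val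
  obtain ⟨g, hg⟩ := Quotient.exists_rep φ.inv
  have h1 : (f : (properHomotopyCon X).Quotient) = φ.val := hf
  have h2 : (g : (properHomotopyCon X).Quotient) = φ.inv := hg
  refine ⟨⟨(f, g), (properHomotopyCon X).eq.1 ?_, (properHomotopyCon X).eq.1 ?_⟩, Units.ext h1⟩
  · change ((f * g : ProperMap X X) : (properHomotopyCon X).Quotient) = (1 : ProperMap X X)
    rw [Con.coe_mul, h1, h2, φ.val_inv]
    rfl
  · change ((g * f : ProperMap X X) : (properHomotopyCon X).Quotient) = (1 : ProperMap X X)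
    rw [Con.coe_mul, h1, h2, φ.inv_val]
    rfl

end Limit

/-! ### Neighbourhoods of ends in the compactification, and the action near the identity -/

namespace TreeModel

variable {X : Type u} [TopologicalSpace X] [T2Space X] {V : Type v} {E : Type w}
  (N : TreeModel X V E)

-- Graphs are locally connected: on an edge, an interval that avoids `K` stays in one component.
-- Openness may be tested on edges, as continuity of the membership predicate.
include N in
theorem isOpen_compSet (K : Compacts X) (U : ConnectedComponents ((K : Set X)ᶜ : Set X)) :
    IsOpen (compSet K U) := by
  refine continuous_Prop.1 (N.continuous_of_edges fun e ↦ continuous_Prop.2 ?_)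
  change IsOpen {s | N.edge e s ∈ compSet K U}
  refine isOpen_iff_mem_nhds.2 fun s hs ↦ ?_
  have ho : IsOpen (N.edge e ⁻¹' (K : Set X)ᶜ) :=
    K.isCompact.isClosed.isOpen_compl.preimage (N.edge e).continuous
  have hsK : s ∈ N.edge e ⁻¹' (K : Set X)ᶜ := compSet_subset_compl K U hs
  refine Filter.mem_of_superset (ordConnectedComponent_mem_nhds.2 (ho.mem_nhds hsK)) fun t ht ↦ ?_
  have hc : IsPreconnected (ordConnectedComponent (N.edge e ⁻¹' (K : Set X)ᶜ) s) :=
    OrdConnected.isPreconnected inferInstance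
  refine subset_compSet (hc.image _ (N.edge e).continuous.continuousOn) ?_
    ⟨_, ⟨s, self_mem_ordConnectedComponent.2 hsK, rfl⟩, hs⟩ ⟨t, ht, rfl⟩
  rw [disjoint_left]
  rintro _ ⟨r, hr, rfl⟩
  exact ordConnectedComponent_subset hr

include N in
theorem continuous_point : Continuous (Freudenthal.point : X → Freudenthal X) := by
  refine continuous_generateFrom_iff.2 ?_
  rintro s (⟨U, hU, rfl⟩ | ⟨K, U, rfl⟩)
  · rwa [preimage_image_eq _ fun _ _ h ↦ by cases h; rfl]
  · rw [Freudenthal.preimage_point_basicSet]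
    exact N.isOpen_compSet K U

/-- The union of the cone of depth `n` that contains an end with the ends in that cone. -/
def hatCone (ω : EndSpace X) (n : ℕ) : Set (Freudenthal X) :=
  Freudenthal.point '' N.cone (N.ray ω n) ∪ Freudenthal.limit '' {η | N.ray η n = N.ray ω n}

theorem hatCone_subset {ω : EndSpace X} {m n : ℕ} (h : m ≤ n) : N.hatCone ω n ⊆ N.hatCone ω m :=
  union_subset_union (image_mono (N.cone_subset_cone (N.ray_le h)))
    (image_mono fun _ hη ↦ N.ray_eq_of_le h hη)

theorem exists_hatCone_subset {U : Set (Freudenthal X)} (hU : IsOpen U) {ω : EndSpace X}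
    (hω : Freudenthal.limit ω ∈ U) : ∃ n, N.hatCone ω n ⊆ U := by
  induction hU with
  | basic s hs =>
    obtain ⟨U, -, rfl⟩ | ⟨K, U, rfl⟩ := hs
    · simp at hω
    · have hω : ω.component K = U := by
        rw [← mem_preimage, Freudenthal.preimage_limit_basicSet] at hω
        exact hω
      obtain ⟨n, -, hn⟩ := (N.hasBasis_endFilter_cone ω).mem_iff.1 (compSet_mem_endFilter ω K)
      rw [hω] at hn
      refine ⟨n, union_subset_union (image_mono hn) (image_mono fun η hη ↦ ?_)⟩
      obtain ⟨x, hx, hx'⟩ := Filter.nonempty_of_mem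
        (Filter.inter_mem (compSet_mem_endFilter η K) (N.cone_ray_mem η n))
      rw [show N.ray η n = N.ray ω n from hη] at hx'
      exact eq_of_mem_compSet hx (hn hx')
  | univ => exact ⟨0, subset_univ _⟩
  | inter s t _ _ ihs iht =>
    obtain ⟨m, hm⟩ := ihs hω.1
    obtain ⟨n, hn⟩ := iht hω.2
    exact ⟨max m n, subset_inter ((N.hatCone_subset (le_max_left _ _)).trans hm)
      ((N.hatCone_subset (le_max_right _ _)).trans hn)⟩
  | sUnion S _ ih =>
    obtain ⟨s, hs, hωs⟩ := hω
    obtain ⟨n, hn⟩ := ih s hs hωs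
    exact ⟨n, hn.trans (subset_sUnion_of_mem hs)⟩

theorem hatCone_mem_nhds (ω : EndSpace X) (n : ℕ) :
    N.hatCone ω n ∈ 𝓝 (Freudenthal.limit ω) := by
  refine Filter.mem_of_superset ((Freudenthal.isOpen_basicSet (N.ball n)
    (ω.component (N.ball n))).mem_nhds (Or.inr ⟨ω, rfl, rfl⟩)) ?_
  have hsub := N.compSet_subset_cone_ray ω n
  refine union_subset_union (image_mono hsub) (image_mono fun η hη ↦ ?_)
  have h1 := N.compSet_subset_cone_ray η n
  rw [show η.component (N.ball n) = ω.component (N.ball n) from hη] at h1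
  obtain ⟨x, hx⟩ := compSet_nonempty (N.ball n) (ω.component (N.ball n))
  exact (N.le_of_mem_cone (h1 hx) (hsub hx) (by simp)).eq_of_depth_le (by simp)

/-! ### Maps close to the identity -/

variable {N}

theorem IsClose.mono {m n : ℕ} (h : m ≤ n) {F : ProperMap X X} (hF : N.IsClose n F) :
    N.IsClose m F := fun x ↦ (hF x).imp_right fun ⟨u, hu, h1, h2⟩ ↦
  ⟨N.anc u m, N.depth_anc (by omega), N.cone_subset_cone (N.anc_le u m) h1,
    N.cone_subset_cone (N.anc_le u m) h2⟩

/-- Distinct cones of one depth are disjoint, so the cone within which the point moves is the cone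
of `u`. -/
theorem IsClose.mapsTo_cone {u : V} {F : ProperMap X X} (hF : N.IsClose (N.depth u) F) :
    MapsTo F.map (N.cone u) (N.cone u) := by
  intro x hx
  obtain h | ⟨v, hv, h1, h2⟩ := hF x
  · rwa [h]
  · rwa [(N.le_of_mem_cone hx h1 hv.ge).eq_of_depth_le hv.le]

theorem IsClose.ray_endMap {n : ℕ} {F : ProperMap X X} (hF : N.IsClose n F) (ω : EndSpace X) :
    N.ray (F.endMap ω) n = N.ray ω n := by
  have hF' : N.IsClose (N.depth (N.ray ω n)) F := by rwa [N.depth_ray]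
  have h := N.eq_ray (F := Filter.map F.map (endFilter ω)) (F.tendsto_endFilter ω)
    (u := N.ray ω n)
    (Filter.mem_map.2 (Filter.mem_of_superset (N.cone_ray_mem ω n) hF'.mapsTo_cone))
  rw [N.depth_ray] at h
  exact h.symm

theorem IsClose.mapsTo_hatCone {n : ℕ} {F : ProperMap X X} (hF : N.IsClose n F)
    (ω : EndSpace X) : MapsTo F.hat (N.hatCone ω n) (N.hatCone ω n) := by
  have hF' : N.IsClose (N.depth (N.ray ω n)) F := by rwa [N.depth_ray]
  rintro _ (⟨x, hx, rfl⟩ | ⟨η, hη, rfl⟩)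
  · exact Or.inl ⟨_, hF'.mapsTo_cone hx, rfl⟩
  · exact Or.inr ⟨_, (hF.ray_endMap η).trans hη, rfl⟩

variable (N)

/-- A compact neighbourhood of a point misses all deep cones, so close maps are the identity on it;
near an end they preserve a deep cone. Compactness of `K` makes the depth uniform. -/
theorem exists_isClose_mapsTo {K U : Set (Freudenthal X)} (hK : IsCompact K) (hU : IsOpen U)
    (hKU : K ⊆ U) : ∃ n, ∀ F : ProperMap X X, N.IsClose n F → MapsTo F.hat K U := by
  have := N.weaklyLocallyCompactSpace
  suffices H : K ⊆ U → ∃ n, ∀ F : ProperMap X X, N.IsClose n F → MapsTo F.hat K U from H hKU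
  clear hKU
  refine fun hKU ↦ hK.induction_on (p := fun s ↦ ∃ n, ∀ F : ProperMap X X, N.IsClose n F →
    MapsTo F.hat s U) ⟨0, fun F _ ↦ mapsTo_empty _ _⟩
    (fun s t hst ⟨n, hn⟩ ↦ ⟨n, fun F hF ↦ (hn F hF).mono_left hst⟩)
    (fun s t ⟨m, hm⟩ ⟨n, hn⟩ ↦ ⟨max m n, fun F hF ↦ (hm F (hF.mono (le_max_left _ _))).union_union
      (hn F (hF.mono (le_max_right _ _))) |>.mono_right (union_self U).subset⟩) ?_
  rintro (x | ω) hy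
  · obtain ⟨C, hC, hxC⟩ := exists_compact_mem_nhds x
    obtain ⟨n, hn⟩ := N.exists_disjoint_cone hC
    refine ⟨Freudenthal.point '' (interior C ∩ Freudenthal.point ⁻¹' U),
      mem_nhdsWithin_of_mem_nhds (IsOpen.mem_nhds (isOpen_generateFrom_of_mem (Or.inl ⟨_,
        isOpen_interior.inter (hU.preimage N.continuous_point), rfl⟩))
        ⟨x, ⟨mem_interior_iff_mem_nhds.2 hxC, hKU hy⟩, rfl⟩), n, fun F hF ↦ ?_⟩
    rintro _ ⟨y, ⟨hyC, hyU⟩, rfl⟩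
    obtain h | ⟨u, hu, h1, -⟩ := hF y
    · change Freudenthal.point (F.map y) ∈ U
      rwa [h]
    · exact absurd (interior_subset hyC) (disjoint_left.1 (hn u hu.ge) h1)
  · obtain ⟨n, hn⟩ := N.exists_hatCone_subset hU (hKU hy)
    exact ⟨N.hatCone ω n, mem_nhdsWithin_of_mem_nhds (N.hatCone_mem_nhds ω n), n,
      fun F hF ↦ (hF.mapsTo_hatCone ω).mono_right hn⟩

theorem exists_isClose_hat_mem {W : Set C(Freudenthal X, Freudenthal X)}
    (hW : W ∈ 𝓝 (ContinuousMap.id (Freudenthal X))) :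
    ∃ n, ∀ F : ProperMap X X, N.IsClose n F → F.hat ∈ W := by
  have hb : (⨅ n, Filter.principal {F : ProperMap X X | N.IsClose n F}).HasBasis
      (fun _ : ℕ ↦ True) fun n ↦ {F | N.IsClose n F} :=
    Filter.hasBasis_iInf_principal (directed_of_isDirected_le fun m n h F hF ↦ IsClose.mono h hF)
  have ht : Filter.Tendsto (ProperMap.hat (X := X) (Y := X))
      (⨅ n, Filter.principal {F : ProperMap X X | N.IsClose n F})
      (𝓝 (ContinuousMap.id (Freudenthal X))) :=
    ContinuousMap.tendsto_nhds_compactOpen.2 fun K hK U hU hKU ↦ by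
      obtain ⟨n, hn⟩ := N.exists_isClose_mapsTo hK hU hKU
      exact hb.eventually_iff.2 ⟨n, trivial, fun F hF ↦ hn F hF⟩
  obtain ⟨n, -, hn⟩ := hb.mem_iff.1 (ht hW)
  exact ⟨n, fun F hF ↦ hn hF⟩

/-! ### The action on the space of ends -/

theorem endAction_mem_loopEnds_iff (φ : Maps X) (ω : EndSpace X) :
    endAction φ ω ∈ N.loopEnds ↔ ω ∈ N.loopEnds := by
  obtain ⟨p, rfl⟩ := exists_toMaps_eq φ
  refine ⟨fun h ↦ ?_, fun h ↦ endMap_mem_loopEnds p.2.2 h⟩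
  have h1 := endMap_mem_loopEnds p.2.1 h
  change p.1.2.endMap (p.1.1.endMap ω) ∈ _ at h1
  rwa [← ProperMap.endMap_comp, p.2.2.endMap_eq, ProperMap.endMap_id] at h1

theorem mem_homeoPair_loopEnds {h : EndSpace X ≃ₜ EndSpace X} :
    h ∈ homeoPair (EndSpace X) N.loopEnds ↔ ∀ ω, h ω ∈ N.loopEnds ↔ ω ∈ N.loopEnds := by
  constructor
  · intro (hh : h '' N.loopEnds = N.loopEnds) ω
    conv_lhs => rw [← hh]
    exact h.injective.mem_set_image
  · intro hh
    refine Subset.antisymm ?_ fun ω hω ↦ ⟨h.symm ω, ?_, h.apply_symm_apply ω⟩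
    · rintro _ ⟨ω, hω, rfl⟩
      exact (hh ω).2 hω
    · rwa [← hh, h.apply_symm_apply]

/-- At depth `m` there are finitely many vertices, and the ends through each form a clopen set of
the compact space of ends. The condition is a finite intersection of subbasic sets of the
compact-open topology. -/
theorem isOpen_setOf_ray_eq (h₀ : EndSpace X ≃ₜ EndSpace X) (m : ℕ) :
    IsOpen {h : EndSpace X ≃ₜ EndSpace X | ∀ ω, N.ray (h ω) m = N.ray (h₀ ω) m} := by
  have := N.compactSpace_end
  have hclosed : ∀ u, IsClosed {ω : EndSpace X | N.ray ω m = u} := fun u ↦ by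
    rw [← isOpen_compl_iff, show {ω : EndSpace X | N.ray ω m = u}ᶜ =
      ⋃ v ∈ ({u}ᶜ : Set V), {ω : EndSpace X | N.ray ω m = v} by ext ω; simp]
    exact isOpen_biUnion fun v _ ↦ N.isOpen_ray_eq m v
  have heq : {h : EndSpace X ≃ₜ EndSpace X | ∀ ω, N.ray (h ω) m = N.ray (h₀ ω) m} =
      ⋂ u ∈ {u | N.depth u = m}, (fun h : EndSpace X ≃ₜ EndSpace X ↦
        (h : C(EndSpace X, EndSpace X))) ⁻¹' {f : C(EndSpace X, EndSpace X) |
          MapsTo f (h₀ ⁻¹' {ω | N.ray ω m = u}) {ω | N.ray ω m = u}} := by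
    ext h
    simp only [mem_ofPred_eq, mem_iInter, mem_preimage]
    constructor
    · intro hh u _ ω hω
      exact (hh ω).trans hω
    · intro hh ω
      exact hh (N.ray (h₀ ω) m) (N.depth_ray _ _) rfl
  rw [heq]
  refine (N.finite_depth_eq m).isOpen_biInter fun u _ ↦ IsOpen.preimage continuous_induced_dom ?_
  exact ContinuousMap.isOpen_setOfPred_mapsTo ((hclosed u).preimage h₀.continuous).isCompact
    (N.isOpen_ray_eq m u)

/-- A homeomorphism `h` close to the action of `p` differs from it by some `k` that fixes ray
vertices of large depth. Realising `k` close to the identity and composing with `p` gives a class in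
`O` that acts as `h`. -/
theorem isOpenMap_endAction
    (hσ : ∀ φ : Maps X, endAction φ ∈ homeoPair (EndSpace X) N.loopEnds) :
    IsOpenMap (endAction.codRestrict (homeoPair (EndSpace X) N.loopEnds) hσ) := by
  intro O hO
  refine isOpen_iff_mem_nhds.2 ?_
  rintro _ ⟨φ, hφ, rfl⟩
  obtain ⟨p, rfl⟩ := exists_toMaps_eq φ
  have hO' : IsOpen (HomotopyInversePair.toMaps ⁻¹' O) := isOpen_coinduced.1 hO
  obtain ⟨W, hW, hWO⟩ := isOpen_induced_iff.1 hO'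
  have hpW : (p.1.1.hat, p.1.2.hat) ∈ W := by
    have : p ∈ HomotopyInversePair.toMaps ⁻¹' O := hφ
    rwa [← hWO] at this
  -- Only compositions with fixed maps occur, each continuous in the compact-open topology. The
  -- inverse pair is composed in the opposite order.
  let Φ : C(Freudenthal X, Freudenthal X) × C(Freudenthal X, Freudenthal X) →
      C(Freudenthal X, Freudenthal X) × C(Freudenthal X, Freudenthal X) :=
    fun q ↦ (q.1.comp p.1.1.hat, p.1.2.hat.comp q.2)
  have hΦ : Continuous Φ :=
    ((ContinuousMap.continuous_precomp _).comp continuous_fst).prodMk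
      ((ContinuousMap.continuous_postcomp _).comp continuous_snd)
  have hΦW : Φ ⁻¹' W ∈ 𝓝 (ContinuousMap.id (Freudenthal X), ContinuousMap.id (Freudenthal X)) :=
    (hW.preimage hΦ).mem_nhds hpW
  rw [nhds_prod_eq] at hΦW
  obtain ⟨W₁, hW₁, W₂, hW₂, hsub⟩ := Filter.mem_prod_iff.1 hΦW
  obtain ⟨n, hn⟩ := N.exists_isClose_hat_mem (Filter.inter_mem hW₁ hW₂)
  obtain ⟨m, hnm, hm⟩ := N.exists_le_src_of_le_tgt n
  refine Filter.mem_of_superset (((N.isOpen_setOf_ray_eq (endAction p.toMaps) m).preimage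
    continuous_subtype_val).mem_nhds fun ω ↦ rfl) ?_
  rintro ⟨h, hh⟩ (hray : ∀ ω, N.ray (h ω) m = N.ray (endAction p.toMaps ω) m)
  let k : EndSpace X ≃ₜ EndSpace X := (endAction p.toMaps).symm.trans h
  have hk : ∀ ω, k ω ∈ N.loopEnds ↔ ω ∈ N.loopEnds := fun ω ↦ by
    change h ((endAction p.toMaps).symm ω) ∈ _ ↔ _
    rw [N.mem_homeoPair_loopEnds.1 hh, ← N.endAction_mem_loopEnds_iff p.toMaps,
      Homeomorph.apply_symm_apply]
  obtain ⟨F, G, hFG, hGF, hF, hFc, hGc⟩ := N.exists_equivalence hk hnm hm fun ω ↦ by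
    change N.ray (h ((endAction p.toMaps).symm ω)) m = _
    rw [hray, Homeomorph.apply_symm_apply]
  let q : HomotopyInversePair X := ⟨(F.comp p.1.1, p.1.2.comp G),
    ((ProperHomotopic.refl F).comp (p.2.1.comp (ProperHomotopic.refl G))).trans hFG,
    ((ProperHomotopic.refl p.1.2).comp (hGF.comp (ProperHomotopic.refl p.1.1))).trans p.2.2⟩
  have hhat : ∀ f g : ProperMap X X, (f.comp g).hat = f.hat.comp g.hat := fun f g ↦ by
    ext y
    obtain x | ω := y
    · rfl
    · exact congrArg Freudenthal.limit (f.endMap_comp g ω)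
  refine ⟨q.toMaps, ?_, Subtype.ext (Homeomorph.ext fun ω ↦ ?_)⟩
  · have hq : (F.hat, G.hat) ∈ Φ ⁻¹' W := hsub ⟨(hn F hFc).1, (hn G hGc).2⟩
    change q ∈ HomotopyInversePair.toMaps ⁻¹' O
    rw [← hWO]
    change ((F.comp p.1.1).hat, (p.1.2.comp G).hat) ∈ W
    rwa [hhat, hhat]
  · change (F.comp p.1.1).endMap ω = h ω
    rw [ProperMap.endMap_comp, hF]
    change h ((endAction p.toMaps).symm (endAction p.toMaps ω)) = h ω
    rw [Homeomorph.symm_apply_apply]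

/-- For a tree, mapping classes are determined by their action on ends, and all homeomorphisms of
the space of ends are realised. -/
theorem bijective_endAction (hN : N.treeEdge = univ) :
    Function.Bijective (endAction (X := X)) := by
  have hL : N.loopEnds = ∅ := eq_empty_of_forall_notMem fun ω hω ↦ by
    obtain ⟨e, he, -⟩ := hω 0
    exact he (hN ▸ mem_univ e)
  constructor
  · intro φ ψ h
    obtain ⟨p, rfl⟩ := exists_toMaps_eq φ
    obtain ⟨q, rfl⟩ := exists_toMaps_eq ψ
    refine Units.ext ((properHomotopyCon X).eq.2 (N.properHomotopic_of_tree (fun x ↦ ?_) ?_))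
    · rw [N.tree_eq_univ hN]
      exact Or.inr ⟨trivial, trivial⟩
    · exact funext fun ω ↦ DFunLike.congr_fun h ω
  · intro h
    -- At depth `0` every ray passes through the root, so the closeness condition is empty.
    obtain ⟨F, G, hFG, hGF, hF, -⟩ := N.exists_equivalence (h := h) (m := 0) (n := 0)
      (fun ω ↦ by simp [hL]) le_rfl (fun _ _ ↦ Nat.zero_le _) fun ω ↦ by
        rw [N.depth_eq_zero.1 (N.depth_ray (h ω) 0), N.depth_eq_zero.1 (N.depth_ray ω 0)]
    exact ⟨HomotopyInversePair.toMaps ⟨(F, G), hFG, hGF⟩, Homeomorph.ext fun ω ↦ congrFun hF ω⟩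

end TreeModel

end LocallyFiniteGraph

end

/-! ### The main theorem -/

theorem mainTheorem9 {X : Type*} [TopologicalSpace X] [T2Space X] [ConnectedSpace X]
    [Topology.CWComplex (Set.univ : Set X)] (hX : LocallyFiniteGraph.IsLocallyFiniteGraph X) :
    (∃ hσ : ∀ φ : LocallyFiniteGraph.Maps X, LocallyFiniteGraph.endAction φ ∈
        LocallyFiniteGraph.homeoPair (LocallyFiniteGraph.EndSpace X)
          (LocallyFiniteGraph.coreEnds X),
      Continuous (LocallyFiniteGraph.endAction.codRestrict
        (LocallyFiniteGraph.homeoPair (LocallyFiniteGraph.EndSpace X)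
          (LocallyFiniteGraph.coreEnds X)) hσ) ∧
      IsOpenMap (LocallyFiniteGraph.endAction.codRestrict
        (LocallyFiniteGraph.homeoPair (LocallyFiniteGraph.EndSpace X)
          (LocallyFiniteGraph.coreEnds X)) hσ)) ∧
    (LocallyFiniteGraph.IsTree X →
      ∃ e : LocallyFiniteGraph.Maps X ≃ₜ*
          (LocallyFiniteGraph.EndSpace X ≃ₜ LocallyFiniteGraph.EndSpace X),
        ∀ φ, e φ = LocallyFiniteGraph.endAction φ) := by
  obtain ⟨M, hMv, hMe⟩ := hX.exists_graphModel
  obtain ⟨N, hNv, hNe⟩ := M.exists_treeModel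
  rw [LocallyFiniteGraph.TreeModel.coreEnds_eq (N := N) hX (fun v ↦ by rw [hMv, hNv])
    fun e ↦ by rw [hMe, hNe]]
  have hσ : ∀ φ : LocallyFiniteGraph.Maps X, LocallyFiniteGraph.endAction φ ∈
      LocallyFiniteGraph.homeoPair (LocallyFiniteGraph.EndSpace X) N.loopEnds := fun φ ↦
    N.mem_homeoPair_loopEnds.2 (N.endAction_mem_loopEnds_iff φ)
  have hopen := N.isOpenMap_endAction hσ
  refine ⟨⟨hσ, LocallyFiniteGraph.continuous_endAction.subtype_mk _, hopen⟩, fun htree ↦ ?_⟩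
  have hN := N.treeEdge_eq_univ htree
  have hbij := N.bijective_endAction hN
  -- All homeomorphisms are realised, so the subgroup is everything; its inclusion is then an open
  -- map, and openness of `σ` carries over to the full homeomorphism group.
  have htop : (LocallyFiniteGraph.homeoPair (LocallyFiniteGraph.EndSpace X) N.loopEnds :
      Set (LocallyFiniteGraph.EndSpace X ≃ₜ LocallyFiniteGraph.EndSpace X)) = Set.univ :=
    Set.eq_univ_of_forall fun h ↦ by
      obtain ⟨φ, rfl⟩ := hbij.2 h
      exact hσ φ
  have hopen' : IsOpenMap (LocallyFiniteGraph.endAction (X := X)) :=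
    (IsOpen.isOpenMap_subtype_val (by rw [htop]; exact isOpen_univ)).comp hopen
  exact ⟨{ MulEquiv.ofBijective LocallyFiniteGraph.endAction hbij with
    continuous_toFun := LocallyFiniteGraph.continuous_endAction
    continuous_invFun := (Equiv.continuous_symm_iff
      (Equiv.ofBijective _ hbij)).2 hopen' }, fun _ ↦ rfl⟩
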